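/- Let $n\ge 2$, $t=n(n-1)/2$ and $d=n+t=n(n+1)/2$. Let $Y$ be the $d$-dimensional space of real symmetric $n\times n$ matrices, with a fixed orientation, and for a nonzero column vector $u\in\mathbb{Q}^n$ put $u'=u\,{}^tu\in Y$. **Sharblies.** $Sh_k$ is the $\mathbb{Q}$-vector space generated by the symbols $[v_1,\dots,v_{n+k}]$ ($v_i\in\mathbb{Q}^n\setminus\{0\}$) modulo (i) $[v_{\sigma(1)},\dots,v_{\sigma(n+k)}]=\operatorname{sign}(\sigma)[v_1,\dots,v_{n+k}]$ for all permutations $\sigma$, (ii) $[v_1,\dots,v_{n+k}]=0$ if the $v_i$ do not span $\mathbb{Q}^n$, (iii) $[av_1,v_2,\dots,v_{n+k}]=[v_1,\dots,v_{n+k}]$ for $a\in\mathbb{Q}^\times$. It carries the action $g[v_1,\dots,v_{n+k}]=[gv_1,\dots,gv_{n+k}]$ of $\mathrm{GL}_n(\mathbb{Q})$ and the equivariant boundary $\partial[v_1,\dots,v_{n+k}]=\sum_i(-1)^{i+1}[v_1,\dots,\widehat{v_i},\dots,v_{n+k}]\in Sh_{k-1}$. For $G\subset\mathrm{SL}_n(\mathbb{Z})$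 write $[v_1,\dots,v_{n+k}]_G$ for the image of $[v_1,\dots,v_{n+k}]$ in the coinvariants $Sh_k\otimes_G\mathbb{Q}$, on which $\partial$ induces a boundary map. A *flipon* is a symbol $[v_1,\dots,v_d]$ such that $v_1',\dots,v_d'$ lie in some $(d-2)$-dimensional affine subspace of $Y$; its image in the coinvariants is also called a flipon. **Tiles.** A positive definite real quadratic form $Q$ is perfect if the matrices $v'$, with $v$ running over the nonzero integral vectors at which $Q$ takes its minimum over $\mathbb{Z}^n\setminus\{0\}$, span $Y$; the convex cone $s_Q\subset Y$ generated by these $v'$ is then called a tile. $\mathrm{SL}_n(\mathbb{Z})$ acts on the tiles by $\gamma\cdot x=\gamma x\,{}^t\gamma$. The vertices of a tile are its extreme rays. A triangulation of a tile $T$ is a set of $d$-dimensional simplicial cones whose vertices are vertices of $T$, whose union is $T$, and any two of which meet in a common face. It is regular if there is a concave function on $T$ that is linear on each of these cones and whose domains of linearity are exactly these cones. For a $d$-dimensional simplicial cone $s$ generated by $v_1',\dots,v_d'$ ($v_i\in\mathbb{Q}^n\setminus\{0\}$), ordered so that the basis $(v_1',\dots,v_d')$ has the fixed orientation of $Y$,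 put $[s]=[v_1,\dots,v_d]$ (this does not depend on the choices) and $[s]_G=[v_1,\dots,v_d]_G$. **Theorem.** Let $G$ be a torsion-free subgroup of finite index in $\mathrm{SL}_n(\mathbb{Z})$. Let $R_G$ be a set of representatives of the $G$-orbits of tiles, choose a regular triangulation of each $T\in R_G$ (with no compatibility required between different tiles), and let $\mathcal{S}$ be the set of all simplicial cones in these triangulations. Then $\mathcal{S}$ is finite, and there are finitely many flipons $[y_1^\alpha,\dots,y_d^\alpha]$ such that $$z_G=\sum_{s\in\mathcal{S}}[s]_G+\sum_\alpha[y_1^\alpha,\dots,y_d^\alpha]_G\in Sh_t\otimes_G\mathbb{Q}$$ satisfies $\partial z_G=0$ in $Sh_{t-1}\otimes_G\mathbb{Q}$. -/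

import Mathlib

noncomputable section

/-! ### Sharblies -/

/-- The nonzero column vectors in `ℚⁿ`. -/
abbrev NZVec (n : ℕ) : Type := {v : Fin n → ℚ // v ≠ 0}

instance NZVec.instMulActionGL (n : ℕ) : MulAction (GL (Fin n) ℚ) (NZVec n) where
  smul g v := ⟨(g : Matrix (Fin n) (Fin n) ℚ).mulVec v.1, fun h => v.2 (by
    have h2 := congrArg (fun x => ((g⁻¹ : GL (Fin n) ℚ) : Matrix (Fin n) (Fin n) ℚ).mulVec x) h
    simpa [Matrix.mulVec_mulVec] using h2)⟩
  one_smul v := Subtype.ext (Matrix.one_mulVec v.1)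
  mul_smul g h v := Subtype.ext (by
    change (((g * h : GL (Fin n) ℚ) : Matrix (Fin n) (Fin n) ℚ)).mulVec v.1 =
      (g : Matrix (Fin n) (Fin n) ℚ).mulVec ((h : Matrix (Fin n) (Fin n) ℚ).mulVec v.1)
    rw [Matrix.mulVec_mulVec, Units.val_mul])

theorem NZVec.gl_smul_val {n : ℕ} (g : GL (Fin n) ℚ) (v : NZVec n) :
    (g • v).1 = (g : Matrix (Fin n) (Fin n) ℚ).mulVec v.1 := rfl

/-- The nonzero vector `a v`, for `a ∈ ℚˣ`. -/
def NZVec.scale {n : ℕ} (a : ℚˣ) (v : NZVec n) : NZVec n :=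
  ⟨(a : ℚ) • v.1, smul_ne_zero a.ne_zero v.2⟩

/-- The vectors `v₁, …, v_m` span `ℚⁿ`. -/
def SpansTop {n m : ℕ} (v : Fin m → NZVec n) : Prop :=
  Submodule.span ℚ (Set.range fun i => (v i).1) = ⊤

/-- The relations between the symbols `[v₁, …, v_m]`: (i) antisymmetry; (ii) non-spanning symbols
vanish; (iii) rescaling one of the vectors by a nonzero rational number changes nothing.
(In the presence of (i), it does not matter in (iii) which of the vectors is rescaled.) -/
def sharblyRel (n m : ℕ) : Submodule ℚ ((Fin m → NZVec n) →₀ ℚ) :=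
  Submodule.span ℚ
    ({x | ∃ (v : Fin m → NZVec n) (σ : Equiv.Perm (Fin m)),
        x = Finsupp.single (v ∘ σ) 1 - ((Equiv.Perm.sign σ : ℤ) : ℚ) • Finsupp.single v 1} ∪
     {x | ∃ v : Fin m → NZVec n, ¬ SpansTop v ∧ x = Finsupp.single v 1} ∪
     {x | ∃ (v : Fin m → NZVec n) (i : Fin m) (a : ℚˣ),
        x = Finsupp.single v 1 - Finsupp.single (Function.update v i ((v i).scale a)) 1})

/-- The `ℚ`-vector space `Sh_k` of `k`-sharblies. -/
abbrev Sharbly (n k : ℕ) : Type :=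
  ((Fin (n + k) → NZVec n) →₀ ℚ) ⧸ sharblyRel n (n + k)

/-- The basic sharbly `[v₁, …, v_{n+k}]`. -/
def basicSharbly {n k : ℕ} (v : Fin (n + k) → NZVec n) : Sharbly n k :=
  (sharblyRel n (n + k)).mkQ (Finsupp.single v 1)

/-- `g [v₁, …, v_m] = [g v₁, …, g v_m]` on free symbols. -/
def freeAct (n m : ℕ) (g : GL (Fin n) ℚ) :
    ((Fin m → NZVec n) →₀ ℚ) →ₗ[ℚ] ((Fin m → NZVec n) →₀ ℚ) :=
  Finsupp.lmapDomain ℚ ℚ (fun v => g • v)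

theorem freeAct_single {n m : ℕ} (g : GL (Fin n) ℚ) (v : Fin m → NZVec n) (c : ℚ) :
    freeAct n m g (Finsupp.single v c) = Finsupp.single (g • v) c := by
  simp [freeAct]

theorem SpansTop.of_gl_smul {n m : ℕ} {g : GL (Fin n) ℚ} {v : Fin m → NZVec n}
    (h : SpansTop (g • v)) : SpansTop v := by
  unfold SpansTop at *
  rw [eq_top_iff]
  intro x _
  have hx : (g : Matrix (Fin n) (Fin n) ℚ).mulVec x ∈
      Submodule.span ℚ (Set.range fun i => ((g • v) i).1) := by rw [h]; trivial
  have key : ∀ y ∈ Submodule.span ℚ (Set.range fun i => ((g • v) i).1),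
      ((g⁻¹ : GL (Fin n) ℚ) : Matrix (Fin n) (Fin n) ℚ).mulVec y ∈
        Submodule.span ℚ (Set.range fun i => (v i).1) := by
    intro y hy
    induction hy using Submodule.span_induction with
    | mem y hy =>
      obtain ⟨i, rfl⟩ := hy
      have : ((g⁻¹ : GL (Fin n) ℚ) : Matrix (Fin n) (Fin n) ℚ).mulVec ((g • v) i).1 = (v i).1 := by
        rw [Pi.smul_apply, NZVec.gl_smul_val, Matrix.mulVec_mulVec, ← Units.val_mul]
        simp
      simp only [this]
      exact Submodule.subset_span ⟨i, rfl⟩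
    | zero => simp
    | add a b _ _ ha hb => rw [Matrix.mulVec_add]; exact add_mem ha hb
    | smul c a _ ha => rw [Matrix.mulVec_smul]; exact Submodule.smul_mem _ c ha
  have := key _ hx
  rw [Matrix.mulVec_mulVec, ← Units.val_mul] at this
  simpa using this

theorem freeAct_rel {n m : ℕ} (g : GL (Fin n) ℚ) :
    sharblyRel n m ≤ (sharblyRel n m).comap (freeAct n m g) := by
  refine Submodule.span_le.2 ?_
  rintro x ((⟨v, σ, rfl⟩ | ⟨v, hv, rfl⟩) | ⟨v, i, a, rfl⟩)
  · refine Submodule.subset_span (Or.inl (Or.inl ⟨g • v, σ, ?_⟩))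
    simp only [map_sub, map_smul, freeAct_single]
    rfl
  · refine Submodule.subset_span (Or.inl (Or.inr ⟨g • v, fun h => hv h.of_gl_smul, ?_⟩))
    rw [freeAct_single]
  · refine Submodule.subset_span (Or.inr ⟨g • v, i, a, ?_⟩)
    simp only [map_sub, freeAct_single]
    congr 2
    funext j
    by_cases h : j = i
    · subst h
      simp only [Pi.smul_apply, Function.update_self]
      exact Subtype.ext (Matrix.mulVec_smul (g : Matrix (Fin n) (Fin n) ℚ) (a : ℚ) (v j).1)
    · simp [Function.update_of_ne h]

/-- `Sh_k` as a representation of `GL_n(ℚ)`, with `g [v₁, …] = [g v₁, …]`. -/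
def sharblyRep (n k : ℕ) : Representation ℚ (GL (Fin n) ℚ) (Sharbly n k) where
  toFun g := (sharblyRel n (n + k)).mapQ _ (freeAct n (n + k) g) (freeAct_rel g)
  map_one' := by
    ext v
    simp [freeAct_single]
  map_mul' g h := by
    ext v
    simp [freeAct_single, mul_smul]

theorem sharblyRep_basic {n k : ℕ} (g : GL (Fin n) ℚ) (v : Fin (n + k) → NZVec n) :
    sharblyRep n k g (basicSharbly v) = basicSharbly (g • v) := by
  simp [sharblyRep, basicSharbly, freeAct_single]

/-- The alternating sum `∑ᵢ (-1)ⁱ⁺¹ [v₁, …, v̂ᵢ, …, v_{m+1}]` on free symbols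
(the index `i` starts from `0` in the code). -/
def freeBoundary (n m : ℕ) :
    ((Fin (m + 1) → NZVec n) →₀ ℚ) →ₗ[ℚ] ((Fin m → NZVec n) →₀ ℚ) :=
  Finsupp.linearCombination ℚ fun v =>
    ∑ i : Fin (m + 1), (-1 : ℚ) ^ (i : ℕ) • Finsupp.single (v ∘ i.succAbove) (1 : ℚ)

theorem freeBoundary_single {n m : ℕ} (v : Fin (m + 1) → NZVec n) :
    freeBoundary n m (Finsupp.single v 1) =
      ∑ i : Fin (m + 1), (-1 : ℚ) ^ (i : ℕ) • Finsupp.single (v ∘ i.succAbove) (1 : ℚ) := by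
  simp [freeBoundary]

theorem exists_perm_succAbove {m : ℕ} (σ : Equiv.Perm (Fin (m + 1))) (i : Fin (m + 1)) :
    ∃ τ : Equiv.Perm (Fin m), (∀ j, σ (i.succAbove j) = (σ i).succAbove (τ j)) ∧
      (-1 : ℚ) ^ (i : ℕ) * ((Equiv.Perm.sign τ : ℤ) : ℚ) =
        ((Equiv.Perm.sign σ : ℤ) : ℚ) * (-1 : ℚ) ^ ((σ i : Fin (m + 1)) : ℕ) := by
  let ρ : Equiv.Perm (Fin (m + 1)) := (σ i).cycleRange * σ * i.cycleRange⁻¹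
  have hρ0 : ρ 0 = 0 := by
    simp [ρ]
  obtain ⟨⟨p, τ⟩, hpτ⟩ := Equiv.Perm.decomposeFin.symm.surjective ρ
  have hp : p = 0 := by
    have := congrArg (fun f : Equiv.Perm (Fin (m + 1)) => f 0) hpτ
    simpa [hρ0] using this
  subst hp
  have hsucc : ∀ j : Fin m, ρ j.succ = (τ j).succ := by
    intro j
    rw [← hpτ, Equiv.Perm.decomposeFin_symm_apply_succ]
    simp
  refine ⟨τ, fun j => ?_, ?_⟩
  · have h1 : i.cycleRange⁻¹ j.succ = i.succAbove j := by
      rw [Equiv.Perm.inv_eq_iff_eq, Fin.cycleRange_succAbove]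
    have h2 := hsucc j
    simp only [ρ, Equiv.Perm.mul_apply, h1] at h2
    apply (σ i).cycleRange.injective
    rw [h2, Fin.cycleRange_succAbove]
  · have h3 : Equiv.Perm.sign τ = Equiv.Perm.sign ρ := by
      rw [← hpτ, Equiv.Perm.decomposeFin.symm_sign]; simp
    rw [h3]
    simp only [ρ, Equiv.Perm.sign_mul, Equiv.Perm.sign_inv, Fin.sign_cycleRange]
    push_cast
    have h4 : ((-1 : ℚ) ^ (i : ℕ)) * ((-1 : ℚ) ^ (i : ℕ)) = 1 := by
      rw [← mul_pow]; norm_num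
    linear_combination (((Equiv.Perm.sign σ : ℤ) : ℚ) * (-1 : ℚ) ^ ((σ i : Fin (m + 1)) : ℕ)) * h4

theorem freeBoundary_rel {n m : ℕ} :
    sharblyRel n (m + 1) ≤ (sharblyRel n m).comap (freeBoundary n m) := by
  refine Submodule.span_le.2 ?_
  rintro x ((⟨v, σ, rfl⟩ | ⟨v, hv, rfl⟩) | ⟨v, i, a, rfl⟩)
  · simp only [SetLike.mem_coe, Submodule.mem_comap, map_sub, map_smul, freeBoundary_single]
    rw [← Equiv.sum_comp σ (fun i : Fin (m + 1) =>
      (-1 : ℚ) ^ (i : ℕ) • Finsupp.single (v ∘ i.succAbove) (1 : ℚ)), Finset.smul_sum,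
      ← Finset.sum_sub_distrib]
    refine Submodule.sum_mem _ fun i _ => ?_
    obtain ⟨τ, h1, h2⟩ := exists_perm_succAbove σ i
    have h3 : (v ∘ σ) ∘ i.succAbove = (v ∘ (σ i).succAbove) ∘ τ := by
      funext j
      simp [h1]
    rw [h3, smul_smul, ← h2, ← smul_smul, ← smul_sub]
    exact Submodule.smul_mem _ _ (Submodule.subset_span (Or.inl (Or.inl ⟨_, τ, rfl⟩)))
  · simp only [SetLike.mem_coe, Submodule.mem_comap, freeBoundary_single]
    refine Submodule.sum_mem _ fun i _ => Submodule.smul_mem _ _ (Submodule.subset_span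
      (Or.inl (Or.inr ⟨_, fun h => hv ?_, rfl⟩)))
    unfold SpansTop at *
    rw [eq_top_iff, ← h]
    refine Submodule.span_mono ?_
    rintro _ ⟨j, rfl⟩
    exact ⟨i.succAbove j, rfl⟩
  · simp only [SetLike.mem_coe, Submodule.mem_comap, map_sub, freeBoundary_single]
    rw [← Finset.sum_sub_distrib]
    refine Submodule.sum_mem _ fun j _ => ?_
    rw [← smul_sub]
    refine Submodule.smul_mem _ _ ?_
    by_cases hij : i = j
    · subst hij
      have : Function.update v i ((v i).scale a) ∘ i.succAbove = v ∘ i.succAbove := by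
        funext l
        simp [Fin.succAbove_ne]
      rw [this, sub_self]
      exact zero_mem _
    · obtain ⟨l, rfl⟩ := Fin.exists_succAbove_eq hij
      have : Function.update v (j.succAbove l) ((v (j.succAbove l)).scale a) ∘ j.succAbove =
          Function.update (v ∘ j.succAbove) l (((v ∘ j.succAbove) l).scale a) :=
        Function.update_comp_eq_of_injective v Fin.succAbove_right_injective l _
      rw [this]
      exact Submodule.subset_span (Or.inr ⟨_, l, a, rfl⟩)

/-- The boundary map `∂ : Sh_k → Sh_{k-1}` of the sharbly complex (zero for `k = 0`). -/
def sharblyBoundary (n : ℕ) : (k : ℕ) → Sharbly n k →ₗ[ℚ] Sharbly n (k - 1)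
  | 0 => 0
  | k + 1 => (sharblyRel n (n + k + 1)).mapQ (sharblyRel n (n + k)) (freeBoundary n (n + k))
      freeBoundary_rel

theorem sharblyBoundary_basic {n k : ℕ} (v : Fin (n + (k + 1)) → NZVec n) :
    sharblyBoundary n (k + 1) (basicSharbly v) =
      ∑ i : Fin (n + k + 1), (-1 : ℚ) ^ (i : ℕ) •
        (basicSharbly (k := k) (fun j : Fin (n + k) => v (i.succAbove j))) := by
  have h := freeBoundary_single (n := n) (m := n + k) v
  have h2 : sharblyBoundary n (k + 1) (basicSharbly v) =
      (sharblyRel n (n + k)).mkQ (freeBoundary n (n + k) (Finsupp.single v 1)) := rfl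
  rw [h2, h, map_sum]
  simp only [map_smul]
  rfl

theorem sharblyBoundary_rep (n k : ℕ) (g : GL (Fin n) ℚ) (x : Sharbly n k) :
    sharblyBoundary n k (sharblyRep n k g x) = sharblyRep n (k - 1) g (sharblyBoundary n k x) := by
  cases k with
  | zero => simp [sharblyBoundary]
  | succ k =>
    suffices h : (sharblyBoundary n (k + 1)) ∘ₗ (sharblyRep n (k + 1) g) =
        (sharblyRep n k g) ∘ₗ (sharblyBoundary n (k + 1)) from LinearMap.congr_fun h x
    refine Submodule.linearMap_qext _ (Finsupp.lhom_ext' fun v => LinearMap.ext_ring ?_)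
    change sharblyBoundary n (k + 1) (sharblyRep n (k + 1) g (basicSharbly v)) =
      sharblyRep n k g (sharblyBoundary n (k + 1) (basicSharbly v))
    rw [sharblyRep_basic, sharblyBoundary_basic, sharblyBoundary_basic, map_sum]
    refine Finset.sum_congr rfl fun i _ => ?_
    rw [map_smul, sharblyRep_basic]
    rfl

/-- `Sh_k` as a representation of a subgroup `G` of `SL_n(ℤ)`. -/
def sharblyRepRes (n k : ℕ) (G : Subgroup (Matrix.SpecialLinearGroup (Fin n) ℤ)) :
    Representation ℚ G (Sharbly n k) :=
  (sharblyRep n k).comp ((Matrix.SpecialLinearGroup.mapGL ℚ).comp G.subtype)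

/-- The coinvariants `Sh_k ⊗_G ℚ`. -/
abbrev SharblyCoinv (n k : ℕ) (G : Subgroup (Matrix.SpecialLinearGroup (Fin n) ℤ)) : Type :=
  (sharblyRepRes n k G).Coinvariants

/-- `[v₁, …, v_{n+k}]_G`, the image of a basic sharbly in the coinvariants. -/
def basicSharblyCoinv {n k : ℕ} (G : Subgroup (Matrix.SpecialLinearGroup (Fin n) ℤ))
    (v : Fin (n + k) → NZVec n) : SharblyCoinv n k G :=
  Representation.Coinvariants.mk (sharblyRepRes n k G) (basicSharbly v)

/-- The boundary map on coinvariants induced by `∂`. -/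
def sharblyCoinvBoundary (n k : ℕ) (G : Subgroup (Matrix.SpecialLinearGroup (Fin n) ℤ)) :
    SharblyCoinv n k G →ₗ[ℚ] SharblyCoinv n (k - 1) G :=
  Representation.Coinvariants.map _ _
    (LinearMap.intertwiningMap_of_isIntertwiningMap (sharblyRepRes n k G)
      (sharblyRepRes n (k - 1) G) (sharblyBoundary n k)
      fun _ x => sharblyBoundary_rep n k _ x)

/-! ### The perfect Voronoi cellulation -/

/-- The virtual cohomological dimension `t = n(n-1)/2` of `SL_n(ℤ)`. -/
abbrev vcd (n : ℕ) : ℕ := n * (n - 1) / 2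

/-- `d = n + t = n(n+1)/2`, the dimension of the space of symmetric matrices. -/
abbrev coneDim (n : ℕ) : ℕ := n + vcd n

/-- The space `Y` of real symmetric `n × n` matrices. -/
def SymMat (n : ℕ) : Submodule ℝ (Matrix (Fin n) (Fin n) ℝ) where
  carrier := {A | A.IsSymm}
  add_mem' ha hb := ha.add hb
  zero_mem' := Matrix.isSymm_zero
  smul_mem' c _ ha := ha.smul c

/-- `u' = u ᵗu`. -/
def rankOne {n : ℕ} (u : Fin n → ℚ) : SymMat n :=
  ⟨Matrix.vecMulVec (fun i => (u i : ℝ)) (fun i => (u i : ℝ)), by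
    change Matrix.transpose _ = _
    ext i j
    simp [Matrix.vecMulVec_apply, mul_comm]⟩

/-- The linear map `A ↦ γ A ᵗγ` of `Y`, for `γ ∈ SL_n(ℤ)`. -/
def symAct {n : ℕ} (γ : Matrix.SpecialLinearGroup (Fin n) ℤ) : SymMat n →ₗ[ℝ] SymMat n where
  toFun A := ⟨(γ.1.map (Int.cast : ℤ → ℝ)) * A.1 * (γ.1.map (Int.cast : ℤ → ℝ)).transpose, by
    change Matrix.transpose _ = _
    have hA : A.1.transpose = A.1 := A.2
    simp [Matrix.transpose_mul, hA, Matrix.mul_assoc]⟩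
  map_add' A B := Subtype.ext (by simp [Matrix.mul_add, Matrix.add_mul])
  map_smul' c A := Subtype.ext (by simp)

/-- The value `ᵗx Q x` of the quadratic form `Q` at an integral vector `x`. -/
def quadVal {n : ℕ} (Q : Matrix (Fin n) (Fin n) ℝ) (x : Fin n → ℤ) : ℝ :=
  (fun i => (x i : ℝ)) ⬝ᵥ Q.mulVec (fun i => (x i : ℝ))

/-- The minimal vectors of `Q`: the nonzero integral vectors at which `Q` is minimal. -/
def minVectors {n : ℕ} (Q : Matrix (Fin n) (Fin n) ℝ) : Set (Fin n → ℤ) :=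
  {x | x ≠ 0 ∧ ∀ y : Fin n → ℤ, y ≠ 0 → quadVal Q x ≤ quadVal Q y}

/-- The rank one matrices `x'`, with `x` a minimal vector of `Q`. -/
def minRankOnes {n : ℕ} (Q : Matrix (Fin n) (Fin n) ℝ) : Set (SymMat n) :=
  (fun x : Fin n → ℤ => rankOne fun i => (x i : ℚ)) '' minVectors Q

/-- A positive definite real quadratic form is perfect if the `x'`, for `x` a minimal vector,
span `Y`. -/
def IsPerfectForm {n : ℕ} (Q : Matrix (Fin n) (Fin n) ℝ) : Prop :=
  Q.PosDef ∧ Submodule.span ℝ (minRankOnes Q) = ⊤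

/-- The tiles: the top-dimensional cones of the perfect Voronoi cellulation, that is, the cones
generated by the `x'`, with `x` running over the minimal vectors of a perfect form. -/
def IsTile {n : ℕ} (T : PointedCone ℝ (SymMat n)) : Prop :=
  ∃ Q : Matrix (Fin n) (Fin n) ℝ, IsPerfectForm Q ∧ T = PointedCone.hull ℝ (minRankOnes Q)

/-- `R` is a set of representatives of the `G`-orbits of tiles, for the action
`γ · A = γ A ᵗγ`. -/
def IsTileRepresentatives {n : ℕ} (G : Subgroup (Matrix.SpecialLinearGroup (Fin n) ℤ))
    (R : Set (PointedCone ℝ (SymMat n))) : Prop :=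
  (∀ T ∈ R, IsTile T) ∧
    ∀ T : PointedCone ℝ (SymMat n), IsTile T →
      ∃! T' : PointedCone ℝ (SymMat n), T' ∈ R ∧ ∃ γ ∈ G, T.map (symAct γ) = T'

/-- The simplicial (or degenerate) cone `s(v₁, …, v_m)` generated by `v₁', …, v_m'`. -/
def coneOf {n m : ℕ} (v : Fin m → NZVec n) : PointedCone ℝ (SymMat n) :=
  PointedCone.hull ℝ (Set.range fun i => rankOne (v i).1)

/-- `v'` is, up to a positive scalar, a vertex of the cone `T`: the ray through `v'` is a
one-dimensional face of `T`. -/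
def IsVertexOf {n : ℕ} (v : NZVec n) (T : PointedCone ℝ (SymMat n)) : Prop :=
  (PointedCone.hull ℝ {rankOne v.1}).IsFaceOf T

/-- The set `Σ(T)` of the top-dimensional simplicial cones whose vertices are vertices of `T`. -/
def simplicialCones {n : ℕ} (T : PointedCone ℝ (SymMat n)) : Set (PointedCone ℝ (SymMat n)) :=
  {s | ∃ v : Fin (coneDim n) → NZVec n,
    LinearIndependent ℝ (fun i => rankOne (v i).1) ∧ (∀ i, IsVertexOf (v i) T) ∧ s = coneOf v}

/-- A triangulation of the tile `T`: a set of cones from `Σ(T)` that cover `T`, any two of them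
meeting in a common face. -/
structure IsTriangulation {n : ℕ} (T : PointedCone ℝ (SymMat n))
    (τ : Set (PointedCone ℝ (SymMat n))) : Prop where
  subset : τ ⊆ simplicialCones T
  cover : (⋃ s ∈ τ, (s : Set (SymMat n))) = (T : Set (SymMat n))
  inter : ∀ s₁ ∈ τ, ∀ s₂ ∈ τ, s₁ ≠ s₂ → (s₁ ⊓ s₂).IsFaceOf s₁ ∧ (s₁ ⊓ s₂).IsFaceOf s₂

/-- A regular (coherent) triangulation of `T`: there is a concave function on `T`, linear on each
cone of the triangulation, whose domains of linearity are exactly these cones. -/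
def IsRegularTriangulation {n : ℕ} (T : PointedCone ℝ (SymMat n))
    (τ : Set (PointedCone ℝ (SymMat n))) : Prop :=
  IsTriangulation T τ ∧
    ∃ f : SymMat n → ℝ, ConcaveOn ℝ (T : Set (SymMat n)) f ∧
      ∀ s ∈ τ, ∃ l : SymMat n →ₗ[ℝ] ℝ, {x | x ∈ T ∧ f x = l x} = (s : Set (SymMat n))

/-- `v₁, …, v_d` is an enumeration of the vertices of the top-dimensional simplicial cone `s`
(each vector being determined up to a scalar) which induces the orientation `o` of `Y`. Then
`[s] = [v₁, …, v_d]`. -/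
def IsOrientedVertexList {n : ℕ} (o : Orientation ℝ (SymMat n) (Fin (coneDim n)))
    (s : PointedCone ℝ (SymMat n)) (v : Fin (coneDim n) → NZVec n) : Prop :=
  s = coneOf v ∧ ∃ b : Module.Basis (Fin (coneDim n)) ℝ (SymMat n),
    (∀ i, b i = rankOne (v i).1) ∧ b.orientation = o

/-- `[v₁, …, v_d]` is a flipon: some affine subspace of `Y` of dimension `d - 2` contains
`v₁', …, v_d'`. -/
def IsFlipon {n : ℕ} (v : Fin (coneDim n) → NZVec n) : Prop :=
  ∃ A : AffineSubspace ℝ (SymMat n),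
    Module.finrank ℝ A.direction + 2 = coneDim n ∧ ∀ i, rankOne (v i).1 ∈ A

end

/-!
Throughout, a quadratic form is regarded as a linear functional `φ` on symmetric matrices, whose
value at the vector `x` is `φ (x ᵗx)`; forms are normalized to have minimum one on nonzero integral
vectors. Sharblies are lifted to chains of ordered tuples of integral vectors. Tuples that do not
span `ℝⁿ` are neglected.

*Flipons.* If the entries of a `d`-tuple are minimal vectors of one form `φ` and the matrices
`x ᵗx` are linearly dependent, these matrices lie in the affine hyperplane `φ = 1` and in a linear
hyperplane, so the tuple is a flipon (`isFlipon_of_finrank_lt`). It therefore suffices to show that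
the boundary of the chain of all simplicial cones `s ∈ S` is, modulo `G` and nonspanning tuples,
the boundary of a chain of such degenerate tuples
(`Dissection.exists_normal_bd_chain_eq`). A sign of a flipon is absorbed by a transposition of two
entries.

*The facets in one hyperplane.* The translates of the cones in `S` by `G` cover all tiles and have
disjoint interiors (`exists_dissection`).
The facets of `S` are sorted by the flats they span: the sets of minimal vectors of a form in a
hyperplane of symmetric matrices. As `G` is torsion-free, it acts freely on spanning flats, so that
every facet has at most one translate in a chosen representative of its orbit of flats. The
translates in such a flat are finitely many simplicial cones in a hyperplane, of both orientations.
At a generic point of the hyperplane, their signed number is the difference of the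
numbers of cells on both sides, which is `1 - 1 = 0` (`Dissection.exists_sum_signedCone_eq_zero`).
The triangulations of both sides are not compatible, but chains of simplicial cones with vanishing
signed indicator function are boundaries, up to degenerate tuples
(`VolumeForm.exists_bd_of_signedCone`): by integration of `exp (-ξ)`, the rational function
`∑ ± det (l) / ∏ ξ (lᵢ)` vanishes, and taking residues at `ξ (v) = 0` one can remove a vertex `v`
from the chain at the expense of a boundary.

*The remaining facets.* What is left of the boundary is a cycle of tuples of length `d - 1` in flats
of rank less than `d - 1`, modulo `G` and nonspanning tuples. Such a cycle is a boundary in these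
flats (`FlatSystem.exists_normal_eq_normal_bd`): its parts in the flats of maximal rank are, by
induction on the rank, cycles up to tuples of smaller rank, and the tuples in one flat, modulo
nonspanning ones, have no homology in lengths greater than `n`
(`FlatSystem.exists_sub_bd_mem_on_finrank_lt`). The last fact is again an instance of the
induction, applied to the linear flats spanned by nonspanning tuples.

*Reduction theory.* The finiteness statements (finitely many minimal vectors, tiles up to the group,
and tiles near a positive definite matrix) come from Minkowski's convex body theorem, which bounds
the determinants of matrices with columns on which a normalized form is bounded
(`Ryshkov.abs_det_le`). That the tiles cover the positive definite matrices is obtained by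
minimizing a linear function over the normalized forms (`exists_perfect_mem_tile`). The signs are
consistent because `SL_n` preserves the orientation of the space of symmetric matrices
(`det_symAct_pos`).
-/

noncomputable section
/-! ### Chains of ordered tuples -/

/-- Integral chains on finite ordered tuples (lists) with entries in `X`. -/
abbrev Ch (X : Type*) : Type _ := List X →₀ ℤ

namespace Ch

variable {X : Type*}

/-- The chains all of whose tuples satisfy `p`. -/
def on (p : List X → Prop) : Submodule ℤ (Ch X) := Finsupp.supported ℤ ℤ {l | p l}

/-- The cone `x * c`: the entry `x` is put in front of every tuple. -/
def cone (x : X) : Ch X →ₗ[ℤ] Ch X := Finsupp.lmapDomain ℤ ℤ (List.cons x)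

/-- The alternating sum of the faces of a tuple, computed from `∂ (x * l) = l - x * ∂ l`. -/
def bdList : List X → Ch X
  | [] => 0
  | x :: l => Finsupp.single l 1 - cone x (bdList l)

/-- The boundary map `∂` on chains of ordered tuples. -/
def bd : Ch X →ₗ[ℤ] Ch X := Finsupp.linearCombination ℤ bdList

theorem cone_single (x : X) (l : List X) (a : ℤ) :
    cone x (Finsupp.single l a) = Finsupp.single (x :: l) a := by
  simp [cone]

theorem bd_single (l : List X) (a : ℤ) : bd (Finsupp.single l a) = a • bdList l := by
  simp [bd]

theorem bd_cone (x : X) (c : Ch X) : bd (cone x c) = c - cone x (bd c) := by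
  induction c using Finsupp.induction_linear with
  | zero => simp
  | add f g hf hg => simp only [map_add, hf, hg]; abel
  | single l a =>
    rw [cone_single, bd_single, bd_single, bdList, smul_sub, map_smul]
    simp

theorem bd_bdList (l : List X) : bd (bdList l) = 0 := by
  induction l with
  | nil => simp [bdList]
  | cons x l ih =>
    rw [bdList, map_sub, bd_cone, ih, bd_single]
    simp

theorem bd_bd (c : Ch X) : bd (bd c) = 0 := by
  induction c using Finsupp.induction_linear with
  | zero => simp
  | add f g hf hg => simp only [map_add, hf, hg]; abel
  | single l a => rw [bd_single, map_smul, bd_bdList, smul_zero]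

theorem mem_on {p : List X → Prop} {c : Ch X} : c ∈ on p ↔ ∀ l, c l ≠ 0 → p l := by
  simp only [on, Finsupp.mem_supported', Set.mem_ofPred_eq]
  exact forall_congr' fun l => not_imp_comm

theorem single_mem_on {p : List X → Prop} {l : List X} (h : p l) (a : ℤ) :
    Finsupp.single l a ∈ on p :=
  Finsupp.single_mem_supported ℤ a h

theorem on_mono {p q : List X → Prop} (h : ∀ l, p l → q l) : on p ≤ on q :=
  Finsupp.supported_mono h

theorem on_induction {p : List X → Prop} {C : Ch X → Prop} (zero : C 0)
    (add : ∀ f g, C f → C g → C (f + g)) (single : ∀ l a, p l → C (Finsupp.single l a))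
    {c : Ch X} (hc : c ∈ on p) : C c := by
  induction c using Finsupp.induction with
  | zero => exact zero
  | single_add l a f hl ha ih =>
    rw [mem_on] at hc
    refine add _ _ (single l a (hc l ?_)) (ih (mem_on.2 fun l' hl' => hc l' ?_))
    · rw [Finsupp.add_apply, Finsupp.notMem_support_iff.1 hl]; simpa using ha
    · have : l ≠ l' := by
        rintro rfl
        exact hl' (Finsupp.notMem_support_iff.1 hl)
      rw [Finsupp.add_apply, Finsupp.single_eq_of_ne' this]; simpa using hl'

theorem map_mem_on {p q : List X → Prop} (f : Ch X →ₗ[ℤ] Ch X)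
    (h : ∀ l, p l → f (Finsupp.single l 1) ∈ on q) {c : Ch X} (hc : c ∈ on p) : f c ∈ on q := by
  refine on_induction (C := fun c => f c ∈ on q) (by simp) (fun f g hf hg => ?_)
    (fun l a hl => ?_) hc
  · rw [map_add]; exact add_mem hf hg
  · have := Submodule.smul_mem _ a (h l hl)
    rw [← map_smul] at this
    simpa using this

theorem map_eq_of_on {p : List X → Prop} {M : Type*} [AddCommGroup M] (f g : Ch X →ₗ[ℤ] M)
    (h : ∀ l, p l → f (Finsupp.single l 1) = g (Finsupp.single l 1)) {c : Ch X} (hc : c ∈ on p) :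
    f c = g c := by
  refine on_induction (C := fun c => f c = g c) (by simp) (fun a b ha hb => ?_)
    (fun l a hl => ?_) hc
  · rw [map_add, map_add, ha, hb]
  · have := congrArg (a • ·) (h l hl)
    simp only [← map_smul] at this
    simpa using this

theorem cone_mem_on {p q : List X → Prop} {x : X} (h : ∀ l, p l → q (x :: l)) {c : Ch X}
    (hc : c ∈ on p) : cone x c ∈ on q :=
  map_mem_on _ (fun l hl => by rw [cone_single]; exact single_mem_on (h l hl) 1) hc

/-- The faces of a tuple of length `k + 1` are sublists of length `k`. -/
theorem bdList_mem (l : List X) :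
    bdList l ∈ on (fun l' => l'.Sublist l ∧ l'.length + 1 = l.length) := by
  induction l with
  | nil => simp [bdList]
  | cons x l ih =>
    rw [bdList]
    refine sub_mem (single_mem_on (by simp) 1) (cone_mem_on (fun l' hl' => ?_) ih)
    simp [hl'.1, hl'.2]

theorem bd_mem_on {p q : List X → Prop}
    (h : ∀ l l' : List X, p l → l'.Sublist l → l'.length + 1 = l.length → q l') {c : Ch X}
    (hc : c ∈ on p) : bd c ∈ on q :=
  map_mem_on _ (fun l hl => by
    rw [bd_single, one_smul]
    exact on_mono (fun l' hl' => h l l' hl hl'.1 hl'.2) (bdList_mem l)) hc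

open scoped Classical in
/-- The part of a chain supported on the tuples that satisfy `p`. -/
def part (p : List X → Prop) : Ch X →ₗ[ℤ] Ch X where
  toFun c := c.filter p
  map_add' _ _ := Finsupp.filter_add
  map_smul' _ _ := Finsupp.filter_smul

theorem part_apply_pos {p : List X → Prop} {l : List X} (h : p l) (c : Ch X) :
    part p c l = c l := by
  classical exact Finsupp.filter_apply_pos p c h

theorem part_apply_neg {p : List X → Prop} {l : List X} (h : ¬ p l) (c : Ch X) :
    part p c l = 0 := by
  classical exact Finsupp.filter_apply_neg p c h

theorem part_mem (p : List X → Prop) (c : Ch X) : part p c ∈ on p := by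
  rw [mem_on]
  intro l hl
  by_contra h
  exact hl (part_apply_neg h c)

theorem part_mem_of_mem (p : List X → Prop) {q : List X → Prop} {c : Ch X} (hc : c ∈ on q) :
    part p c ∈ on (fun l => q l ∧ p l) := by
  rw [mem_on] at *
  intro l hl
  by_cases h : p l
  · exact ⟨hc l (by rwa [part_apply_pos h] at hl), h⟩
  · exact absurd (part_apply_neg h c) hl

theorem part_eq_self {p : List X → Prop} {c : Ch X} (hc : c ∈ on p) : part p c = c := by
  ext l
  by_cases h : p l
  · rw [part_apply_pos h]
  · rw [part_apply_neg h]
    by_contra h'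
    exact h (mem_on.1 hc l (Ne.symm h'))

theorem part_eq_zero {p q : List X → Prop} (h : ∀ l, q l → ¬ p l) {c : Ch X} (hc : c ∈ on q) :
    part p c = 0 := by
  ext l
  by_cases hl : p l
  · rw [part_apply_pos hl]
    by_contra h'
    exact h l (mem_on.1 hc l h') hl
  · rw [part_apply_neg hl]; rfl

theorem part_single_pos {p : List X → Prop} {l : List X} (h : p l) (a : ℤ) :
    part p (Finsupp.single l a) = Finsupp.single l a :=
  part_eq_self (single_mem_on h a)

theorem part_single_neg {p : List X → Prop} {l : List X} (h : ¬ p l) (a : ℤ) :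
    part p (Finsupp.single l a) = 0 :=
  part_eq_zero (q := fun l' => ¬ p l') (fun _ h => h) (single_mem_on h a)

theorem part_add_part (p : List X → Prop) (c : Ch X) : part p c + part (fun l => ¬ p l) c = c := by
  ext l
  by_cases h : p l
  · rw [Finsupp.add_apply, part_apply_pos h, part_apply_neg (not_not.2 h), add_zero]
  · rw [Finsupp.add_apply, part_apply_neg h, part_apply_pos h, zero_add]

/-- A chain is the sum of its parts of given type `κ l = E`. -/
theorem sum_part {P : Type*} [DecidableEq P] (κ : List X → P) (c : Ch X) :
    ∑ E ∈ c.support.image κ, part (fun l => κ l = E) c = c := by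
  ext l
  rw [Finsupp.finsetSum_apply]
  by_cases hl : c l = 0
  · rw [hl]
    refine Finset.sum_eq_zero fun E _ => ?_
    by_cases h : κ l = E
    · rw [part_apply_pos h, hl]
    · rw [part_apply_neg h]
  · rw [Finset.sum_eq_single (κ l)]
    · exact part_apply_pos (p := fun l' => κ l' = κ l) rfl c
    · intro E _ hE
      exact part_apply_neg (p := fun l' => κ l' = E) (Ne.symm hE) c
    · intro h
      exact absurd (Finset.mem_image_of_mem κ (Finsupp.mem_support_iff.2 hl)) h

end Ch

end

noncomputable section
/-! ### Vanishing of homology for systems of flats -/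

/-- A system of flats: every admissible tuple `l` spans a flat `κ l`, a set of labels, which has a
rank `r l`; the tuples satisfying `N` are the ones to be neglected. Tuples in a given flat that
is not neglected form a complex which is acyclic, modulo neglected tuples, above the rank. -/
structure FlatSystem (X : Type*) where
  /-- the neglected tuples -/
  N : List X → Prop
  /-- the flat spanned by a tuple -/
  κ : List X → Set X
  /-- the rank of the flat spanned by a tuple -/
  r : List X → ℕ
  /-- the admissible tuples -/
  A : List X → Prop
  N_sub : ∀ l l', N l → l'.Sublist l → N l'
  subset : ∀ l, A l → ∀ x ∈ l, x ∈ κ l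
  closed : ∀ l l', A l → (∀ x ∈ l', x ∈ κ l) →
    A l' ∧ κ l' ⊆ κ l ∧ r l' ≤ r l ∧ (r l' = r l → κ l' = κ l)
  congr : ∀ l l', A l → A l' → κ l = κ l' → r l = r l' ∧ (N l ↔ N l')
  acyclic : ∀ l, A l → ¬ N l → ∀ K, r l < K →
    ∀ c ∈ Ch.on (fun l' => l'.length = K ∧ ∀ x ∈ l', x ∈ κ l), Ch.bd c ∈ Ch.on N →
      ∃ a ∈ Ch.on (fun l' => l'.length = K + 1 ∧ ∀ x ∈ l', x ∈ κ l), c - Ch.bd a ∈ Ch.on N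

namespace FlatSystem

open Ch

variable {X : Type*}

/-- The system of the tuples in a single flat. -/
def restrict (F : FlatSystem X) (l₀ : List X) (h₀ : F.A l₀) : FlatSystem X where
  N := F.N
  κ := F.κ
  r := F.r
  A l := ∀ x ∈ l, x ∈ F.κ l₀
  N_sub := F.N_sub
  subset l hl := F.subset l (F.closed l₀ l h₀ hl).1
  closed l l' hl hl' := by
    have h1 := F.closed l₀ l h₀ hl
    exact ⟨fun x hx => h1.2.1 (hl' x hx), (F.closed l l' h1.1 hl').2⟩
  congr l l' hl hl' := F.congr l l' (F.closed l₀ l h₀ hl).1 (F.closed l₀ l' h₀ hl').1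
  acyclic l hl := F.acyclic l (F.closed l₀ l h₀ hl).1

open scoped Classical in
/-- The map of chains which replaces a tuple `l` by its normal form `ν l`, and which kills the
neglected tuples. -/
def normal (F : FlatSystem X) (ν : List X → List X) : Ch X →ₗ[ℤ] Ch X :=
  Finsupp.linearCombination ℤ fun l => if F.N l then 0 else Finsupp.single (ν l) 1

theorem normal_single (F : FlatSystem X) (ν : List X → List X) {l : List X} (h : ¬ F.N l) :
    F.normal ν (Finsupp.single l 1) = Finsupp.single (ν l) 1 := by
  simp [normal, h]

theorem normal_single_of_N (F : FlatSystem X) (ν : List X → List X) {l : List X} (h : F.N l) :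
    F.normal ν (Finsupp.single l 1) = 0 := by
  simp [normal, h]

theorem normal_of_N (F : FlatSystem X) (ν : List X → List X) {c : Ch X} (h : c ∈ on F.N) :
    F.normal ν c = 0 := by
  have := map_eq_of_on (F.normal ν) 0 (fun l hl => F.normal_single_of_N ν hl) h
  simpa using this

theorem bd_N (F : FlatSystem X) {c : Ch X} (h : c ∈ on F.N) : bd c ∈ on F.N :=
  bd_mem_on (fun l l' hl hs _ => F.N_sub l l' hl hs) h

theorem normal_id (F : FlatSystem X) (c : Ch X) : F.normal id c = part (fun l => ¬ F.N l) c := by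
  refine map_eq_of_on (p := fun _ => True) _ _ (fun l _ => ?_) (mem_on.2 fun _ _ => trivial)
  by_cases h : F.N l
  · rw [normal_single_of_N F _ h, part_single_neg (not_not.2 h)]
  · rw [normal_single F _ h, part_single_pos h]; rfl

theorem normal_id_eq_zero (F : FlatSystem X) {c : Ch X} (h : F.normal id c = 0) :
    c ∈ on F.N := by
  rw [normal_id] at h
  rw [← part_add_part F.N c, h, add_zero]
  exact part_mem _ _

/-- A normal form for the tuples of a system of flats: `ν` selects among flats, without changing
the tuples in a selected flat that span it. -/
structure IsNormalForm (F : FlatSystem X) (ν : List X → List X) : Prop where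
  mem : ∀ l, F.A l → ¬ F.N l → F.A (ν l) ∧ (ν l).length = l.length ∧ F.r (ν l) = F.r l ∧
    ¬ F.N (ν l)
  comm : ∀ l, F.A l → F.normal ν (bd (F.normal ν (Finsupp.single l 1))) =
    F.normal ν (bd (Finsupp.single l 1))
  fix : ∀ l l', F.A l → ¬ F.N l → (∀ x ∈ l', x ∈ F.κ (ν l)) → F.κ l' = F.κ (ν l) → ν l' = l'

theorem isNormalForm_id (F : FlatSystem X) : F.IsNormalForm id where
  mem l h hN := ⟨h, rfl, rfl, hN⟩
  comm l _ := by
    by_cases h : F.N l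
    · rw [normal_single_of_N F _ h, map_zero, map_zero,
        normal_of_N F _ (F.bd_N (single_mem_on h 1))]
    · rw [normal_single F _ h]; rfl
  fix _ _ _ _ _ _ := rfl

/-- In a system of flats, relative cycles of tuples of length at least `m`, in flats of rank less
than `m`, are relative boundaries, even up to passage to normal forms: the pieces of the cycle in
the flats of maximal rank are, separately, cycles modulo flats of smaller rank. -/
theorem exists_normal_eq_normal_bd (m : ℕ) : ∀ (F : FlatSystem X) (ν : List X → List X)
    (_ : F.IsNormalForm ν) (K : ℕ) (_ : m ≤ K)
    (c : Ch X) (_ : c ∈ on (fun l => F.A l ∧ l.length = K ∧ F.r l < m))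
    (_ : F.normal ν (bd c) = 0),
    ∃ a ∈ on (fun l => F.A l ∧ l.length = K + 1 ∧ F.r l < m),
      F.normal ν c = F.normal ν (bd a) := by
  induction m with
  | zero =>
    intro F ν _ K _ c hc _
    refine ⟨0, zero_mem _, ?_⟩
    have : c = 0 := by
      ext l
      by_contra h
      exact absurd (mem_on.1 hc l h).2.2 (Nat.not_lt_zero _)
    simp [this]
  | succ m ih =>
    intro F ν hν K hmK c hc hbd
    classical
    obtain ⟨K, rfl⟩ : ∃ K', K = K' + 1 := ⟨K - 1, by omega⟩
    have hνA : ∀ {c : Ch X} {p : List X → Prop}, c ∈ on p → (∀ l, p l → F.A l) →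
        F.normal ν (bd (F.normal ν c)) = F.normal ν (bd c) := by
      intro c p hc hp
      exact map_eq_of_on (F.normal ν ∘ₗ bd ∘ₗ F.normal ν) (F.normal ν ∘ₗ bd)
        (fun l hl => hν.comm l (hp l hl)) hc
    set c₁ := F.normal ν c with hc₁
    have hc₁mem : c₁ ∈ on (fun l => F.A l ∧ l.length = K + 1 ∧ F.r l < m + 1 ∧ ¬ F.N l ∧
        ∃ l₀, F.A l₀ ∧ ¬ F.N l₀ ∧ l = ν l₀) := by
      refine map_mem_on _ (fun l hl => ?_) hc
      by_cases h : F.N l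
      · rw [normal_single_of_N F _ h]; exact zero_mem _
      · rw [normal_single F _ h]
        obtain ⟨h1, h2, h3, h4⟩ := hν.mem l hl.1 h
        exact single_mem_on
          ⟨h1, by rw [h2, hl.2.1], by rw [h3]; exact hl.2.2, h4, l, hl.1, h, rfl⟩ 1
    have hfix₁ : F.normal ν c₁ = c₁ := by
      refine map_eq_of_on (F.normal ν) LinearMap.id (fun l hl => ?_) hc₁mem
      obtain ⟨h1, h2, h3, h4, l₀, h5, h6, rfl⟩ := hl
      rw [normal_single F _ h4, hν.fix l₀ (ν l₀) h5 h6 (F.subset _ h1) rfl]; rfl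
    have hbd₁ : F.normal ν (bd c₁) = 0 := by
      rw [hc₁, hνA hc (fun l hl => hl.1), hbd]
    -- The part of maximal rank, and its pieces in the various flats.
    set low := part (fun l => ¬ F.r l = m) c₁ with hlow
    set top := part (fun l => F.r l = m) c₁ with htop
    have hsplit : c₁ = top + low := (part_add_part _ c₁).symm
    have hlowmem : low ∈ on (fun l => F.A l ∧ l.length = K + 1 ∧ F.r l < m) :=
      on_mono (fun l hl => ⟨hl.1.1, hl.1.2.1, by have := hl.1.2.2.1; have := hl.2; omega⟩)
        (part_mem_of_mem _ hc₁mem)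
    have htopmem := part_mem_of_mem (fun l => F.r l = m) hc₁mem
    rw [← htop] at htopmem
    set I := top.support.image F.κ with hI
    set piece : Set X → Ch X := fun E => part (fun l => F.κ l = E) top with hpiece
    have hsum : ∑ E ∈ I, piece E = top := sum_part F.κ top
    have hrep : ∀ E ∈ I, ∃ l₁, F.A l₁ ∧ ¬ F.N l₁ ∧ F.A (ν l₁) ∧ ¬ F.N (ν l₁) ∧ F.r (ν l₁) = m ∧
        F.κ (ν l₁) = E := by
      intro E hE
      obtain ⟨l, hl, rfl⟩ := Finset.mem_image.1 hE
      obtain ⟨⟨h1, -, -, h4, l₁, h5, h6, rfl⟩, h7⟩ :=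
        mem_on.1 htopmem l (Finsupp.mem_support_iff.1 hl)
      exact ⟨l₁, h5, h6, h1, h4, h7, rfl⟩
    have hpiecemem : ∀ E, piece E ∈ on (fun l => l.length = K + 1 ∧ ∀ x ∈ l, x ∈ E) := by
      intro E
      refine on_mono (fun l hl => ?_) (part_mem_of_mem (fun l => F.κ l = E) htopmem)
      exact ⟨hl.1.1.2.1, fun x hx => hl.2 ▸ F.subset l hl.1.1.1 x hx⟩
    have hbdpiece : ∀ E, bd (piece E) ∈ on (fun l => l.length = K ∧ ∀ x ∈ l, x ∈ E) := by
      intro E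
      refine bd_mem_on (fun l l' hl hs hlen => ?_) (hpiecemem E)
      exact ⟨by omega, fun x hx => hl.2 x (hs.subset hx)⟩
    -- A chain of smaller rank has a normal form of smaller rank.
    have hnormlow : ∀ {d : Ch X} (E : Set X), d ∈ on (fun l => F.A l ∧ F.r l < m) →
        part (fun l => F.κ l = E ∧ F.r l = m) (F.normal ν d) = 0 := by
      intro d E hd
      refine part_eq_zero (q := fun l => F.r l < m) (fun l hl h => by omega) ?_
      refine map_mem_on _ (fun l hl => ?_) hd
      by_cases h : F.N l
      · rw [normal_single_of_N F _ h]; exact zero_mem _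
      · rw [normal_single F _ h]
        exact single_mem_on (by rw [(hν.mem l hl.1 h).2.2.1]; exact hl.2) 1
    -- In a selected flat, a chain of maximal rank is its own normal form.
    have hnormtop : ∀ E ∈ I, ∀ {d : Ch X}, d ∈ on (fun l => F.r l = m ∧ ∀ x ∈ l, x ∈ E) →
        d ∈ on (fun l => F.κ l = E ∧ F.r l = m) ∧ F.normal ν d = d := by
      intro E hE d hd
      obtain ⟨l₁, h1, h2, h3, h4, h5, rfl⟩ := hrep E hE
      have key : ∀ l, (F.r l = m ∧ ∀ x ∈ l, x ∈ F.κ (ν l₁)) → F.A l ∧ F.κ l = F.κ (ν l₁) := by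
        intro l hl
        have := F.closed _ l h3 hl.2
        exact ⟨this.1, this.2.2.2 (by rw [h5, hl.1])⟩
      refine ⟨on_mono (fun l hl => ⟨(key l hl).2, hl.1⟩) hd, ?_⟩
      refine map_eq_of_on (F.normal ν) LinearMap.id (fun l hl => ?_) hd
      have hN : ¬ F.N l := fun h => h4 (((F.congr _ _ (key l hl).1 h3 (key l hl).2).2).1 h)
      rw [normal_single F _ hN, hν.fix l₁ l h1 h2 hl.2 (key l hl).2]; rfl
    have hbdsplit : ∀ E ∈ I, part (fun l => ¬ F.r l = m) (bd (piece E)) ∈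
        on (fun l => F.A l ∧ F.r l < m) := by
      intro E hE
      refine on_mono (fun l hl => ?_) (part_mem_of_mem (fun l => ¬ F.r l = m) (hbdpiece E))
      obtain ⟨l₁, h1, h2, h3, h4, h5, rfl⟩ := hrep E hE
      have := F.closed _ l h3 hl.1.2
      exact ⟨this.1, by have := this.2.2.1; have := hl.2; omega⟩
    have hbdtop : ∀ E, part (fun l => F.r l = m) (bd (piece E)) ∈
        on (fun l => F.r l = m ∧ ∀ x ∈ l, x ∈ E) := fun E =>
      on_mono (fun l hl => ⟨hl.2, hl.1.2⟩) (part_mem_of_mem (fun l => F.r l = m) (hbdpiece E))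
    -- The boundary of a piece has no part of maximal rank: in the cycle `c₁` that part could only
    -- cancel against pieces in the same flat.
    have hzero : ∀ E ∈ I, part (fun l => F.r l = m) (bd (piece E)) = 0 := by
      intro E hE
      have h0 : part (fun l => F.κ l = E ∧ F.r l = m) (F.normal ν (bd c₁)) = 0 := by
        rw [hbd₁, map_zero]
      have hlow0 : part (fun l => F.κ l = E ∧ F.r l = m) (F.normal ν (bd low)) = 0 := by
        refine hnormlow E (bd_mem_on (fun l l' hl hs _ => ?_) hlowmem)
        have := F.closed l l' hl.1 (fun x hx => F.subset l hl.1 x (hs.subset hx))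
        exact ⟨this.1, lt_of_le_of_lt this.2.2.1 hl.2.2⟩
      rw [hsplit, ← hsum, map_add, map_add, map_add, hlow0, add_zero, map_sum, map_sum, map_sum,
        Finset.sum_eq_single E] at h0
      · rw [← part_add_part (fun l => F.r l = m) (bd (piece E)), map_add, map_add,
          hnormlow E (hbdsplit E hE), add_zero, (hnormtop E hE (hbdtop E)).2,
          part_eq_self (hnormtop E hE (hbdtop E)).1] at h0
        exact h0
      · intro E' hE' hne
        rw [← part_add_part (fun l => F.r l = m) (bd (piece E')), map_add, map_add,
          hnormlow E (hbdsplit E' hE'), add_zero, (hnormtop E' hE' (hbdtop E')).2]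
        exact part_eq_zero (fun l hl h => hne (hl.1.symm.trans h.1))
          (hnormtop E' hE' (hbdtop E')).1
      · exact fun h => absurd hE h
    -- By induction the boundary of a piece bounds in smaller rank inside the flat, and the
    -- difference bounds by acyclicity.
    have hfill : ∀ E ∈ I, ∃ ab : Ch X × Ch X,
        ab.1 ∈ on (fun l => F.A l ∧ l.length = K + 1 + 1 ∧ F.r l < m + 1) ∧
        ab.2 ∈ on (fun l => F.A l ∧ l.length = K + 1 ∧ F.r l < m) ∧
        piece E - ab.2 - bd ab.1 ∈ on F.N := by
      intro E hE
      obtain ⟨l₁, h1, h2, h3, h4, h5, rfl⟩ := hrep E hE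
      have hy : bd (piece (F.κ (ν l₁))) ∈
          on (fun l => (∀ x ∈ l, x ∈ F.κ (ν l₁)) ∧ l.length = K ∧ F.r l < m) := by
        have h := part_add_part (fun l => F.r l = m) (bd (piece (F.κ (ν l₁))))
        rw [hzero _ hE, zero_add] at h
        rw [← h]
        refine on_mono (fun l hl => ?_)
          (part_mem_of_mem (fun l => ¬ F.r l = m) (hbdpiece (F.κ (ν l₁))))
        have := (F.closed _ l h3 hl.1.2).2.2.1
        exact ⟨hl.1.2, hl.1.1, by have := hl.2; omega⟩
      obtain ⟨b, hb, hb2⟩ := ih (F.restrict (ν l₁) h3) id (isNormalForm_id _) K (by omega)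
        (bd (piece (F.κ (ν l₁)))) hy (by rw [bd_bd, map_zero])
      have hN1 : bd (piece (F.κ (ν l₁))) - bd b ∈ on F.N :=
        (F.restrict (ν l₁) h3).normal_id_eq_zero (by rw [map_sub, hb2, sub_self])
      obtain ⟨a, ha, ha2⟩ := F.acyclic (ν l₁) h3 h4 (K + 1) (by omega) (piece (F.κ (ν l₁)) - b)
        (sub_mem (hpiecemem _) (on_mono (fun l hl => ⟨hl.2.1, hl.1⟩) hb))
        (by rw [map_sub]; exact hN1)
      refine ⟨(a, b), on_mono (fun l hl => ?_) ha, on_mono (fun l hl => ?_) hb, ha2⟩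
      · have := F.closed _ l h3 hl.2
        exact ⟨this.1, hl.1, by have := this.2.2.1; omega⟩
      · exact ⟨(F.closed _ l h3 hl.1).1, hl.2⟩
    choose! ab hab using hfill
    set n := ∑ E ∈ I, (piece E - (ab E).2 - bd (ab E).1) with hn
    have hnN : n ∈ on F.N := Submodule.sum_mem _ fun E hE => (hab E hE).2.2
    set c₂ := low + ∑ E ∈ I, (ab E).2 with hc₂
    set a₁ := ∑ E ∈ I, (ab E).1 with ha₁
    have hc₁eq : c₁ = c₂ + bd a₁ + n := by
      rw [hsplit, ← hsum, hc₂, hn, ha₁, map_sum, Finset.sum_sub_distrib, Finset.sum_sub_distrib]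
      abel
    have hc₂mem : c₂ ∈ on (fun l => F.A l ∧ l.length = K + 1 ∧ F.r l < m) :=
      add_mem hlowmem (Submodule.sum_mem _ fun E hE => (hab E hE).2.1)
    have hbd₂ : F.normal ν (bd c₂) = 0 := by
      rw [hc₁eq, map_add, map_add, map_add, map_add, bd_bd, map_zero, add_zero,
        F.normal_of_N ν (F.bd_N hnN), add_zero] at hbd₁
      exact hbd₁
    obtain ⟨a₂, ha₂, ha₂'⟩ := ih F ν hν (K + 1) (by omega) c₂ hc₂mem hbd₂
    refine ⟨a₂ + a₁, add_mem (on_mono (fun l hl => ⟨hl.1, hl.2.1, by omega⟩) ha₂)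
      (Submodule.sum_mem _ fun E hE => (hab E hE).1), ?_⟩
    rw [← hfix₁, hc₁eq, map_add, map_add, ha₂', F.normal_of_N ν hnN, add_zero, map_add, map_add]

end FlatSystem

end

noncomputable section
/-! ### Chains with vanishing volume functions -/

namespace Ch

variable {X : Type*}

/-- The pairing of a chain with a real-valued function on tuples. -/
def eval (w : List X → ℝ) : Ch X →ₗ[ℤ] ℝ := Finsupp.linearCombination ℤ w

theorem eval_single (w : List X → ℝ) (l : List X) (a : ℤ) :
    eval w (Finsupp.single l a) = a * w l := by
  simp [eval]

theorem eval_cone (w : List X → ℝ) (x : X) (c : Ch X) :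
    eval w (cone x c) = eval (fun l => w (x :: l)) c := by
  induction c using Finsupp.induction_linear with
  | zero => simp
  | add f g hf hg => simp only [map_add, hf, hg]
  | single l a => rw [cone_single, eval_single, eval_single]

theorem eval_congr {w w' : List X → ℝ} {p : List X → Prop} (h : ∀ l, p l → w l = w' l) {c : Ch X}
    (hc : c ∈ on p) : eval w c = eval w' c :=
  map_eq_of_on _ _ (fun l hl => by rw [eval_single, eval_single, h l hl]) hc

theorem eval_smul (w : List X → ℝ) (t : ℝ) (c : Ch X) :
    eval (fun l => t * w l) c = t * eval w c := by
  induction c using Finsupp.induction_linear with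
  | zero => simp
  | add f g hf hg => simp only [map_add, hf, hg]; ring
  | single l a => rw [eval_single, eval_single]; ring

theorem eval_eq_sum (w : List X → ℝ) (c : Ch X) : eval w c = ∑ l ∈ c.support, c l * w l := by
  simp [eval, Finsupp.linearCombination_apply, Finsupp.sum]

theorem tendsto_eval {ι : Type*} {F : Filter ι} {w : ι → List X → ℝ} {w' : List X → ℝ}
    {p : List X → Prop} (h : ∀ l, p l → Filter.Tendsto (fun t => w t l) F (nhds (w' l)))
    {c : Ch X} (hc : c ∈ on p) :
    Filter.Tendsto (fun t => eval (w t) c) F (nhds (eval w' c)) := by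
  simp only [eval_eq_sum]
  exact tendsto_finsetSum _ fun l hl =>
    (h l (mem_on.1 hc l (Finsupp.mem_support_iff.1 hl))).const_mul _

end Ch

namespace VolumeForm

open Ch

variable {X : Type*}

/-- The alternating sum `∑ ± ω(l₀, …, l̂ᵢ, …) ξ(lᵢ)`. -/
def cramer (ξ : X → ℝ) : (List X → ℝ) → List X → ℝ
  | _, [] => 0
  | ω, x :: l => ω l * ξ x - cramer ξ (fun l' => ω (x :: l')) l

/-- The product `∏ ξ(lᵢ)`. -/
def den (ξ : X → ℝ) (l : List X) : ℝ := (l.map ξ).prod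

theorem den_cons (ξ : X → ℝ) (x : X) (l : List X) : den ξ (x :: l) = ξ x * den ξ l := by
  simp [den]

theorem den_ne_zero {ξ : X → ℝ} {l : List X} (h : ∀ x ∈ l, ξ x ≠ 0) : den ξ l ≠ 0 := by
  induction l with
  | nil => simp [den]
  | cons x l ih =>
    rw [den_cons]
    exact mul_ne_zero (h x (by simp)) (ih fun y hy => h y (by simp [hy]))

/-- The volume function `∑ c_l ω(l) / ∏ ξ(lᵢ)` of a chain: up to a factor, the signed volume of
its simplicial cones truncated at the height `1` of `ξ`. -/
def vol (ω : List X → ℝ) (ξ : X → ℝ) : Ch X →ₗ[ℤ] ℝ := eval fun l => ω l / den ξ l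

theorem vol_bdList (ξ : X → ℝ) (l : List X) (hl : ∀ x ∈ l, ξ x ≠ 0) (ω : List X → ℝ) :
    vol ω ξ (bdList l) = cramer ξ ω l / den ξ l := by
  induction l generalizing ω with
  | nil => simp [bdList, cramer]
  | cons x l ih =>
    have hx : ξ x ≠ 0 := hl x (by simp)
    have hd : den ξ l ≠ 0 := den_ne_zero fun y hy => hl y (by simp [hy])
    have h1 : vol ω ξ (cone x (bdList l)) =
        (ξ x)⁻¹ * vol (fun l' => ω (x :: l')) ξ (bdList l) := by
      unfold vol
      rw [eval_cone, ← eval_smul]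
      refine congrArg (fun w => eval w (bdList l)) (funext fun l' => ?_)
      rw [den_cons]
      by_cases h : den ξ l' = 0
      · simp [h]
      · field_simp
    rw [bdList, map_sub, h1, ih (fun y hy => hl y (by simp [hy])), cramer, den_cons]
    unfold vol
    rw [eval_single]
    field_simp
    simp

/-- An abstract determinant: a function `ω` on tuples of length `k`, together with a space `Ξ` of
functions on the labels, to be thought of as the linear functionals on a `k`-dimensional space in
which the labels are vectors. -/
structure IsVolume (Ξ : Submodule ℝ (X → ℝ)) (k : ℕ) (ω : List X → ℝ) : Prop where
  /-- Cramer's rule -/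
  cramer : ∀ ξ ∈ Ξ, ∀ l : List X, l.length = k + 1 → cramer ξ ω l = 0
  /-- `ω` vanishes on linearly dependent tuples -/
  dep : ∀ (l₁ : List X) (x : X) (l₂ : List X), (l₁ ++ x :: l₂).length = k →
    (∀ ξ ∈ Ξ, (∀ y ∈ l₁ ++ l₂, ξ y = 0) → ξ x = 0) → ω (l₁ ++ x :: l₂) = 0

/-- The functions in `Ξ` that vanish at the label `v`. -/
def quot (Ξ : Submodule ℝ (X → ℝ)) (v : X) : Submodule ℝ (X → ℝ) where
  carrier := {ξ | ξ ∈ Ξ ∧ ξ v = 0}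
  add_mem' h h' := ⟨add_mem h.1 h'.1, by simp [h.2, h'.2]⟩
  zero_mem' := ⟨zero_mem _, rfl⟩
  smul_mem' a _ h := ⟨Submodule.smul_mem _ a h.1, by simp [h.2]⟩

theorem IsVolume.quot {Ξ : Submodule ℝ (X → ℝ)} {k : ℕ} {ω : List X → ℝ}
    (h : IsVolume Ξ (k + 1) ω) (v : X) : IsVolume (quot Ξ v) k (fun l => ω (v :: l)) where
  cramer ξ hξ l hl := by
    have h1 := h.cramer ξ hξ.1 (v :: l) (by simpa using hl)
    rw [VolumeForm.cramer, hξ.2, mul_zero, zero_sub, neg_eq_zero] at h1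
    exact h1
  dep l₁ x l₂ hl hx := by
    refine h.dep (v :: l₁) x l₂ (by simpa using hl) fun ξ hξ hy => ?_
    exact hx ξ ⟨hξ, hy v (by simp)⟩ fun y hy' => hy y (by simp at hy' ⊢; tauto)

theorem IsVolume.eq_zero_of_mem {Ξ : Submodule ℝ (X → ℝ)} {k : ℕ} {ω : List X → ℝ}
    (h : IsVolume Ξ k ω) {x : X} {l : List X} (hl : l.length = k) (hx : x ∈ l)
    (hx0 : ∀ ξ ∈ Ξ, ξ x = 0) : ω l = 0 := by
  obtain ⟨l₁, l₂, rfl⟩ := List.append_of_mem hx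
  exact h.dep l₁ x l₂ hl fun ξ hξ _ => hx0 ξ hξ

theorem IsVolume.vol_bd {Ξ : Submodule ℝ (X → ℝ)} {k : ℕ} {ω : List X → ℝ}
    (h : IsVolume Ξ k ω) {ξ : X → ℝ} (hξ : ξ ∈ Ξ) {c : Ch X}
    (hc : c ∈ on (fun l => l.length = k + 1 ∧ ∀ x ∈ l, ξ x ≠ 0)) : vol ω ξ (bd c) = 0 := by
  refine map_eq_of_on (vol ω ξ ∘ₗ bd) 0 (fun l hl => ?_) hc
  rw [LinearMap.comp_apply, bd_single, one_smul, vol_bdList ξ l hl.2, h.cramer ξ hξ l hl.1]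
  simp

theorem vol_eq_zero_of_ω {ω : List X → ℝ} {ξ : X → ℝ} {c : Ch X}
    (hc : c ∈ on (fun l => ω l = 0)) : vol ω ξ c = 0 := by
  have := eval_congr (w := fun l => ω l / den ξ l) (w' := fun _ => 0)
    (fun l hl => by rw [hl, zero_div]) hc
  rw [vol, this, eval_eq_sum]
  simp

/-- The functions `ξ + t η`, for small nonzero `t`. -/
theorem eventually_add_smul_ne {ξ η : X → ℝ} {D : Finset X}
    (h : ∀ x ∈ D, ξ x ≠ 0 ∨ η x ≠ 0) :
    ∀ᶠ t in nhdsWithin (0 : ℝ) {0}ᶜ, ∀ x ∈ D, (ξ + t • η) x ≠ 0 := by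
  rw [Filter.eventually_all_finset]
  intro x hx
  by_cases h0 : ξ x = 0
  · have h1 := (h x hx).resolve_left (not_not.2 h0)
    filter_upwards [self_mem_nhdsWithin] with t ht
    simpa [h0, h1] using ht
  · have : Filter.Tendsto (fun t : ℝ => (ξ + t • η) x) (nhds 0) (nhds (ξ x)) := by
      have : Continuous fun t : ℝ => (ξ + t • η) x := by
        simp only [Pi.add_apply, Pi.smul_apply, smul_eq_mul]
        fun_prop
      simpa using this.tendsto 0
    exact (this.mono_left nhdsWithin_le_nhds).eventually_ne h0

theorem tendsto_den (ξ η : X → ℝ) (l : List X) :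
    Filter.Tendsto (fun t : ℝ => den (ξ + t • η) l) (nhds 0) (nhds (den ξ l)) := by
  induction l with
  | nil => simp [den]
  | cons x l ih =>
    simp only [den_cons]
    refine Filter.Tendsto.mul ?_ ih
    have : Continuous fun t : ℝ => (ξ + t • η) x := by
      simp only [Pi.add_apply, Pi.smul_apply, smul_eq_mul]
      fun_prop
    simpa using this.tendsto 0

theorem tendsto_vol (ω : List X → ℝ) (ξ η : X → ℝ) {c : Ch X}
    (hc : c ∈ on (fun l => ω l = 0 ∨ ∀ x ∈ l, ξ x ≠ 0)) :
    Filter.Tendsto (fun t : ℝ => vol ω (ξ + t • η) c) (nhdsWithin 0 {0}ᶜ) (nhds (vol ω ξ c)) := by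
  refine tendsto_eval (fun l hl => ?_) hc
  rcases hl with hl | hl
  · simp [hl]
  · exact Filter.Tendsto.div tendsto_const_nhds
      ((tendsto_den ξ η l).mono_left nhdsWithin_le_nhds) (den_ne_zero hl)

/-- A chain of tuples of length `k` whose volume function vanishes is a boundary, up to linearly
dependent tuples. Proof: coning off a label `v` replaces the chain by the cone `v * ∂ c`; the
residue of the volume function at `ξ v = 0` is the volume function of `∂ c` modulo `v`, so that by
induction `∂ c` is a boundary `∂ a`, modulo `v`, of a chain `a` that does not involve `v`; and `c`
is homologous to `a`. -/
theorem exists_bd_of_vol_eq_zero (k : ℕ) : ∀ (Ξ : Submodule ℝ (X → ℝ)) (ω : List X → ℝ)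
    (_ : IsVolume Ξ k ω) (D : Finset X) (_ : ∀ x ∈ D, ∃ ξ ∈ Ξ, ξ x ≠ 0) (c : Ch X)
    (_ : c ∈ on (fun l => l.length = k ∧ ∀ x ∈ l, x ∈ D))
    (_ : ∀ ξ ∈ Ξ, (∀ x ∈ D, ξ x ≠ 0) → vol ω ξ c = 0),
    ∃ a ∈ on (fun l => l.length = k + 1 ∧ ∀ x ∈ l, x ∈ D),
      c - bd a ∈ on (fun l => ω l = 0) := by
  induction k with
  | zero =>
    intro Ξ ω hω D hD c hc hvol
    refine ⟨0, zero_mem _, ?_⟩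
    have hc' : c = Finsupp.single [] (c []) := by
      ext l
      by_cases h : l = []
      · subst h; simp
      · rw [Finsupp.single_eq_of_ne h]
        by_contra h'
        exact h (List.length_eq_zero_iff.1 (mem_on.1 hc l h').1)
    by_cases h0 : ω [] = 0
    · rw [map_zero, sub_zero, hc']
      exact single_mem_on h0 _
    · have hDe : D = ∅ ∨ ∃ x, x ∈ D := D.eq_empty_or_nonempty
      rcases hDe with rfl | ⟨x, hx⟩
      · have := hvol 0 (zero_mem _) (by simp)
        rw [hc', vol, eval_single] at this
        simp only [den, List.map_nil, List.prod_nil, div_one, mul_eq_zero, h0, or_false,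
          Int.cast_eq_zero] at this
        rw [hc', this]
        simp
      · -- In dimension `0`, Cramer's rule for the tuple `[x]` says that `ω [] * ξ x = 0`.
        obtain ⟨ξ, hξ, hξx⟩ := hD x hx
        have := hω.cramer ξ hξ [x] rfl
        simp [cramer, h0, hξx] at this
  | succ k ihk =>
    intro Ξ ω hω D
    classical
    induction D using Finset.induction_on with
    | empty =>
      intro _ c hc _
      refine ⟨0, zero_mem _, ?_⟩
      rw [map_zero, sub_zero]
      refine on_mono (fun l hl => ?_) hc
      obtain ⟨h1, h2⟩ := hl
      rcases l with _ | ⟨x, l⟩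
      · simp at h1
      · exact absurd (h2 x (by simp)) (by simp)
    | insert v D' hv ihD =>
      intro hD c hc hvol
      obtain ⟨η, hη, hηv⟩ := hD v (by simp)
      set b := bd c with hb
      have hbmem : b ∈ on (fun l => l.length = k ∧ ∀ x ∈ l, x ∈ insert v D') :=
        bd_mem_on (fun l l' hl hs hlen => ⟨by omega, fun x hx => hl.2 x (hs.subset hx)⟩) hc
      -- `good x` says that `x` is not a multiple of `v`, as far as `Ξ` can tell.
      let good : X → Prop := fun x => ∃ ξ ∈ quot Ξ v, ξ x ≠ 0
      have hωbad : ∀ l : List X, l.length = k → ¬ (∀ x ∈ l, good x) → ω (v :: l) = 0 := by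
        intro l hl hbad
        push Not at hbad
        obtain ⟨x, hx, hx0⟩ := hbad
        have hx0' : ∀ ξ ∈ quot Ξ v, ξ x = 0 := fun ξ hξ => by
          by_contra h
          exact hx0 ⟨ξ, hξ, h⟩
        exact (hω.quot v).eq_zero_of_mem hl hx hx0'
      set b₁ := part (fun l => ∀ x ∈ l, good x) b with hb₁
      set D'' := D'.filter good with hD''
      have hvbad : ¬ good v := fun ⟨ξ, hξ, h⟩ => h hξ.2
      have hb₁mem : b₁ ∈ on (fun l => l.length = k ∧ ∀ x ∈ l, x ∈ D'') := by
        refine on_mono (fun l hl => ⟨hl.1.1, fun x hx => ?_⟩)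
          (part_mem_of_mem (fun l => ∀ x ∈ l, good x) hbmem)
        rw [hD'', Finset.mem_filter]
        refine ⟨?_, hl.2 x hx⟩
        have := hl.1.2 x hx
        rw [Finset.mem_insert] at this
        rcases this with rfl | h
        · exact absurd (hl.2 x hx) hvbad
        · exact h
      have hbb₁ : cone v b - cone v b₁ ∈ on (fun l => ω l = 0) := by
        rw [← map_sub, hb₁]
        nth_rewrite 1 [← part_add_part (fun l => ∀ x ∈ l, good x) b]
        rw [add_sub_cancel_left]
        exact cone_mem_on (fun l hl => hωbad l hl.1.1 hl.2)
          (part_mem_of_mem (fun l => ¬ ∀ x ∈ l, good x) hbmem)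
      have hceq : c = bd (cone v c) + cone v b := by rw [bd_cone]; abel
      have hvolb₁ : ∀ ξ ∈ Ξ, (∀ x ∈ insert v D', ξ x ≠ 0) → vol ω ξ (cone v b₁) = 0 := by
        intro ξ hξ hne
        have h1 : vol ω ξ (bd (cone v c)) = 0 := by
          refine hω.vol_bd hξ (cone_mem_on (fun l hl => ?_) hc)
          refine ⟨by simp [hl.1], fun x hx => hne x ?_⟩
          rcases List.mem_cons.1 hx with rfl | hx
          · simp
          · exact hl.2 x hx
        have h2 := hvol ξ hξ hne
        rw [hceq, map_add, h1, zero_add] at h2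
        have h3 := vol_eq_zero_of_ω (ξ := ξ) hbb₁
        rw [map_sub, h2, zero_sub, neg_eq_zero] at h3
        exact h3
      -- The residue at `ξ v = 0`.
      have hvolq : ∀ ξ ∈ quot Ξ v, (∀ x ∈ D'', ξ x ≠ 0) →
          vol (fun l => ω (v :: l)) ξ b₁ = 0 := by
        intro ξ hξ hne
        have hlim := tendsto_vol (fun l => ω (v :: l)) ξ η (c := b₁)
          (on_mono (fun l hl => Or.inr fun x hx => hne x (hl.2 x hx)) hb₁mem)
        refine tendsto_nhds_unique hlim ?_
        refine Filter.Tendsto.congr' ?_ (tendsto_const_nhds (x := (0 : ℝ)))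
        have hne' : ∀ x ∈ D', ξ x ≠ 0 ∨ η x ≠ 0 := by
          intro x hx
          by_contra h
          push Not at h
          -- If `ξ x = 0` then `x` is a multiple of `v`, so that `η x ≠ 0`.
          have hbad : ¬ good x := fun hg => hne x (Finset.mem_filter.2 ⟨hx, hg⟩) h.1
          obtain ⟨ζ, hζ, hζx⟩ := hD x (by simp [hx])
          refine hbad ⟨η v • ζ - ζ v • η, ⟨sub_mem (Submodule.smul_mem _ _ hζ)
            (Submodule.smul_mem _ _ hη), by simp [mul_comm]⟩, ?_⟩
          simp [h.2, hηv, hζx]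
        filter_upwards [eventually_add_smul_ne (ξ := ξ) (η := η) (D := insert v D') (fun x hx => by
          rcases Finset.mem_insert.1 hx with rfl | hx
          · exact Or.inr hηv
          · exact hne' x hx)] with t hall
        have hv0 := hall v (by simp)
        have h1 := hvolb₁ (ξ + t • η) (add_mem hξ.1 (Submodule.smul_mem _ _ hη)) hall
        unfold vol at h1 ⊢
        rw [eval_cone] at h1
        have h2 : (fun l => ω (v :: l) / den (ξ + t • η) (v :: l)) =
            fun l => ((ξ + t • η) v)⁻¹ * (ω (v :: l) / den (ξ + t • η) l) := by
          funext l
          rw [den_cons, div_mul_eq_div_div_swap, div_eq_inv_mul]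
        rw [h2, eval_smul, mul_eq_zero] at h1
        exact (h1.resolve_left (inv_ne_zero hv0)).symm
      obtain ⟨a, ha, ha2⟩ := ihk (quot Ξ v) _ (hω.quot v) D''
        (fun x hx => (Finset.mem_filter.1 hx).2) b₁ hb₁mem hvolq
      have haD' : a ∈ on (fun l => l.length = k + 1 ∧ ∀ x ∈ l, x ∈ D') :=
        on_mono (fun l hl => ⟨hl.1, fun x hx => (Finset.mem_filter.1 (hl.2 x hx)).1⟩) ha
      have haD : a ∈ on (fun l => l.length = k + 1 ∧ ∀ x ∈ l, x ∈ insert v D') :=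
        on_mono (fun l hl => ⟨hl.1, fun x hx => Finset.mem_insert_of_mem (hl.2 x hx)⟩) haD'
      have hcone : cone v b₁ - cone v (bd a) ∈ on (fun l => ω l = 0) := by
        rw [← map_sub]
        exact cone_mem_on (fun l hl => hl) ha2
      have hca : c - bd (cone v c - cone v a) - a ∈ on (fun l => ω l = 0) := by
        have : c - bd (cone v c - cone v a) - a =
            (cone v b - cone v b₁) + (cone v b₁ - cone v (bd a)) := by
          rw [map_sub, bd_cone, bd_cone]; abel
        rw [this]
        exact add_mem hbb₁ hcone
      have hconemem : cone v c - cone v a ∈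
          on (fun l => l.length = k + 1 + 1 ∧ ∀ x ∈ l, x ∈ insert v D') := by
        have : ∀ l : List X, (l.length = k + 1 ∧ ∀ x ∈ l, x ∈ insert v D') →
            ((v :: l).length = k + 1 + 1 ∧ ∀ x ∈ v :: l, x ∈ insert v D') := by
          intro l hl
          refine ⟨by simp [hl.1], fun x hx => ?_⟩
          rcases List.mem_cons.1 hx with rfl | hx
          · simp
          · exact hl.2 x hx
        exact sub_mem (cone_mem_on this hc) (cone_mem_on this haD)
      have hvola' : ∀ ξ ∈ Ξ, (∀ x ∈ insert v D', ξ x ≠ 0) → vol ω ξ a = 0 := by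
        intro ξ hξ hne
        have h1 := vol_eq_zero_of_ω (ξ := ξ) hca
        have h2 : vol ω ξ (bd (cone v c - cone v a)) = 0 :=
          hω.vol_bd hξ (on_mono (fun l hl => ⟨hl.1, fun x hx => hne x (hl.2 x hx)⟩) hconemem)
        rw [map_sub, map_sub, h2, hvol ξ hξ hne] at h1
        linarith
      -- By continuity, the volume function of `a` also vanishes where `ξ v = 0`.
      have hvola : ∀ ξ ∈ Ξ, (∀ x ∈ D', ξ x ≠ 0) → vol ω ξ a = 0 := by
        intro ξ hξ hne
        refine tendsto_nhds_unique (tendsto_vol ω ξ η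
          (on_mono (fun l hl => Or.inr fun x hx => hne x (hl.2 x hx)) haD')) ?_
        refine Filter.Tendsto.congr' ?_ (tendsto_const_nhds (x := (0 : ℝ)))
        have := eventually_add_smul_ne (ξ := ξ) (η := η) (D := insert v D') (fun x hx => by
          rcases Finset.mem_insert.1 hx with rfl | hx
          · exact Or.inr hηv
          · exact Or.inl (hne x hx))
        filter_upwards [this] with t ht
        exact (hvola' _ (add_mem hξ (Submodule.smul_mem _ _ hη)) ht).symm
      obtain ⟨a', ha', ha2'⟩ := ihD (fun x hx => hD x (Finset.mem_insert_of_mem hx)) a haD' hvola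
      refine ⟨a' + (cone v c - cone v a), add_mem (on_mono (fun l hl =>
        ⟨hl.1, fun x hx => Finset.mem_insert_of_mem (hl.2 x hx)⟩) ha') hconemem, ?_⟩
      have : c - bd (a' + (cone v c - cone v a)) =
          (c - bd (cone v c - cone v a) - a) + (a - bd a') := by
        rw [map_add]; abel
      rw [this]
      exact add_mem hca ha2'

end VolumeForm
end

noncomputable section
/-! ### Volumes of simplicial cones -/

namespace Ch

variable {X : Type*}

theorem bdList_ofFn {m : ℕ} (z : Fin (m + 1) → X) :
    bdList (List.ofFn z) =
      ∑ i : Fin (m + 1), (-1 : ℤ) ^ (i : ℕ) • Finsupp.single (List.ofFn (z ∘ i.succAbove)) 1 := by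
  induction m with
  | zero => simp [bdList]
  | succ m ih =>
    rw [List.ofFn_succ, bdList, ih, sub_eq_add_neg]
    conv_rhs => rw [Fin.sum_univ_succ]
    congr 1
    · simp [Function.comp_def]
    · rw [map_sum, ← Finset.sum_neg_distrib]
      refine Finset.sum_congr rfl fun i _ => ?_
      rw [map_smul, cone_single, Fin.val_succ, pow_succ, mul_neg_one, neg_smul]
      congr 3
      rw [List.ofFn_succ]
      congr 1
      simp [Function.comp_def]

end Ch

namespace VolumeForm

open Ch MeasureTheory

variable {X : Type*}

theorem cramer_ofFn {m : ℕ} (ξ : X → ℝ) (ω : List X → ℝ) (z : Fin (m + 1) → X) :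
    cramer ξ ω (List.ofFn z) =
      ∑ i : Fin (m + 1), (-1 : ℝ) ^ (i : ℕ) * (ω (List.ofFn (z ∘ i.succAbove)) * ξ (z i)) := by
  induction m generalizing ω with
  | zero => simp [cramer]
  | succ m ih =>
    rw [List.ofFn_succ, cramer, ih, sub_eq_add_neg]
    conv_rhs => rw [Fin.sum_univ_succ]
    congr 1
    · simp [Function.comp_def]
    · rw [← Finset.sum_neg_distrib]
      refine Finset.sum_congr rfl fun i _ => ?_
      rw [Fin.val_succ, pow_succ, mul_neg_one, neg_mul]
      congr 4
      rw [List.ofFn_succ]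
      congr 1
      simp [Function.comp_def]

theorem cramer_map {W : Type*} (φ : W → ℝ) (u : X → W) (ω : List W → ℝ) (l : List X) :
    cramer (φ ∘ u) (fun l => ω (l.map u)) l = cramer φ ω (l.map u) := by
  induction l generalizing ω with
  | nil => simp [cramer]
  | cons x l ih =>
    rw [List.map_cons, cramer, cramer, ← ih]
    rfl

variable {W : Type*} [AddCommGroup W] [Module ℝ W] {k : ℕ}

/-- A determinant evaluated on a list of vectors. -/
def detList {m : ℕ} (b : Module.Basis (Fin m) ℝ W) (L : List W) : ℝ :=
  b.det fun i => L.getD i 0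

theorem detList_ofFn {m : ℕ} (b : Module.Basis (Fin m) ℝ W) (v : Fin m → W) :
    detList b (List.ofFn v) = b.det v := by
  unfold detList
  congr 1
  funext i
  simp [List.getD_eq_getElem?_getD]

theorem exists_ofFn_eq {m : ℕ} {l : List X} (h : l.length = m) :
    ∃ v : Fin m → X, l = List.ofFn v := by
  subst h
  exact ⟨l.get, (List.ofFn_get l).symm⟩

/-- Cramer's rule: the left-hand side is an alternating form of degree larger than the
dimension. -/
theorem cramer_detList {m : ℕ} (b : Module.Basis (Fin m) ℝ W) (φ : W →ₗ[ℝ] ℝ) (L : List W)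
    (hL : L.length = m + 1) : cramer φ (detList b) L = 0 := by
  obtain ⟨v, rfl⟩ := exists_ofFn_eq hL
  let f : W →ₗ[ℝ] W [⋀^Fin m]→ₗ[ℝ] ℝ := φ.smulRight b.det
  have h1 : AlternatingMap.alternatizeUncurryFin f v = 0 := by
    refine AlternatingMap.map_linearDependent _ v fun hli => ?_
    have := Module.Finite.of_basis b
    have := hli.fintype_card_le_finrank (R := ℝ) (M := W)
    rw [Module.finrank_eq_card_basis b] at this
    simp at this
  rw [AlternatingMap.alternatizeUncurryFin_apply] at h1
  rw [cramer_ofFn, ← h1]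
  refine Finset.sum_congr rfl fun i _ => ?_
  rw [detList_ofFn]
  simp only [f, LinearMap.smulRight_apply, AlternatingMap.smul_apply, smul_eq_mul, zsmul_eq_mul]
  push_cast
  rw [mul_comm (φ _)]
  rfl

/-- The functions on the labels given by the linear functionals that vanish at `N`. -/
def functionals (u : X → W) (N : W) : Submodule ℝ (X → ℝ) where
  carrier := {ξ | ∃ φ : W →ₗ[ℝ] ℝ, φ N = 0 ∧ ξ = φ ∘ u}
  add_mem' := by
    rintro _ _ ⟨φ, h, rfl⟩ ⟨φ', h', rfl⟩
    exact ⟨φ + φ', by simp [h, h'], rfl⟩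
  zero_mem' := ⟨0, rfl, rfl⟩
  smul_mem' := by
    rintro a _ ⟨φ, h, rfl⟩
    exact ⟨a • φ, by simp [h], rfl⟩

/-- The determinant of a tuple of labels relative to the vector `N`. -/
def relDet (b : Module.Basis (Fin (k + 1)) ℝ W) (u : X → W) (N : W) (l : List X) : ℝ :=
  detList b (N :: l.map u)

theorem relDet_ofFn (b : Module.Basis (Fin (k + 1)) ℝ W) (u : X → W) (N : W) (v : Fin k → X) :
    relDet b u N (List.ofFn v) = b.det (Fin.cons N (u ∘ v) : Fin (k + 1) → W) := by
  rw [relDet, ← detList_ofFn, List.ofFn_succ, List.map_ofFn]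
  rfl

/-- A determinant is a volume on the functionals that vanish on `N`: by Cramer's rule, and because
it vanishes if one of the vectors is in the span of `N` and the other vectors. -/
theorem isVolume_relDet (b : Module.Basis (Fin (k + 1)) ℝ W) (u : X → W) (N : W) :
    IsVolume (functionals u N) k (relDet b u N) where
  cramer := by
    rintro _ ⟨φ, hφ, rfl⟩ l hl
    have h1 := cramer_detList b φ (N :: l.map u) (by simpa using hl)
    rw [cramer, hφ, mul_zero, zero_sub, neg_eq_zero] at h1
    rw [← h1]
    exact cramer_map φ u (fun L => detList b (N :: L)) l
  dep := by
    intro l₁ x l₂ hl hx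
    set S := Submodule.span ℝ {w | w ∈ N :: (l₁ ++ l₂).map u} with hS
    have hmem : u x ∈ S := by
      by_contra hnot
      obtain ⟨φ, hφ, hφS⟩ := Submodule.exists_le_ker_of_notMem hnot
      refine hφ (hx _ ⟨φ, ?_, rfl⟩ fun y hy => ?_)
      · exact hφS (Submodule.subset_span (by simp))
      · exact hφS (Submodule.subset_span (List.mem_cons_of_mem _ (List.mem_map_of_mem hy)))
    by_contra hne
    obtain ⟨v, hv⟩ :=
      exists_ofFn_eq (l := N :: (l₁ ++ x :: l₂).map u) (m := k + 1) (by simpa using hl)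
    rw [relDet, hv, detList_ofFn] at hne
    have hli : LinearIndependent ℝ v := by
      by_contra h
      exact hne (AlternatingMap.map_linearDependent _ v h)
    -- The vector `u x` sits at the position `l₁.length + 1` of the tuple.
    have hlen : l₁.length + 1 < k + 1 := by simp at hl; omega
    have hpos : ∀ i : Fin (k + 1), v i = (N :: (l₁ ++ x :: l₂).map u)[(i : ℕ)]'(by
        simp at hl ⊢; omega) := by
      intro i
      rw [List.getElem_of_eq hv, List.getElem_ofFn]
    have hvx : v ⟨l₁.length + 1, hlen⟩ = u x := by
      rw [hpos]; simp
    refine hli.notMem_span_image (s := {i | i ≠ ⟨l₁.length + 1, hlen⟩}) (x := ⟨l₁.length + 1, hlen⟩)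
      (by simp) ?_
    rw [hvx]
    refine Submodule.span_mono ?_ hmem
    intro w hw
    rcases List.mem_cons.1 hw with rfl | hw
    · refine ⟨0, ?_, by rw [hpos]; simp⟩
      simp [Fin.ext_iff]
    · obtain ⟨y, hy, rfl⟩ := List.mem_map.1 hw
      rcases List.mem_append.1 hy with hy | hy
      · obtain ⟨j, hj, rfl⟩ := List.mem_iff_getElem.1 hy
        refine ⟨⟨j + 1, by omega⟩, ?_, ?_⟩
        · simp [Fin.ext_iff]; omega
        · rw [hpos]; simp [List.getElem_append_left, hj]
      · obtain ⟨j, hj, rfl⟩ := List.mem_iff_getElem.1 hy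
        have : l₁.length + 1 + (j + 1) < k + 1 := by simp at hl; omega
        refine ⟨⟨l₁.length + 1 + (j + 1), this⟩, ?_, ?_⟩
        · simp [Fin.ext_iff]
        · rw [hpos]
          have e : l₁.length + 1 + (j + 1) = l₁.length + (j + 1) + 1 := by omega
          simp only [e, List.getElem_cons_succ, List.map_append, List.map_cons]
          rw [List.getElem_append_right (by simp)]
          simp

/-- The signed indicator function of the open simplicial cone spanned by a tuple, extended to
be invariant under translation by `N`. -/
def signedCone (b : Module.Basis (Fin (k + 1)) ℝ W) (u : X → W) (N : W) (y : W) (l : List X) : ℝ :=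
  open scoped Classical in
  if ∃ (a : ℝ) (t : Fin l.length → ℝ), (∀ i, 0 < t i) ∧ y = a • N + ∑ i, t i • u (l.get i)
  then SignType.sign (relDet b u N l) else 0

open scoped Classical in
theorem signedCone_ofFn (b : Module.Basis (Fin (k + 1)) ℝ W) (u : X → W) (N : W) (y : W)
    {m : ℕ} (v : Fin m → X) :
    signedCone b u N y (List.ofFn v) =
      if ∃ (a : ℝ) (t : Fin m → ℝ), (∀ i, 0 < t i) ∧ y = a • N + ∑ i, t i • u (v i)
      then ((SignType.sign (relDet b u N (List.ofFn v)) : SignType) : ℝ) else 0 := by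
  unfold signedCone
  have hlen : (List.ofFn v).length = m := by simp
  refine if_congr (exists_congr fun a => ?_) rfl rfl
  constructor
  · rintro ⟨t, ht, h⟩
    refine ⟨fun i => t (i.cast hlen.symm), fun i => ht _, ?_⟩
    rw [h, ← Equiv.sum_comp (finCongr hlen.symm)]
    simp
  · rintro ⟨t, ht, h⟩
    refine ⟨fun i => t (i.cast hlen), fun i => ht _, ?_⟩
    rw [h, ← Equiv.sum_comp (finCongr hlen)]
    simp
    rfl

end VolumeForm
end

noncomputable section
namespace VolumeForm

open Ch MeasureTheory

variable {X : Type*} {W : Type*} [AddCommGroup W] [Module ℝ W] {k : ℕ}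

/-- The factors of the integrand of the Laplace transform, in the coordinates of the cone. -/
def laplaceFactor (a : Fin k → ℝ) : Fin (k + 1) → ℝ → ℝ :=
  Fin.cons ((Set.Ioo 0 1).indicator fun _ => 1)
    fun i => (Set.Ioi 0).indicator fun t => Real.exp (-a i * t)

theorem integrable_laplaceFactor {a : Fin k → ℝ} (ha : ∀ i, 0 < a i) (i : Fin (k + 1)) :
    Integrable (laplaceFactor a i) := by
  refine Fin.cases ?_ (fun i => ?_) i
  · simp only [laplaceFactor, Fin.cons_zero]
    rw [integrable_indicator_iff measurableSet_Ioo]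
    exact integrableOn_const (by simp)
  · simp only [laplaceFactor, Fin.cons_succ]
    rw [integrable_indicator_iff measurableSet_Ioi]
    exact exp_neg_integrableOn_Ioi 0 (ha i)

theorem integral_laplaceFactor {a : Fin k → ℝ} (ha : ∀ i, 0 < a i) :
    ∫ t : Fin (k + 1) → ℝ, ∏ i, laplaceFactor a i (t i) = ∏ i, (a i)⁻¹ := by
  rw [integral_fintype_prod_volume_eq_prod, Fin.prod_univ_succ]
  have h0 : ∫ t, laplaceFactor a 0 t = 1 := by
    simp only [laplaceFactor, Fin.cons_zero]
    rw [integral_indicator measurableSet_Ioo]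
    simp
  rw [h0, one_mul]
  refine Finset.prod_congr rfl fun i _ => ?_
  simp only [laplaceFactor, Fin.cons_succ]
  rw [integral_indicator measurableSet_Ioi, integral_exp_mul_Ioi (by linarith [ha i])]
  simp

/-- The integrand of the Laplace transform, in the coordinates given by the basis `b`. -/
def laplaceIntegrand (b : Module.Basis (Fin (k + 1)) ℝ W) (u : X → W) (N : W) (ν φ : W →ₗ[ℝ] ℝ)
    (l : List X) (z : Fin (k + 1) → ℝ) : ℝ :=
  signedCone b u N (b.equivFun.symm z) l *
    ((Set.Ioo (0 : ℝ) 1).indicator (fun _ => 1) (ν (b.equivFun.symm z)) *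
      Real.exp (-φ (b.equivFun.symm z)))

/-- The Laplace transform of a simplicial cone, thickened in the direction `N`. -/
theorem integral_laplaceIntegrand (b : Module.Basis (Fin (k + 1)) ℝ W) (u : X → W) (N : W)
    (ν φ : W →ₗ[ℝ] ℝ) (hνN : ν N = 1) (hφN : φ N = 0) (v : Fin k → X) (hν : ∀ i, ν (u (v i)) = 0)
    (hφ : ∀ i, 0 < φ (u (v i))) :
    Integrable (laplaceIntegrand b u N ν φ (List.ofFn v)) ∧
      ∫ z, laplaceIntegrand b u N ν φ (List.ofFn v) z =
        relDet b u N (List.ofFn v) / den (φ ∘ u) (List.ofFn v) := by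
  classical
  set V : Fin (k + 1) → W := Fin.cons N (u ∘ v) with hV
  have hdet : relDet b u N (List.ofFn v) = b.det V := relDet_ofFn b u N v
  have hden : den (φ ∘ u) (List.ofFn v) = ∏ i, φ (u (v i)) := by
    rw [den, List.map_ofFn, List.prod_ofFn]; rfl
  by_cases h0 : b.det V = 0
  · have : laplaceIntegrand b u N ν φ (List.ofFn v) = 0 := by
      funext z
      simp [laplaceIntegrand, signedCone, hdet, h0]
    rw [this, hdet, h0]
    simp
  · set M : (Fin (k + 1) → ℝ) →ₗ[ℝ] (Fin (k + 1) → ℝ) := Matrix.toLin' (b.toMatrix V) with hM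
    have hMdet : LinearMap.det M = b.det V := by
      rw [hM, LinearMap.det_toLin', ← Module.Basis.det_apply]
    have hMne : LinearMap.det M ≠ 0 := by rwa [hMdet]
    have hMsymm : ∀ t, b.equivFun.symm (M t) = ∑ i, t i • V i := by
      intro t
      rw [LinearEquiv.symm_apply_eq, map_sum]
      funext j
      simp [hM, Matrix.mulVec, dotProduct, Module.Basis.toMatrix_apply, mul_comm]
    have hli : LinearIndependent ℝ V := by
      by_contra h
      exact h0 (AlternatingMap.map_linearDependent _ V h)
    have hemb : MeasurableEmbedding M := by
      have : (M : (Fin (k + 1) → ℝ) → (Fin (k + 1) → ℝ)) =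
          ((LinearEquiv.ofIsUnitDet (f := M) (v := Pi.basisFun ℝ _) (v' := Pi.basisFun ℝ _) (by
            rw [LinearMap.det_toMatrix]
            exact isUnit_iff_ne_zero.2 hMne)).toContinuousLinearEquiv.toHomeomorph) := by
        funext t; rfl
      rw [this]
      exact Homeomorph.measurableEmbedding _
    have hmap := Real.map_linearMap_volume_pi_eq_smul_volume_pi hMne
    have hvol : (volume : Measure (Fin (k + 1) → ℝ)) =
        ENNReal.ofReal |LinearMap.det M| • Measure.map M volume := by
      rw [hmap, smul_smul, ← ENNReal.ofReal_mul (abs_nonneg _), ← abs_mul, mul_inv_cancel₀ hMne]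
      simp
    have hcomp : ∀ t, laplaceIntegrand b u N ν φ (List.ofFn v) (M t) =
        (SignType.sign (b.det V) : ℝ) * ∏ i, laplaceFactor (fun i => φ (u (v i))) i (t i) := by
      intro t
      have hνt : ν (∑ i, t i • V i) = t 0 := by
        simp [Fin.sum_univ_succ, hV, hνN, hν]
      have hφt : φ (∑ i, t i • V i) = ∑ i : Fin k, t i.succ * φ (u (v i)) := by
        simp [Fin.sum_univ_succ, hV, hφN]
      have hcone : (∃ (a : ℝ) (s : Fin k → ℝ), (∀ i, 0 < s i) ∧
          (∑ i, t i • V i) = a • N + ∑ i, s i • u (v i)) ↔ ∀ i : Fin k, 0 < t i.succ := by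
        constructor
        · rintro ⟨a, s, hs, h⟩ i
          have h1 : ∑ i, t i • V i = ∑ i, (Fin.cons a s : Fin (k + 1) → ℝ) i • V i := by
            rw [h, Fin.sum_univ_succ]; simp [hV]
          have h2 := Fintype.linearIndependent_iff.1 hli
            (fun i => t i - (Fin.cons a s : Fin (k + 1) → ℝ) i)
            (by simp [sub_smul, Finset.sum_sub_distrib, h1]) i.succ
          rw [Fin.cons_succ, sub_eq_zero] at h2
          rw [h2]; exact hs i
        · intro h
          exact ⟨t 0, fun i => t i.succ, h, by rw [Fin.sum_univ_succ]; simp [hV]⟩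
      rw [laplaceIntegrand, hMsymm, hνt, hφt, signedCone_ofFn, hdet, Fin.prod_univ_succ]
      simp only [hcone, laplaceFactor, Fin.cons_zero, Fin.cons_succ]
      by_cases hpos : ∀ i : Fin k, 0 < t i.succ
      · rw [if_pos hpos]
        congr 2
        rw [← Finset.sum_neg_distrib, Real.exp_sum]
        refine Finset.prod_congr rfl fun i _ => ?_
        rw [Set.indicator_of_mem (by simpa using hpos i)]
        congr 1; ring
      · rw [if_neg hpos]
        push Not at hpos
        obtain ⟨i, hi⟩ := hpos
        have hz : ∏ i, (Set.Ioi (0 : ℝ)).indicator (fun s => Real.exp (-φ (u (v i)) * s))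
            (t i.succ) = 0 :=
          Finset.prod_eq_zero (Finset.mem_univ i)
            (Set.indicator_of_notMem (by simpa using hi) _)
        rw [hz]
        simp
    have hint : Integrable fun t : Fin (k + 1) → ℝ =>
        ∏ i, laplaceFactor (fun i => φ (u (v i))) i (t i) :=
      Integrable.fintype_prod (f := laplaceFactor (fun i => φ (u (v i))))
        (μ := fun _ => volume) (integrable_laplaceFactor hφ)
    constructor
    · rw [hvol]
      refine Integrable.smul_measure ?_ (by simp)
      rw [hemb.integrable_map_iff]
      refine (hint.const_mul (SignType.sign (b.det V) : ℝ)).congr (Filter.Eventually.of_forall ?_)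
      exact fun t => (hcomp t).symm
    · rw [hvol, integral_smul_measure, hemb.integral_map]
      simp only [hcomp]
      rw [integral_const_mul, integral_laplaceFactor hφ, hMdet, hdet, hden,
        ENNReal.toReal_ofReal (abs_nonneg _), Finset.prod_inv_distrib, smul_eq_mul, ← mul_assoc,
        mul_comm |b.det V|, sign_mul_abs, div_eq_mul_inv]

/-- A chain of simplicial cones in the hyperplane `ν = 0` whose signed indicator functions cancel at
generic points has a vanishing volume function where all its rays are positive. -/
theorem vol_eq_zero_of_signedCone (b : Module.Basis (Fin (k + 1)) ℝ W) (u : X → W) (N : W)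
    (ν φ : W →ₗ[ℝ] ℝ) (hνN : ν N = 1) (hφN : φ N = 0) {c : Ch X}
    (hc : c ∈ on (fun l => l.length = k ∧ ∀ x ∈ l, ν (u x) = 0 ∧ 0 < φ (u x)))
    (H : Finset (W →ₗ[ℝ] ℝ)) (hH : ∀ ψ ∈ H, ψ ≠ 0)
    (hgen : ∀ y, (∀ ψ ∈ H, ψ y ≠ 0) → eval (signedCone b u N y) c = 0) :
    vol (relDet b u N) (φ ∘ u) c = 0 := by
  have hsingle : ∀ l ∈ c.support, Integrable (laplaceIntegrand b u N ν φ l) ∧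
      ∫ z, laplaceIntegrand b u N ν φ l z = relDet b u N l / den (φ ∘ u) l := by
    intro l hl
    obtain ⟨h1, h2⟩ := mem_on.1 hc l (Finsupp.mem_support_iff.1 hl)
    obtain ⟨v, rfl⟩ := exists_ofFn_eq h1
    exact integral_laplaceIntegrand b u N ν φ hνN hφN v (fun i => (h2 _ (by simp)).1)
      (fun i => (h2 _ (by simp)).2)
  have hsum : ∫ z, ∑ l ∈ c.support, (c l : ℝ) * laplaceIntegrand b u N ν φ l z =
      vol (relDet b u N) (φ ∘ u) c := by
    rw [integral_finsetSum _ fun l hl => (hsingle l hl).1.const_mul _, vol, eval_eq_sum]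
    refine Finset.sum_congr rfl fun l hl => ?_
    rw [integral_const_mul, (hsingle l hl).2]
  rw [← hsum]
  refine integral_eq_zero_of_ae ?_
  have hae : ∀ᵐ z : Fin (k + 1) → ℝ, ∀ ψ ∈ H, ψ (b.equivFun.symm z) ≠ 0 := by
    rw [Filter.eventually_all_finset]
    intro ψ hψ
    have hker : LinearMap.ker (ψ ∘ₗ (b.equivFun.symm : (Fin (k + 1) → ℝ) →ₗ[ℝ] W)) ≠ ⊤ := by
      intro h
      apply hH ψ hψ
      ext w
      have := LinearMap.congr_fun (LinearMap.ker_eq_top.1 h) (b.equivFun w)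
      simpa using this
    have := Measure.addHaar_submodule (volume : Measure (Fin (k + 1) → ℝ)) _ hker
    filter_upwards [measure_eq_zero_iff_ae_notMem.1 this] with z hz
    exact fun h => hz h
  filter_upwards [hae] with z hz
  have h1 := hgen _ hz
  rw [eval_eq_sum] at h1
  have : ∑ l ∈ c.support, (c l : ℝ) * laplaceIntegrand b u N ν φ l z =
      (∑ l ∈ c.support, (c l : ℝ) * signedCone b u N (b.equivFun.symm z) l) *
        ((Set.Ioo (0 : ℝ) 1).indicator (fun _ => 1) (ν (b.equivFun.symm z)) *
          Real.exp (-φ (b.equivFun.symm z))) := by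
    rw [Finset.sum_mul]
    exact Finset.sum_congr rfl fun l _ => by rw [laplaceIntegrand, mul_assoc]
  rw [this, h1, zero_mul]
  rfl

/-- A volume function that vanishes near a point vanishes wherever it is defined: on a line, it is
the quotient of two polynomials. -/
theorem vol_eq_zero_of_eventually {ω : List X → ℝ} {D : Finset X} {c : Ch X}
    (hc : c ∈ on (fun l => l.length = k ∧ ∀ x ∈ l, x ∈ D)) {ξ η : X → ℝ}
    (hξ : ∀ x ∈ D, ξ x ≠ 0) (hη : ∀ x ∈ D, (ξ + (1 : ℝ) • η) x ≠ 0)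
    (h : ∀ᶠ t in nhds (0 : ℝ), vol ω (ξ + t • η) c = 0) : vol ω (ξ + (1 : ℝ) • η) c = 0 := by
  classical
  let lin : X → Polynomial ℝ := fun x => Polynomial.C (ξ x) + Polynomial.C (η x) * Polynomial.X
  have hlin : ∀ x (t : ℝ), (lin x).eval t = (ξ + t • η) x := by
    intro x t
    simp only [lin, Polynomial.eval_add, Polynomial.eval_mul, Polynomial.eval_C, Polynomial.eval_X,
      Pi.add_apply, Pi.smul_apply, smul_eq_mul]
    ring
  -- The numerator over the common denominator `(∏_{x ∈ D} ξ x) ^ k`.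
  let P : Polynomial ℝ := ∑ l ∈ c.support, Polynomial.C ((c l : ℝ) * ω l) *
    (l.map fun x => ∏ x' ∈ D.erase x, lin x').prod
  have hP : ∀ t : ℝ, (∀ x ∈ D, (ξ + t • η) x ≠ 0) →
      P.eval t = vol ω (ξ + t • η) c * (∏ x ∈ D, (ξ + t • η) x) ^ k := by
    intro t ht
    rw [vol, eval_eq_sum, Finset.sum_mul, Polynomial.eval_finsetSum]
    refine Finset.sum_congr rfl fun l hl => ?_
    obtain ⟨h1, h2⟩ := mem_on.1 hc l (Finsupp.mem_support_iff.1 hl)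
    have key : ∀ l : List X, (∀ x ∈ l, x ∈ D) →
        ((l.map fun x => ∏ x' ∈ D.erase x, lin x').prod.eval t) * den (ξ + t • η) l =
          (∏ x ∈ D, (ξ + t • η) x) ^ l.length := by
      intro l hl
      induction l with
      | nil => simp [den]
      | cons x l ih =>
        rw [List.map_cons, List.prod_cons, Polynomial.eval_mul, den_cons, List.length_cons,
          pow_succ, ← ih fun y hy => hl y (by simp [hy]), Polynomial.eval_prod,
          ← Finset.mul_prod_erase D _ (hl x (by simp))]
        simp only [hlin]
        ring
    have hd : den (ξ + t • η) l ≠ 0 := den_ne_zero fun x hx => ht x (h2 x hx)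
    rw [Polynomial.eval_mul, Polynomial.eval_C, ← h1, ← key l h2]
    field_simp
  have hev : ∀ᶠ t in nhds (0 : ℝ), ∀ x ∈ D, (ξ + t • η) x ≠ 0 := by
    rw [Filter.eventually_all_finset]
    intro x hx
    have : Filter.Tendsto (fun t : ℝ => (ξ + t • η) x) (nhds 0) (nhds (ξ x)) := by
      have : Continuous fun t : ℝ => (ξ + t • η) x := by
        simp only [Pi.add_apply, Pi.smul_apply, smul_eq_mul]
        fun_prop
      simpa using this.tendsto 0
    exact this.eventually_ne (hξ x hx)
  have hP0 : P = 0 := by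
    refine Polynomial.eq_zero_of_infinite_isRoot P ?_
    have : ∀ᶠ t in nhds (0 : ℝ), P.IsRoot t := by
      filter_upwards [h, hev] with t h1 h2
      rw [Polynomial.IsRoot, hP t h2, h1, zero_mul]
    exact infinite_of_mem_nhds (0 : ℝ) this
  have h1 := hP 1 hη
  rw [hP0, Polynomial.eval_zero, eq_comm, mul_eq_zero] at h1
  exact h1.resolve_right (pow_ne_zero _ (Finset.prod_ne_zero_iff.2 hη))

/-- A chain of simplicial cones in a hyperplane, with rays in an open half-space, whose signed
indicator functions cancel at generic points is a boundary, up to degenerate cones. -/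
theorem exists_bd_of_signedCone (b : Module.Basis (Fin (k + 1)) ℝ W) (u : X → W) (N : W)
    (ν φ : W →ₗ[ℝ] ℝ) (hνN : ν N = 1) {D : Finset X} (hD : ∀ x ∈ D, ν (u x) = 0 ∧ 0 < φ (u x))
    {c : Ch X} (hc : c ∈ on (fun l => l.length = k ∧ ∀ x ∈ l, x ∈ D))
    (H : Finset (W →ₗ[ℝ] ℝ)) (hH : ∀ ψ ∈ H, ψ ≠ 0)
    (hgen : ∀ y, (∀ ψ ∈ H, ψ y ≠ 0) → eval (signedCone b u N y) c = 0) :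
    ∃ a ∈ on (fun l => l.length = k + 1 ∧ ∀ x ∈ l, x ∈ D),
      c - bd a ∈ on (fun l => relDet b u N l = 0) := by
  set φ₀ := φ - φ N • ν with hφ₀
  have hφ₀N : φ₀ N = 0 := by simp [hφ₀, hνN]
  have hφ₀D : ∀ x ∈ D, φ₀ (u x) = φ (u x) := fun x hx => by simp [hφ₀, (hD x hx).1]
  refine exists_bd_of_vol_eq_zero k (functionals u N) (relDet b u N) (isVolume_relDet b u N) D
    (fun x hx => ⟨φ₀ ∘ u, ⟨φ₀, hφ₀N, rfl⟩, ?_⟩) c hc ?_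
  · rw [Function.comp_apply, hφ₀D x hx]; exact (hD x hx).2.ne'
  · rintro _ ⟨φ₁, hφ₁N, rfl⟩ hne
    have hη : φ₁ ∘ u = φ₀ ∘ u + (1 : ℝ) • ((φ₁ - φ₀) ∘ u) := by
      funext x; simp
    rw [hη]
    refine vol_eq_zero_of_eventually hc (fun x hx => ?_) (by rwa [← hη]) ?_
    · rw [Function.comp_apply, hφ₀D x hx]; exact (hD x hx).2.ne'
    · have hev : ∀ᶠ t in nhds (0 : ℝ), ∀ x ∈ D, 0 < (φ₀ + t • (φ₁ - φ₀)) (u x) := by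
        rw [Filter.eventually_all_finset]
        intro x hx
        have : Filter.Tendsto (fun t : ℝ => (φ₀ + t • (φ₁ - φ₀)) (u x)) (nhds 0)
            (nhds (φ₀ (u x))) := by
          have : Continuous fun t : ℝ => (φ₀ + t • (φ₁ - φ₀)) (u x) := by
            simp only [LinearMap.add_apply, LinearMap.smul_apply, smul_eq_mul]
            fun_prop
          simpa using this.tendsto 0
        exact this.eventually (lt_mem_nhds (by rw [hφ₀D x hx]; exact (hD x hx).2))
      filter_upwards [hev] with t ht
      have h1 := vol_eq_zero_of_signedCone b u N ν (φ₀ + t • (φ₁ - φ₀)) hνN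
        (by simp [hφ₀N, hφ₁N])
        (on_mono (fun l hl => ⟨hl.1, fun x hx => ⟨(hD x (hl.2 x hx)).1, ht x (hl.2 x hx)⟩⟩) hc)
        H hH hgen
      exact h1

end VolumeForm
end

noncomputable section
/-! ### Quadratic forms as linear functionals on symmetric matrices -/

namespace Voronoi

variable {n : ℕ}

/-- The symmetric matrix `x ᵗy + y ᵗx`. -/
def symB (x y : Fin n → ℝ) : SymMat n :=
  ⟨Matrix.vecMulVec x y + Matrix.vecMulVec y x, by
    change Matrix.transpose _ = _
    ext i j
    simp [Matrix.vecMulVec_apply]; ring⟩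

/-- The symmetric matrix `x ᵗx`, for a real vector `x`. -/
def symR (x : Fin n → ℝ) : SymMat n :=
  ⟨Matrix.vecMulVec x x, by
    change Matrix.transpose _ = _
    ext i j
    simp [Matrix.vecMulVec_apply, mul_comm]⟩

/-- The symmetric matrix `x' = x ᵗx`, for an integral vector `x`. -/
def sym (x : Fin n → ℤ) : SymMat n := rankOne fun i => (x i : ℚ)

/-- An integral vector, seen as a real vector. -/
abbrev toR (x : Fin n → ℤ) : Fin n → ℝ := fun i => (x i : ℝ)

theorem symR_apply (x : Fin n → ℝ) (i j : Fin n) : (symR x).1 i j = x i * x j := rfl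

theorem symB_apply (x y : Fin n → ℝ) (i j : Fin n) :
    (symB x y).1 i j = x i * y j + y i * x j := rfl

theorem rankOne_eq_symR (u : Fin n → ℚ) : rankOne u = symR fun i => (u i : ℝ) := rfl

theorem sym_eq (x : Fin n → ℤ) : sym x = symR (toR x) := by
  apply Subtype.ext
  ext i j
  simp [sym, rankOne, symR, Matrix.vecMulVec_apply]

@[ext]
theorem symMat_ext {A B : SymMat n} (h : ∀ i j, A.1 i j = B.1 i j) : A = B :=
  Subtype.ext (Matrix.ext h)

theorem symR_smul (a : ℝ) (x : Fin n → ℝ) : symR (a • x) = (a ^ 2) • symR x := by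
  ext i j
  simp [symR_apply]; ring

theorem symR_zero : symR (0 : Fin n → ℝ) = 0 := by
  ext i j
  simp [symR_apply]

/-- The linear functionals on `Y`, which are the quadratic forms: `φ` has the value
`φ (x ᵗx)` at the vector `x`. -/
abbrev Form (n : ℕ) : Type := SymMat n →ₗ[ℝ] ℝ

/-- The symmetric bilinear form with quadratic form `x ↦ φ (x ᵗx)`. -/
def bil (φ : Form n) : (Fin n → ℝ) →ₗ[ℝ] (Fin n → ℝ) →ₗ[ℝ] ℝ :=
  LinearMap.mk₂ ℝ (fun x y => φ (symB x y) / 2)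
    (fun x y z => by
      rw [← add_div, ← map_add]; congr 2; ext i j; simp [symB_apply]; ring)
    (fun c x y => by
      rw [smul_eq_mul, ← mul_div_assoc, ← smul_eq_mul, ← map_smul]; congr 2; ext i j
      simp [symB_apply]; ring)
    (fun x y z => by
      rw [← add_div, ← map_add]; congr 2; ext i j; simp [symB_apply]; ring)
    (fun c x y => by
      rw [smul_eq_mul, ← mul_div_assoc, ← smul_eq_mul, ← map_smul]; congr 2; ext i j
      simp [symB_apply]; ring)

theorem bil_self (φ : Form n) (x : Fin n → ℝ) : bil φ x x = φ (symR x) := by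
  have : symB x x = (2 : ℝ) • symR x := by ext i j; simp [symB_apply, symR_apply]; ring
  simp [bil, this]

theorem bil_comm (φ : Form n) (x y : Fin n → ℝ) : bil φ x y = bil φ y x := by
  have : symB x y = symB y x := by ext i j; simp [symB_apply]; ring
  simp [bil, this]

/-- A symmetric matrix in terms of the products of the standard basis vectors. -/
theorem eq_sum_symB (A : SymMat n) :
    A = ∑ i, ∑ j, (A.1 i j / 2) • symB (Pi.single i 1) (Pi.single j 1) := by
  have hA : ∀ i j, A.1 i j = A.1 j i := fun i j => congrFun (congrFun A.2 j) i
  ext a c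
  have : ∀ (f : Fin n → Fin n → SymMat n), (∑ i, ∑ j, f i j).1 a c = ∑ i, ∑ j, (f i j).1 a c := by
    intro f
    rw [AddSubmonoidClass.coe_finsetSum, Matrix.sum_apply]
    refine Finset.sum_congr rfl fun i _ => ?_
    rw [AddSubmonoidClass.coe_finsetSum, Matrix.sum_apply]
  rw [this]
  have h2 : ∀ i j, ((A.1 i j / 2) • symB (Pi.single i (1 : ℝ)) (Pi.single j 1)).1 a c =
      (if a = i then (if c = j then A.1 i j / 2 else 0) else 0) +
      (if a = j then (if c = i then A.1 i j / 2 else 0) else 0) := by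
    intro i j
    change (A.1 i j / 2) * (symB (Pi.single i (1 : ℝ)) (Pi.single j 1)).1 a c = _
    rw [symB_apply]
    simp only [Pi.single_apply]
    split_ifs <;> simp
    ring
  simp only [h2, Finset.sum_add_distrib]
  rw [Finset.sum_comm (f := fun i j => if a = j then (if c = i then A.1 i j / 2 else 0) else 0)]
  simp [hA c a]

theorem apply_eq_sum_bil (φ : Form n) (A : SymMat n) :
    φ A = ∑ i, ∑ j, A.1 i j * bil φ (Pi.single i 1) (Pi.single j 1) := by
  conv_lhs => rw [eq_sum_symB A]
  simp only [map_sum, map_smul, smul_eq_mul]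
  refine Finset.sum_congr rfl fun i _ => Finset.sum_congr rfl fun j _ => ?_
  simp [bil]; ring

/-- `φ` is positive semidefinite. -/
def PSD (φ : Form n) : Prop := ∀ y : Fin n → ℝ, 0 ≤ φ (symR y)

/-- The trace of a form. -/
def tr (φ : Form n) : ℝ := ∑ i, φ (symR (Pi.single i 1))

theorem PSD.le_tr {φ : Form n} (h : PSD φ) (i : Fin n) : φ (symR (Pi.single i 1)) ≤ tr φ :=
  Finset.single_le_sum (f := fun i => φ (symR (Pi.single i 1))) (fun _ _ => h _)
    (Finset.mem_univ i)

theorem PSD.tr_nonneg {φ : Form n} (h : PSD φ) : 0 ≤ tr φ := Finset.sum_nonneg fun _ _ => h _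

theorem PSD.abs_bil_le {φ : Form n} (h : PSD φ) (x y : Fin n → ℝ) :
    |bil φ x y| ≤ φ (symR x) + φ (symR y) := by
  have h1 := h (x + y)
  have h2 := h (x - y)
  have h3 := h x
  have h4 := h y
  rw [← bil_self] at *
  simp only [map_add, map_sub, LinearMap.add_apply, LinearMap.sub_apply, bil_comm φ y x] at *
  rw [← bil_self φ y] at *
  rw [abs_le]
  constructor <;> linarith

/-- The Jensen inequality for a positive semidefinite form. -/
theorem PSD.sum_le {φ : Form n} (h : PSD φ) {ι : Type*} [Fintype ι] (t : ι → ℝ)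
    (y : ι → Fin n → ℝ) :
    φ (symR (∑ i, t i • y i)) ≤ Fintype.card ι * ∑ i, t i ^ 2 * φ (symR (y i)) := by
  have h0 : 0 ≤ ∑ i, ∑ j, φ (symR (t i • y i - t j • y j)) :=
    Finset.sum_nonneg fun i _ => Finset.sum_nonneg fun j _ => h _
  have h1 : ∀ i j, φ (symR (t i • y i - t j • y j)) =
      t i ^ 2 * φ (symR (y i)) + t j ^ 2 * φ (symR (y j)) -
        2 * bil φ (t i • y i) (t j • y j) := by
    intro i j
    rw [← bil_self, ← bil_self, ← bil_self]
    simp only [map_sub, LinearMap.sub_apply, map_smul, LinearMap.smul_apply, smul_eq_mul]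
    rw [bil_comm φ (y j) (y i)]
    ring
  have h2 : φ (symR (∑ i, t i • y i)) = ∑ i, ∑ j, bil φ (t i • y i) (t j • y j) := by
    rw [← bil_self]
    simp only [map_sum, LinearMap.sum_apply]
    rw [Finset.sum_comm]
  simp only [h1, Finset.sum_sub_distrib, Finset.sum_add_distrib, ← Finset.mul_sum,
    Finset.sum_const, Finset.card_univ, nsmul_eq_mul] at h0
  rw [← h2] at h0
  have h3 : ∑ x, t x ^ 2 * ((Fintype.card ι : ℝ) * φ (symR (y x))) =
      Fintype.card ι * ∑ x, t x ^ 2 * φ (symR (y x)) := by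
    rw [Finset.mul_sum]
    exact Finset.sum_congr rfl fun _ _ => by ring
  linarith

theorem PSD.abs_apply_le {φ : Form n} (h : PSD φ) (A : SymMat n) :
    |φ A| ≤ (2 * ∑ i, ∑ j, |A.1 i j|) * tr φ := by
  rw [apply_eq_sum_bil, Finset.mul_sum, Finset.sum_mul]
  refine (Finset.abs_sum_le_sum_abs _ _).trans (Finset.sum_le_sum fun i _ => ?_)
  rw [Finset.mul_sum, Finset.sum_mul]
  refine (Finset.abs_sum_le_sum_abs _ _).trans (Finset.sum_le_sum fun j _ => ?_)
  rw [abs_mul]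
  have := h.abs_bil_le (Pi.single i 1) (Pi.single j 1)
  have h1 := h.le_tr i
  have h2 := h.le_tr j
  nlinarith [abs_nonneg (A.1 i j)]

/-- If the vectors of a tuple span, then the sum of the values of a form at these vectors controls
the form. -/
theorem exists_tr_le {ι : Type*} [Fintype ι] (v : ι → Fin n → ℝ)
    (hv : Submodule.span ℝ (Set.range v) = ⊤) :
    ∃ c : ℝ, 0 < c ∧ ∀ φ : Form n, PSD φ → c * tr φ ≤ ∑ i, φ (symR (v i)) := by
  have h1 : ∀ j : Fin n, ∃ t : ι → ℝ, ∑ i, t i • v i = Pi.single j 1 := fun j =>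
    (Submodule.mem_span_range_iff_exists_fun ℝ).1 (by rw [hv]; trivial)
  choose t ht using h1
  set C : ℝ := ∑ j, Fintype.card ι * ∑ i, t j i ^ 2 with hC
  have hC0 : 0 ≤ C := by positivity
  refine ⟨(C + 1)⁻¹, by positivity, fun φ hφ => ?_⟩
  rw [inv_mul_le_iff₀ (by positivity)]
  have hle : ∀ i, φ (symR (v i)) ≤ ∑ i, φ (symR (v i)) := fun i =>
    Finset.single_le_sum (f := fun i => φ (symR (v i))) (fun i _ => hφ _) (Finset.mem_univ i)
  have hS : 0 ≤ ∑ i, φ (symR (v i)) := Finset.sum_nonneg fun _ _ => hφ _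
  calc tr φ ≤ C * ∑ i, φ (symR (v i)) := by
        rw [hC, tr, Finset.sum_mul]
        refine Finset.sum_le_sum fun j _ => ?_
        rw [← ht j]
        refine (hφ.sum_le (t j) v).trans ?_
        rw [mul_assoc, Finset.sum_mul]
        gcongr with i
        exact hle i
    _ ≤ (C + 1) * ∑ i, φ (symR (v i)) := by nlinarith

/-- The square of the linear functional with coefficients `f`, as a functional on `Y`. -/
def sqForm (f : Fin n → ℝ) : Form n where
  toFun A := ∑ i, ∑ j, f i * f j * A.1 i j
  map_add' A B := by
    simp only [← Finset.sum_add_distrib]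
    refine Finset.sum_congr rfl fun i _ => Finset.sum_congr rfl fun j _ => ?_
    change _ * (A.1 i j + B.1 i j) = _
    ring
  map_smul' c A := by
    simp only [smul_eq_mul, RingHom.id_apply, Finset.mul_sum]
    refine Finset.sum_congr rfl fun i _ => Finset.sum_congr rfl fun j _ => ?_
    change _ * (c * A.1 i j) = _
    ring

theorem sqForm_symR (f x : Fin n → ℝ) : sqForm f (symR x) = (∑ i, f i * x i) ^ 2 := by
  change ∑ i, ∑ j, f i * f j * (x i * x j) = _
  rw [sq, Finset.sum_mul_sum]
  refine Finset.sum_congr rfl fun i _ => Finset.sum_congr rfl fun j _ => ?_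
  ring

theorem span_eq_top_of_sym {ι : Type*} (v : ι → Fin n → ℝ)
    (h : Submodule.span ℝ (Set.range fun i => symR (v i)) = ⊤) :
    Submodule.span ℝ (Set.range v) = ⊤ := by
  by_contra hne
  obtain ⟨f, hf0, hf⟩ := Submodule.exists_le_ker_of_lt_top _ (lt_top_iff_ne_top.2 hne)
  have hsum : ∀ x : Fin n → ℝ, f x = ∑ i, f (Pi.single i 1) * x i := by
    intro x
    conv_lhs => rw [pi_eq_sum_univ' x]
    simp [map_sum, mul_comm]
  have h1 : sqForm (fun i => f (Pi.single i 1)) = 0 := by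
    refine LinearMap.ext_on_range h fun i => ?_
    rw [sqForm_symR, ← hsum]
    have : f (v i) = 0 := hf (Submodule.subset_span ⟨i, rfl⟩)
    simp [this]
  refine hf0 (LinearMap.ext fun x => ?_)
  have h2 : sqForm (fun i => f (Pi.single i 1)) (symR x) = 0 := by rw [h1]; rfl
  rw [sqForm_symR, ← hsum] at h2
  simpa using h2

end Voronoi
end

noncomputable section
/-! ### Perfect forms -/

namespace Voronoi

open MeasureTheory

variable {n : ℕ}

/-- The Ryshkov polyhedron: the positive semidefinite forms which are at least one at all nonzero
integral vectors. -/
structure Ryshkov (φ : Form n) : Prop where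
  psd : PSD φ
  one_le : ∀ x : Fin n → ℤ, x ≠ 0 → 1 ≤ φ (sym x)

/-- The integral vectors at which a form in the Ryshkov polyhedron takes the value one. -/
def minSet (φ : Form n) : Set (Fin n → ℤ) := {x | φ (sym x) = 1}

/-- A form in the Ryshkov polyhedron is perfect if its minimal vectors determine it. -/
structure Perfect (φ : Form n) : Prop extends Ryshkov φ where
  span : Submodule.span ℝ (sym '' minSet φ) = ⊤

theorem sym_zero : sym (0 : Fin n → ℤ) = 0 := by
  ext i j
  simp [sym_eq, symR_apply]

theorem ne_zero_of_mem_minSet {φ : Form n} {x : Fin n → ℤ} (h : x ∈ minSet φ) : x ≠ 0 := by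
  rintro rfl
  simp [minSet, sym_zero] at h

instance (b : Module.Basis (Fin n) ℝ (Fin n → ℝ)) :
    Countable (Submodule.span ℤ (Set.range b)).toAddSubgroup :=
  inferInstanceAs (Countable (Submodule.span ℤ (Set.range b)))

/-- Minkowski's bound: vectors at which a form of the Ryshkov polyhedron is small have a small
determinant. -/
theorem Ryshkov.abs_det_le {φ : Form n} (h : Ryshkov φ) (hn : 0 < n) {r : ℝ} (hr : 0 < r)
    (M : Matrix (Fin n) (Fin n) ℝ) (hM : ∀ i, φ (symR (M.col i)) ≤ r ^ 2) :
    |M.det| ≤ (n * r) ^ n := by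
  by_contra! hlt
  have hn' : (0 : ℝ) < n := by exact_mod_cast hn
  have hnr : 0 < (n : ℝ) * r := by positivity
  set s : Set (Fin n → ℝ) := Matrix.toLin' M '' Metric.ball 0 (1 / (n * r)) with hs
  have hvol : volume s = ENNReal.ofReal (|M.det| * (2 * (1 / (n * r))) ^ n) := by
    rw [hs, Measure.addHaar_image_linearMap, Real.volume_pi_ball _ (by positivity),
      LinearMap.det_toLin', ← ENNReal.ofReal_mul (abs_nonneg _), Fintype.card_fin]
  obtain ⟨x, hx0, t, ht, htx⟩ := exists_ne_zero_mem_lattice_of_measure_mul_two_pow_lt_measure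
    (ZSpan.isAddFundamentalDomain' (Pi.basisFun ℝ (Fin n)) volume) (s := s)
    (by
      rintro _ ⟨t, ht, rfl⟩
      exact ⟨-t, by simpa using ht, by rw [map_neg]⟩)
    ((convex_ball _ _).linear_image _)
    (by
      rw [ZSpan.volume_fundamentalDomain, hvol]
      have : (Matrix.of ⇑(Pi.basisFun ℝ (Fin n))).det = 1 := by
        rw [← Matrix.det_one (n := Fin n) (R := ℝ)]
        congr 1
        ext i j
        simp [Matrix.one_apply, Pi.single_apply, eq_comm]
      rw [this]
      have h2 : (2 : ENNReal) ^ Module.finrank ℝ (Fin n → ℝ) = ENNReal.ofReal (2 ^ n) := by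
        simp [ENNReal.ofReal_pow]
      rw [h2]
      simp only [abs_one, ENNReal.ofReal_one, one_mul]
      have hdet : 0 < |M.det| := lt_of_le_of_lt (by positivity) hlt
      refine (ENNReal.ofReal_lt_ofReal_iff (by positivity)).2 ?_
      have : (2 * (1 / (n * r))) ^ n = 2 ^ n / (n * r) ^ n := by
        rw [mul_one_div, div_pow]
      rw [this, ← mul_div_assoc, lt_div_iff₀ (by positivity), mul_comm]
      gcongr)
  have hxZ : ∃ z : Fin n → ℤ, toR z = x := by
    have h1 := ((Pi.basisFun ℝ (Fin n)).mem_span_iff_repr_mem ℤ (x : Fin n → ℝ)).1 x.2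
    choose z hz using h1
    exact ⟨z, funext fun i => by simpa using hz i⟩
  obtain ⟨z, hz⟩ := hxZ
  have hz0 : z ≠ 0 := by
    rintro rfl
    exact hx0 (Subtype.ext (by rw [← hz]; ext; simp))
  have h1 := h.one_le z hz0
  rw [sym_eq, hz, ← htx] at h1
  have hti : ∀ i, t i ^ 2 < (1 / (n * r)) ^ 2 := by
    intro i
    rw [mem_ball_zero_iff, pi_norm_lt_iff (by positivity)] at ht
    have := ht i
    rw [Real.norm_eq_abs] at this
    exact sq_lt_sq.2 (by rwa [abs_of_pos (a := 1 / (n * r)) (by positivity)])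
  have h2 : Matrix.toLin' M t = ∑ i, t i • M.col i := by
    rw [Matrix.toLin'_apply, Matrix.mulVec_eq_sum]
    simp [Matrix.col]
  rw [h2] at h1
  have h3 := h.psd.sum_le t fun i => M.col i
  have h4 : ∑ i, t i ^ 2 * φ (symR (M.col i)) < ∑ i : Fin n, (1 / (n * r)) ^ 2 * r ^ 2 := by
    have : Nonempty (Fin n) := ⟨⟨0, hn⟩⟩
    refine Finset.sum_lt_sum_of_nonempty Finset.univ_nonempty fun i _ => ?_
    calc t i ^ 2 * φ (symR (M.col i)) ≤ t i ^ 2 * r ^ 2 := by gcongr; exact hM i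
      _ < _ := mul_lt_mul_of_pos_right (hti i) (by positivity)
  have h5 : ∑ i : Fin n, (1 / (n * r)) ^ 2 * r ^ 2 = (1 : ℝ) / n := by
    rw [Finset.sum_const, Finset.card_univ, Fintype.card_fin, nsmul_eq_mul]
    field_simp
  rw [h5] at h4
  rw [Fintype.card_fin] at h3
  have h6 : (n : ℝ) * ∑ i, t i ^ 2 * φ (symR (M.col i)) < 1 := by
    calc (n : ℝ) * ∑ i, t i ^ 2 * φ (symR (M.col i)) < n * (1 / n) := by gcongr
      _ = 1 := by field_simp
  linarith

theorem Ryshkov.abs_le {φ : Form n} (h : Ryshkov φ) {r : ℝ} (hr : 0 < r) (htr : tr φ ≤ r ^ 2)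
    {y : Fin n → ℝ} (hy : φ (symR y) ≤ r ^ 2) (i : Fin n) : |y i| ≤ (n * r) ^ n := by
  have := h.abs_det_le (Nat.pos_of_ne_zero fun h => by subst h; exact i.elim0) hr
    ((1 : Matrix (Fin n) (Fin n) ℝ).updateCol i y) fun j => by
      by_cases hj : j = i
      · subst hj
        convert hy
        ext k
        simp
      · refine (le_of_eq ?_).trans ((h.psd.le_tr j).trans htr)
        congr 2
        ext k
        simp [hj, Matrix.one_apply, Pi.single_apply]
  rwa [← Matrix.cramer_apply, Matrix.cramer_one, Module.End.one_apply] at this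

/-- The forms in the Ryshkov polyhedron of bounded trace are uniformly positive definite. -/
theorem exists_forall_le (n : ℕ) (C : ℝ) :
    ∃ c : ℝ, 0 < c ∧ ∀ φ : Form n, Ryshkov φ → tr φ ≤ C →
      ∀ y : Fin n → ℝ, c * ∑ i, y i ^ 2 ≤ φ (symR y) := by
  set r : ℝ := max C 1 with hr
  have hr1 : 1 ≤ r := le_max_right _ _
  set B : ℝ := (n * r) ^ n with hB
  have hB0 : 0 ≤ B := by positivity
  refine ⟨(n * B ^ 2 + 1)⁻¹, by positivity, fun φ h htr y => ?_⟩
  have htr2 : tr φ ≤ r ^ 2 := (htr.trans (le_max_left _ _)).trans (by nlinarith)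
  rw [inv_mul_le_iff₀ (by positivity)]
  have key : ∀ a : ℝ, φ (symR (a • y)) ≤ 1 → ∀ i, a ^ 2 * y i ^ 2 ≤ B ^ 2 := by
    intro a ha i
    have := h.abs_le (by positivity) htr2 (ha.trans (by nlinarith)) i
    rw [← mul_pow]
    exact sq_le_sq.2 (by rwa [abs_of_nonneg hB0])
  have hq := h.psd y
  rcases hq.eq_or_lt with h0 | hpos
  · have hy : ∀ i, y i = 0 := by
      intro i
      by_contra hi
      have := key ((B + 1) / y i) (by rw [symR_smul, map_smul, ← h0]; simp) i
      rw [← mul_pow, div_mul_cancel₀ _ hi] at this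
      nlinarith
    simp [hy, ← h0]
  · have h1 : ∀ i, y i ^ 2 ≤ B ^ 2 * φ (symR y) := by
      intro i
      have := key (Real.sqrt (φ (symR y)))⁻¹ (by
        rw [symR_smul, map_smul, inv_pow, Real.sq_sqrt hq, smul_eq_mul, inv_mul_cancel₀ hpos.ne']) i
      rw [inv_pow, Real.sq_sqrt hq, inv_mul_le_iff₀ hpos] at this
      linarith
    calc ∑ i, y i ^ 2 ≤ ∑ i : Fin n, B ^ 2 * φ (symR y) := Finset.sum_le_sum fun i _ => h1 i
      _ = n * B ^ 2 * φ (symR y) := by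
        rw [Finset.sum_const, Finset.card_univ, Fintype.card_fin, nsmul_eq_mul]; ring
      _ ≤ _ := by nlinarith

/-- The integral vectors with bounded sum of squares are finite in number. -/
theorem finite_sum_sq_le (n : ℕ) (C : ℝ) : {x : Fin n → ℤ | ∑ i, (x i : ℝ) ^ 2 ≤ C}.Finite := by
  obtain ⟨N, hN⟩ := exists_nat_gt C
  refine (Set.Finite.pi' (t := fun _ : Fin n => Set.Icc (-(N : ℤ)) N)
    fun _ => Set.finite_Icc _ _).subset fun x hx i => ?_
  have h1 : (x i : ℝ) ^ 2 ≤ C :=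
    (Finset.single_le_sum (f := fun i => (x i : ℝ) ^ 2) (fun i _ => sq_nonneg _)
      (Finset.mem_univ i)).trans hx
  have h2 : x i ^ 2 < (N : ℤ) := by exact_mod_cast h1.trans_lt hN
  constructor <;> nlinarith [sq_nonneg (x i - 1), sq_nonneg (x i + 1)]

theorem finite_setOf_minSet (n : ℕ) (C : ℝ) :
    ∃ B : Set (Fin n → ℤ), B.Finite ∧ ∀ φ : Form n, Ryshkov φ → tr φ ≤ C →
      ∀ x, φ (sym x) ≤ C → x ∈ B := by
  obtain ⟨c, hc, h⟩ := exists_forall_le n C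
  refine ⟨_, finite_sum_sq_le n (c⁻¹ * C), fun φ hφ htr x hx => ?_⟩
  have := h φ hφ htr (toR x)
  rw [← sym_eq] at this
  change ∑ i, (x i : ℝ) ^ 2 ≤ _
  rw [le_inv_mul_iff₀ hc]
  exact this.trans hx

theorem Ryshkov.finite_le {φ : Form n} (h : Ryshkov φ) (C : ℝ) :
    {x | φ (sym x) ≤ C}.Finite := by
  obtain ⟨B, hB, h1⟩ := finite_setOf_minSet n (max (tr φ) C)
  exact hB.subset fun x hx => h1 φ h (le_max_left _ _) x (le_trans hx (le_max_right _ _))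

theorem Ryshkov.finite_minSet {φ : Form n} (h : Ryshkov φ) : (minSet φ).Finite :=
  (h.finite_le 1).subset fun _ hx => le_of_eq hx

theorem abs_apply_symR_le (ψ : Form n) :
    ∃ K : ℝ, 0 ≤ K ∧ ∀ y : Fin n → ℝ, |ψ (symR y)| ≤ K * ∑ i, y i ^ 2 := by
  refine ⟨∑ i, ∑ j, |bil ψ (Pi.single i 1) (Pi.single j 1)|, by positivity, fun y => ?_⟩
  rw [apply_eq_sum_bil, Finset.sum_mul]
  refine (Finset.abs_sum_le_sum_abs _ _).trans (Finset.sum_le_sum fun i _ => ?_)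
  rw [Finset.sum_mul]
  refine (Finset.abs_sum_le_sum_abs _ _).trans (Finset.sum_le_sum fun j _ => ?_)
  rw [abs_mul, mul_comm, symR_apply, abs_mul]
  gcongr
  have h1 : ∀ i, y i ^ 2 ≤ ∑ i, y i ^ 2 := fun i =>
    Finset.single_le_sum (f := fun i => y i ^ 2) (fun i _ => sq_nonneg _) (Finset.mem_univ i)
  have h2 := h1 i
  have h3 := h1 j
  rw [← sq_abs] at h2 h3
  nlinarith [sq_nonneg (|y i| - |y j|)]

/-- A form of the Ryshkov polyhedron may be moved in each direction which does not make it smaller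
at its minimal vectors. -/
theorem Ryshkov.exists_add_smul {φ : Form n} (h : Ryshkov φ) (ψ : Form n)
    (hψ : ∀ x ∈ minSet φ, 0 ≤ ψ (sym x)) : ∃ ε : ℝ, 0 < ε ∧
    ∀ t : ℝ, 0 ≤ t → t ≤ ε → Ryshkov (φ + t • ψ) := by
  obtain ⟨c, hc, hφ⟩ := exists_forall_le n (tr φ)
  replace hφ := hφ φ h le_rfl
  obtain ⟨K, hK, hψK⟩ := abs_apply_symR_le ψ
  have hfin := h.finite_le 2
  -- at the finitely many vectors where `φ` is below two, a small multiple of `ψ` is harmless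
  have h1 : ∀ x : Fin n → ℤ, x ≠ 0 → ∃ ε > 0, ∀ t : ℝ, 0 ≤ t → t ≤ ε →
      1 ≤ φ (sym x) + t * ψ (sym x) := by
    intro x hx
    rcases (h.one_le x hx).eq_or_lt with h2 | h2
    · exact ⟨1, one_pos, fun t ht _ => by
        have := hψ x h2.symm
        nlinarith [mul_nonneg ht this]⟩
    · refine ⟨(φ (sym x) - 1) / (|ψ (sym x)| + 1), div_pos (by linarith) (by positivity),
        fun t ht ht2 => ?_⟩
      rw [le_div_iff₀ (by positivity)] at ht2
      have := neg_abs_le (ψ (sym x))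
      nlinarith
  choose! ε hε hε2 using h1
  obtain ⟨ε₀, hε₀, hε₀2⟩ : ∃ ε₀ > 0, ∀ x ∈ hfin.toFinset, x ≠ 0 → ε₀ ≤ ε x := by
    by_cases hne : (hfin.toFinset.filter fun x => x ≠ 0).Nonempty
    · obtain ⟨x, hx, hmin⟩ := Finset.exists_min_image _ ε hne
      exact ⟨ε x, hε x (Finset.mem_filter.1 hx).2,
        fun y hy hy0 => hmin y (Finset.mem_filter.2 ⟨hy, hy0⟩)⟩
    · refine ⟨1, one_pos, fun x hx hx0 => absurd ⟨x, Finset.mem_filter.2 ⟨hx, hx0⟩⟩ hne⟩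
  refine ⟨min ε₀ (c / (2 * (K + 1))), lt_min hε₀ (by positivity), fun t ht htε => ?_⟩
  have ht1 : t ≤ ε₀ := htε.trans (min_le_left _ _)
  have ht2 : t * (2 * (K + 1)) ≤ c := (le_div_iff₀ (by positivity)).1 (htε.trans (min_le_right _ _))
  have hhalf : ∀ y, φ (symR y) / 2 ≤ (φ + t • ψ) (symR y) := by
    intro y
    have e1 := hφ y
    have e2 := hψK y
    have e3 := neg_abs_le (ψ (symR y))
    have e4 : 0 ≤ ∑ i, y i ^ 2 := Finset.sum_nonneg fun i _ => sq_nonneg _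
    have e5 : t * |ψ (symR y)| ≤ t * (K * ∑ i, y i ^ 2) := by gcongr
    have e6 : (t * (2 * (K + 1))) * ∑ i, y i ^ 2 ≤ c * ∑ i, y i ^ 2 := by gcongr
    have e7 : t * (-|ψ (symR y)|) ≤ t * ψ (symR y) := by gcongr
    have e8 : 0 ≤ t * ∑ i, y i ^ 2 := by positivity
    simp only [LinearMap.add_apply, LinearMap.smul_apply, smul_eq_mul]
    nlinarith
  refine ⟨fun y => (by have := h.psd y; linarith [hhalf y]), fun x hx => ?_⟩
  by_cases hx2 : φ (sym x) ≤ 2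
  · exact hε2 x hx t ht (ht1.trans (hε₀2 x (hfin.mem_toFinset.2 hx2) hx))
  · have := hhalf (toR x)
    rw [← sym_eq] at this
    linarith

end Voronoi
end

noncomputable section
/-! ### The tiles cover the positive definite matrices -/

namespace Voronoi

variable {n : ℕ}

instance : LocallyConvexSpace ℝ (Matrix (Fin n) (Fin n) ℝ) :=
  inferInstanceAs (LocallyConvexSpace ℝ (Fin n → Fin n → ℝ))

/-- The tile of a form: the cone generated by its minimal vectors. -/
def tile (φ : Form n) : PointedCone ℝ (SymMat n) := PointedCone.hull ℝ (sym '' minSet φ)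

theorem sym_mem_tile {φ : Form n} {x : Fin n → ℤ} (h : x ∈ minSet φ) : sym x ∈ tile φ :=
  PointedCone.subset_hull ⟨x, h, rfl⟩

/-- A perfect form is determined by its minimal vectors. -/
theorem Perfect.eq {φ ψ : Form n} (h : Perfect φ) (h2 : minSet φ ⊆ minSet ψ) : φ = ψ := by
  refine LinearMap.ext_on h.span ?_
  rintro _ ⟨x, hx, rfl⟩
  rw [show φ (sym x) = 1 from hx, show ψ (sym x) = 1 from h2 hx]

theorem finite_perfect (n : ℕ) (C : ℝ) : {φ : Form n | Perfect φ ∧ tr φ ≤ C}.Finite := by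
  obtain ⟨B, hB, h⟩ := finite_setOf_minSet n (max C 1)
  refine Set.Finite.of_injOn (f := minSet) (t := {A | A ⊆ B}) ?_ ?_ hB.finite_subsets
  · intro φ hφ x hx
    exact h φ hφ.1.toRyshkov (hφ.2.trans (le_max_left _ _)) x
      ((le_of_eq hx).trans (le_max_right _ _))
  · intro φ hφ ψ _ h2
    exact hφ.1.eq h2.subset

/-- The form `∑ xᵢ²`. -/
def sumSq (n : ℕ) : Form n := ∑ i, sqForm (Pi.single i 1)

theorem sumSq_symR (y : Fin n → ℝ) : sumSq n (symR y) = ∑ i, y i ^ 2 := by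
  rw [sumSq, LinearMap.sum_apply]
  refine Finset.sum_congr rfl fun i _ => ?_
  rw [sqForm_symR]
  simp [Pi.single_apply]

theorem ryshkov_sumSq (n : ℕ) : Ryshkov (sumSq n) := by
  refine ⟨fun y => ?_, fun x hx => ?_⟩
  · rw [sumSq_symR]; positivity
  · rw [sym_eq, sumSq_symR]
    obtain ⟨i, hi⟩ := Function.ne_iff.1 hx
    have h1 : (1 : ℝ) ≤ (x i : ℝ) ^ 2 := by
      have : 1 ≤ x i ^ 2 := Int.one_le_abs (by simpa using hi) |>.trans (by
        rw [← sq_abs]; nlinarith [Int.one_le_abs (show x i ≠ 0 by simpa using hi)])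
      exact_mod_cast this
    exact h1.trans (Finset.single_le_sum (f := fun i => (x i : ℝ) ^ 2)
      (fun i _ => sq_nonneg _) (Finset.mem_univ i))

theorem Ryshkov.one_le_tr {φ : Form n} (h : Ryshkov φ) (hn : 0 < n) : 1 ≤ tr φ := by
  refine le_trans ?_ (h.psd.le_tr ⟨0, hn⟩)
  have := h.one_le (Pi.single ⟨0, hn⟩ 1) (by simp)
  rw [sym_eq] at this
  have h2 : toR (Pi.single (⟨0, hn⟩ : Fin n) (1 : ℤ)) = Pi.single ⟨0, hn⟩ 1 := by
    funext j
    by_cases hj : j = ⟨0, hn⟩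
    · subst hj; simp
    · simp [Pi.single_eq_of_ne hj]
  rwa [h2] at this

/-- A positive definite matrix `q` lies in a tile: among the forms of the Ryshkov polyhedron at
which `q` is minimal there is a perfect one, and `q` lies in its tile, since otherwise a hyperplane
separating `q` from the tile would show a direction in which `q` decreases. -/
theorem exists_perfect_mem_tile (hn : 0 < n) {q : SymMat n} {c : ℝ} (hc : 0 < c)
    (hq : ∀ φ : Form n, PSD φ → c * tr φ ≤ φ q) :
    ∃ φ : Form n, Perfect φ ∧ q ∈ tile φ ∧ c * tr φ ≤ sumSq n q := by
  let b := Module.finBasis ℝ (SymMat n)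
  let F := b.constr ℝ (M' := ℝ)
  have hcont : ∀ A, Continuous fun z => F z A := fun A =>
    (LinearMap.applyₗ A ∘ₗ F.toLinearMap).continuous_of_finiteDimensional
  set K₀ : Set (_ → ℝ) := {z | Ryshkov (F z) ∧ F z q ≤ sumSq n q} with hK₀
  have hclosed : IsClosed K₀ := by
    have : K₀ = (⋂ y, {z | 0 ≤ F z (symR y)}) ∩
        (⋂ x : {x : Fin n → ℤ // x ≠ 0}, {z | 1 ≤ F z (sym x.1)}) ∩ {z | F z q ≤ sumSq n q} := by
      ext z
      simp only [hK₀, Set.mem_ofPred_eq, Set.mem_inter_iff, Set.mem_iInter]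
      exact and_congr_left fun _ => ⟨fun h => ⟨h.psd, fun x => h.one_le x.1 x.2⟩,
        fun h => ⟨h.1, fun x hx => h.2 ⟨x, hx⟩⟩⟩
    rw [this]
    exact ((isClosed_iInter fun y => isClosed_le continuous_const (hcont _)).inter
      (isClosed_iInter fun x => isClosed_le continuous_const (hcont _))).inter
      (isClosed_le (hcont _) continuous_const)
  have hcomp : IsCompact K₀ := by
    refine (isCompact_univ_pi fun i => isCompact_Icc
      (a := -((2 * ∑ k, ∑ l, |(b i).1 k l|) * (c⁻¹ * sumSq n q)))
      (b := (2 * ∑ k, ∑ l, |(b i).1 k l|) * (c⁻¹ * sumSq n q))).of_isClosed_subset hclosed ?_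
    intro z hz i _
    have h1 := hz.1.psd.abs_apply_le (b i)
    have h2 : tr (F z) ≤ c⁻¹ * sumSq n q := by
      rw [le_inv_mul_iff₀ hc]
      exact (hq _ hz.1.psd).trans hz.2
    have h3 : F z (b i) = z i := b.constr_basis ℝ z i
    rw [h3] at h1
    exact abs_le.1 (h1.trans (by gcongr))
  have hne : K₀.Nonempty := ⟨F.symm (sumSq n), by simp [hK₀, ryshkov_sumSq]⟩
  obtain ⟨z₀, hz₀, hmin₀⟩ := hcomp.exists_isMinOn hne (hcont q).continuousOn
  set M : Set (_ → ℝ) := K₀ ∩ {z | F z q ≤ F z₀ q} with hM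
  have hMcomp : IsCompact M := hcomp.inter_right (isClosed_le (hcont _) continuous_const)
  obtain ⟨z₁, hz₁⟩ := hMcomp.extremePoints_nonempty ⟨z₀, hz₀, le_refl (F z₀ q)⟩
  rw [mem_extremePoints] at hz₁
  obtain ⟨hz₁M, hext⟩ := hz₁
  set φ := F z₁ with hφ
  have hR : Ryshkov φ := hz₁M.1.1
  have hmin : ∀ ψ : Form n, Ryshkov ψ → φ q ≤ ψ q := by
    intro ψ hψ
    by_cases h : ψ q ≤ sumSq n q
    · have h1 : F.symm ψ ∈ K₀ := by simpa [hK₀] using ⟨hψ, h⟩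
      have h2 := hmin₀ h1
      simp only [Set.mem_ofPred_eq, LinearEquiv.apply_symm_apply] at h2
      exact le_trans hz₁M.2 h2
    · exact le_trans hz₁M.1.2 (not_le.1 h).le
  have hP : Perfect φ := by
    refine ⟨hR, ?_⟩
    by_contra hspan
    obtain ⟨ψ, hψ0, hψ⟩ := Submodule.exists_le_ker_of_lt_top _ (lt_top_iff_ne_top.2 hspan)
    have h0 : ∀ x ∈ minSet φ, ψ (sym x) = 0 := fun x hx =>
      hψ (Submodule.subset_span ⟨x, hx, rfl⟩)
    obtain ⟨ε₁, hε₁, h1⟩ := hR.exists_add_smul ψ fun x hx => (h0 x hx).ge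
    obtain ⟨ε₂, hε₂, h2⟩ := hR.exists_add_smul (-ψ) fun x hx => by simp [h0 x hx]
    set δ := min ε₁ ε₂ with hδ
    have hδ0 : 0 < δ := lt_min hε₁ hε₂
    have r1 := h1 δ hδ0.le (min_le_left _ _)
    have r2 := h2 δ hδ0.le (min_le_right _ _)
    have hψq : ψ q = 0 := by
      have e1 := hmin _ r1
      have e2 := hmin _ r2
      simp only [LinearMap.add_apply, LinearMap.smul_apply, LinearMap.neg_apply, smul_eq_mul]
        at e1 e2
      have e3 : 0 ≤ ψ q := by
        by_contra! hlt
        nlinarith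
      have e4 : ψ q ≤ 0 := by
        by_contra! hlt
        nlinarith
      exact le_antisymm e4 e3
    have mem : ∀ χ : Form n, Ryshkov χ → χ q = φ q → F.symm χ ∈ M := by
      intro χ hχ hχq
      refine ⟨⟨by simpa using hχ, ?_⟩, ?_⟩
      · simpa [hχq] using hz₁M.1.2
      · simpa [hχq] using hz₁M.2
    have m1 := mem _ r1 (by simp [hψq])
    have m2 := mem _ r2 (by simp [hψq])
    have := (hext _ m1 _ m2 ⟨1 / 2, 1 / 2, by norm_num, by norm_num, by norm_num, by
      apply F.injective
      rw [← hφ, map_add, map_smul, map_smul, LinearEquiv.apply_symm_apply,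
        LinearEquiv.apply_symm_apply]
      module⟩).1
    rw [LinearEquiv.symm_apply_eq, ← hφ] at this
    have : δ • ψ = 0 := by simpa using this
    rcases smul_eq_zero.1 this with h | h
    · exact hδ0.ne' h
    · exact hψ0 h
  refine ⟨φ, hP, ?_, (hq _ hR.psd).trans hz₁M.1.2⟩
  have hφq : 0 < φ q := lt_of_lt_of_le (mul_pos hc (by linarith [hR.one_le_tr hn])) (hq _ hR.psd)
  by_cases hmem : (φ q)⁻¹ • q ∈ convexHull ℝ (sym '' minSet φ)
  · have h1 : (φ q)⁻¹ • q ∈ tile φ :=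
      convexHull_min PointedCone.subset_hull (tile φ).toConvexCone.convex hmem
    have := (tile φ).smul_mem hφq.le h1
    rwa [smul_inv_smul₀ hφq.ne'] at this
  · exfalso
    obtain ⟨f, u, h1, h2⟩ := geometric_hahn_banach_point_closed (convex_convexHull ℝ _)
      (Set.Finite.isClosed_convexHull ℝ (hR.finite_minSet.image sym)) hmem
    set ψ : Form n := (f : SymMat n →ₗ[ℝ] ℝ) - u • φ with hψ
    obtain ⟨ε, hε, h3⟩ := hR.exists_add_smul ψ fun x hx => by
      have := h2 (sym x) (subset_convexHull ℝ _ ⟨x, hx, rfl⟩)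
      have hx1 : φ (sym x) = 1 := hx
      simp [hψ, hx1, this.le]
    have h4 := hmin _ (h3 ε hε.le le_rfl)
    rw [map_smul, smul_eq_mul, inv_mul_lt_iff₀ hφq] at h1
    simp only [hψ, LinearMap.add_apply, LinearMap.smul_apply, LinearMap.sub_apply, smul_eq_mul,
      ContinuousLinearMap.coe_coe] at h4
    nlinarith

end Voronoi
end

noncomputable section
/-! ### The action of `SL_n(ℤ)` on forms, and finiteness of perfect forms -/

namespace Voronoi

variable {n : ℕ}

local notation "SLZ" n => Matrix.SpecialLinearGroup (Fin n) ℤ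

theorem smul_def (g : SLZ n) (x : Fin n → ℤ) : g • x = g.1.mulVec x := rfl

theorem symAct_symR (g : SLZ n) (y : Fin n → ℝ) :
    symAct g (symR y) = symR ((g.1.map (Int.cast : ℤ → ℝ)).mulVec y) := by
  apply Subtype.ext
  change _ * Matrix.vecMulVec y y * _ = Matrix.vecMulVec _ _
  rw [Matrix.mul_vecMulVec, Matrix.vecMulVec_mul, Matrix.vecMul_transpose]

theorem symAct_sym (g : SLZ n) (x : Fin n → ℤ) : symAct g (sym x) = sym (g • x) := by
  rw [sym_eq, sym_eq, symAct_symR]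
  congr 1
  funext i
  simp [smul_def, toR, Matrix.mulVec, dotProduct]

theorem symAct_mul (g h : SLZ n) : symAct (g * h) = symAct g ∘ₗ symAct h := by
  refine LinearMap.ext fun A => Subtype.ext ?_
  change _ * A.1 * _ = _ * (_ * A.1 * _) * _
  have : ((g * h).1.map (Int.cast : ℤ → ℝ)) = g.1.map (Int.cast : ℤ → ℝ) * h.1.map Int.cast := by
    rw [Matrix.SpecialLinearGroup.coe_mul]
    exact Matrix.map_mul (f := Int.castRingHom ℝ)
  rw [this, Matrix.transpose_mul]
  simp only [Matrix.mul_assoc]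

theorem symAct_one : symAct (1 : SLZ n) = LinearMap.id := by
  refine LinearMap.ext fun A => Subtype.ext ?_
  change _ * A.1 * _ = A.1
  simp

theorem symAct_inv_symAct (g : SLZ n) (A : SymMat n) : symAct g⁻¹ (symAct g A) = A := by
  rw [← LinearMap.comp_apply, ← symAct_mul, inv_mul_cancel, symAct_one, LinearMap.id_apply]

theorem symAct_symAct_inv (g : SLZ n) (A : SymMat n) : symAct g (symAct g⁻¹ A) = A := by
  rw [← LinearMap.comp_apply, ← symAct_mul, mul_inv_cancel, symAct_one, LinearMap.id_apply]

theorem mem_minSet_comp {φ : Form n} {g : SLZ n} {x : Fin n → ℤ} :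
    x ∈ minSet (φ ∘ₗ symAct g) ↔ g • x ∈ minSet φ := by
  simp [minSet, symAct_sym]

theorem Ryshkov.comp {φ : Form n} (h : Ryshkov φ) (g : SLZ n) : Ryshkov (φ ∘ₗ symAct g) := by
  refine ⟨fun y => ?_, fun x hx => ?_⟩
  · rw [LinearMap.comp_apply, symAct_symR]; exact h.psd _
  · rw [LinearMap.comp_apply, symAct_sym]
    exact h.one_le _ fun h0 => hx (by simpa using congrArg (g⁻¹ • ·) h0)

theorem image_sym_minSet_comp (φ : Form n) (g : SLZ n) :
    symAct g '' (sym '' minSet (φ ∘ₗ symAct g)) = sym '' minSet φ := by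
  ext A
  constructor
  · rintro ⟨_, ⟨x, hx, rfl⟩, rfl⟩
    exact ⟨g • x, mem_minSet_comp.1 hx, (symAct_sym g x).symm⟩
  · rintro ⟨x, hx, rfl⟩
    exact ⟨_, ⟨g⁻¹ • x, mem_minSet_comp.2 (by simpa using hx), rfl⟩, by simp [symAct_sym]⟩

theorem Perfect.comp {φ : Form n} (h : Perfect φ) (g : SLZ n) : Perfect (φ ∘ₗ symAct g) := by
  refine ⟨h.toRyshkov.comp g, ?_⟩
  have h1 : (Submodule.span ℝ (sym '' minSet (φ ∘ₗ symAct g))).map (symAct g) = ⊤ := by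
    rw [Submodule.map_span, image_sym_minSet_comp, h.span]
  rw [eq_top_iff]
  intro A _
  obtain ⟨B, hB, hBA⟩ : symAct g A ∈ (Submodule.span ℝ _).map (symAct g) := by rw [h1]; trivial
  have := congrArg (symAct g⁻¹) hBA
  rw [symAct_inv_symAct, symAct_inv_symAct] at this
  exact this ▸ hB

theorem tile_comp (φ : Form n) (g : SLZ n) : (tile (φ ∘ₗ symAct g)).map (symAct g) = tile φ := by
  rw [tile, tile, ← image_sym_minSet_comp φ g]
  exact Submodule.map_span _ _

theorem comp_comp (φ : Form n) (g h : SLZ n) :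
    (φ ∘ₗ symAct g) ∘ₗ symAct h = φ ∘ₗ symAct (g * h) := by
  rw [symAct_mul]; rfl

theorem det_map_cast (M : Matrix (Fin n) (Fin n) ℤ) :
    (M.map (Int.cast : ℤ → ℝ)).det = (M.det : ℝ) :=
  (RingHom.map_det (Int.castRingHom ℝ) M).symm

/-- From integral vectors which span `ℝⁿ` one can choose the columns of a nonsingular matrix. -/
theorem exists_det_ne_zero {A : Set (Fin n → ℤ)} (h1 : Submodule.span ℝ (toR '' A) = ⊤) :
    ∃ M : Matrix (Fin n) (Fin n) ℤ, M.det ≠ 0 ∧ ∀ j, M.col j ∈ A := by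
  obtain ⟨f, hf, -, hli⟩ := Submodule.exists_fun_fin_finrank_span_eq ℝ (toR '' A)
  have hr : n = Module.finrank ℝ (Submodule.span ℝ (toR '' A)) := by
    rw [h1, finrank_top, Module.finrank_fin_fun]
  choose x hx hxf using hf
  refine ⟨Matrix.of fun i j => x (Fin.cast hr j) i, fun h0 => ?_, fun j => hx _⟩
  have h2 : LinearIndependent ℝ (Matrix.of fun i j => (x (Fin.cast hr j) i : ℝ)).col := by
    have e : (Matrix.of fun i j => (x (Fin.cast hr j) i : ℝ)).col = f ∘ Fin.cast hr := by
      funext j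
      rw [Function.comp_apply, ← hxf]
      rfl
    rw [e]
    exact hli.comp _ (Fin.cast_injective hr)
  rw [Matrix.linearIndependent_cols_iff_isUnit, Matrix.isUnit_iff_isUnit_det, isUnit_iff_ne_zero]
    at h2
  exact h2 ((det_map_cast (Matrix.of fun i j => x (Fin.cast hr j) i)).trans (by rw [h0]; simp))

theorem Perfect.span_minSet {φ : Form n} (h : Perfect φ) :
    Submodule.span ℝ (toR '' minSet φ) = ⊤ := by
  have := span_eq_top_of_sym (fun x : minSet φ => toR x.1) (by
    rw [← h.span]
    congr 1
    ext A
    simp [sym_eq])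
  rw [← this]
  congr 1
  ext y
  simp

/-- Integral matrices with the same determinant `D ≠ 0` and congruent modulo `D` differ by an
element of `SL_n(ℤ)`. -/
theorem exists_mul_eq {M M' : Matrix (Fin n) (Fin n) ℤ} (h0 : M'.det ≠ 0) (h : M.det = M'.det)
    (hmod : ∀ i j, M i j % M'.det = M' i j % M'.det) : ∃ g : SLZ n, g.1 * M' = M := by
  have h1 : ∀ i j, ∃ e, M i j - M' i j = M'.det * e := fun i j =>
    (Int.ModEq.symm (hmod i j)).dvd
  choose E hE using h1
  have h2 : (1 + Matrix.of E * M'.adjugate) * M' = M := by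
    rw [add_mul, one_mul, Matrix.mul_assoc, Matrix.adjugate_mul]
    ext i j
    have := hE i j
    simp only [Matrix.mul_smul, Matrix.mul_one, Matrix.add_apply, Matrix.smul_apply,
      Matrix.of_apply, smul_eq_mul]
    linarith
  refine ⟨⟨1 + Matrix.of E * M'.adjugate, ?_⟩, h2⟩
  have h3 := congrArg Matrix.det h2
  rw [Matrix.det_mul, h] at h3
  exact mul_right_cancel₀ h0 (h3.trans (one_mul _).symm)

/-- There are finitely many perfect forms up to the action of `SL_n(ℤ)`: the determinant of a
matrix of minimal vectors is bounded, and so there are finitely many such matrices up to the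
action; those of a given matrix bound the trace. -/
theorem exists_finite_perfect (hn : 0 < n) :
    ∃ P : Set (Form n), P.Finite ∧ ∀ φ : Form n, Perfect φ → ∃ g : SLZ n, φ ∘ₗ symAct g ∈ P := by
  let key : Matrix (Fin n) (Fin n) ℤ → ℤ × (Fin n → Fin n → ℤ) :=
    fun M => (M.det, fun i j => M i j % M.det)
  have h1 : ∀ k, ∃ C : ℝ, ∀ φ : Form n, Perfect φ → ∀ M : Matrix (Fin n) (Fin n) ℤ, M.det ≠ 0 →
      (∀ j, M.col j ∈ minSet φ) → key M = k → ∃ g : SLZ n, tr (φ ∘ₗ symAct g) ≤ C := by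
    intro k
    by_cases hk : ∃ M, M.det ≠ 0 ∧ key M = k
    · obtain ⟨M', hM', hkey'⟩ := hk
      have hspan : Submodule.span ℝ (Set.range fun j => toR (M'.col j)) = ⊤ := by
        have h2 : LinearIndependent ℝ (M'.map (Int.cast : ℤ → ℝ)).col := by
          rw [Matrix.linearIndependent_cols_iff_isUnit, Matrix.isUnit_iff_isUnit_det,
            isUnit_iff_ne_zero]
          rw [det_map_cast]
          exact_mod_cast hM'
        exact h2.span_eq_top_of_card_eq_finrank' (by simp)
      obtain ⟨c, hc, hctr⟩ := exists_tr_le _ hspan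
      refine ⟨c⁻¹ * n, fun φ hφ M hM hmin hkey => ?_⟩
      have hdet : M.det = M'.det := congrArg Prod.fst (hkey.trans hkey'.symm)
      have hmod : ∀ i j, M i j % M'.det = M' i j % M'.det := fun i j => by
        have := congrFun (congrFun (congrArg Prod.snd (hkey.trans hkey'.symm)) i) j
        simpa only [key, hdet] using this
      obtain ⟨g, hg⟩ := exists_mul_eq hM' hdet hmod
      refine ⟨g, ?_⟩
      rw [le_inv_mul_iff₀ hc]
      refine (hctr _ (hφ.toRyshkov.comp g).psd).trans (le_of_eq ?_)
      have : ∀ j, (φ ∘ₗ symAct g) (symR (toR (M'.col j))) = 1 := by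
        intro j
        rw [← sym_eq]
        refine mem_minSet_comp.2 ?_
        convert hmin j using 1
        rw [← hg]
        rfl
      simp [this]
    · exact ⟨0, fun φ _ M hM _ hkey => absurd ⟨M, hM, hkey⟩ hk⟩
  choose C hC using h1
  let B : ℤ := (n : ℤ) ^ n
  let Ks : Set (ℤ × (Fin n → Fin n → ℤ)) :=
    Set.Icc (-B) B ×ˢ {f | ∀ i, f i ∈ {v | ∀ j, v j ∈ Set.Icc (0 : ℤ) B}}
  have hKs : Ks.Finite := (Set.finite_Icc _ _).prod
    (Set.Finite.pi' fun _ => Set.Finite.pi' fun _ => Set.finite_Icc _ _)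
  refine ⟨⋃ k ∈ Ks, {ψ | Perfect ψ ∧ tr ψ ≤ C k}, hKs.biUnion fun k _ => finite_perfect n _,
    fun φ hφ => ?_⟩
  obtain ⟨M, hM, hmin⟩ := exists_det_ne_zero hφ.span_minSet
  have hdet : |M.det| ≤ B := by
    have h2 := hφ.toRyshkov.abs_det_le hn one_pos (M.map (Int.cast : ℤ → ℝ)) fun i => by
      have : φ (sym (M.col i)) = 1 := hmin i
      rw [sym_eq] at this
      rw [one_pow]
      exact this.le
    rw [det_map_cast, mul_one] at h2
    exact_mod_cast h2
  obtain ⟨g, hg⟩ := hC _ φ hφ M hM hmin rfl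
  refine ⟨g, Set.mem_biUnion (x := key M) ⟨abs_le.1 hdet, fun i j => ⟨?_, ?_⟩⟩ ⟨hφ.comp g, hg⟩⟩
  · exact Int.emod_nonneg _ hM
  · exact ((Int.emod_lt_abs _ hM).le).trans hdet

end Voronoi
end

noncomputable section
/-! ### Cones with finitely many generators -/

namespace Voronoi

section Cones

variable {W : Type*} [AddCommGroup W] [Module ℝ W]

/-- A ray which is a face of the cone generated by a set contains an element of this set. -/
theorem exists_smul_of_isFaceOf {A : Set W} {a : W} (ha : a ≠ 0)
    (h : (PointedCone.hull ℝ {a}).IsFaceOf (PointedCone.hull ℝ A)) :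
    ∃ b ∈ A, ∃ c : ℝ, 0 < c ∧ b = c • a := by
  classical
  have h1 : a ∈ PointedCone.hull ℝ A := h.le (PointedCone.subset_hull rfl)
  obtain ⟨f, hf, hf0, hfa⟩ := PointedCone.mem_hull_set.1 h1
  obtain ⟨b, hb, hb0⟩ : ∃ b ∈ f.support, b ≠ 0 := by
    by_contra! hall
    exact ha (hfa ▸ Finset.sum_eq_zero fun b hb => by simp [hall b hb])
  have hsplit : f b • b + ∑ x ∈ f.support.erase b, f x • x = a := by
    rw [Finset.add_sum_erase _ (fun x => f x • x) hb]
    exact hfa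
  have hmem : b ∈ PointedCone.hull ℝ {a} := by
    refine h.mem_of_smul_add_mem (x := b) (a := f b)
      (y := ∑ x ∈ f.support.erase b, f x • x)
      (PointedCone.subset_hull (hf hb)) (sum_mem fun x hx => ?_)
      (lt_of_le_of_ne (hf0 b) (Finsupp.mem_support_iff.1 hb).symm) ?_
    · exact PointedCone.smul_mem _ (hf0 x)
        (PointedCone.subset_hull (hf (Finset.mem_of_mem_erase hx)))
    · rw [hsplit]; exact PointedCone.subset_hull rfl
  obtain ⟨c, hc⟩ := Submodule.mem_span_singleton.1 hmem
  have hc' : b = (c : ℝ) • a := hc.symm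
  refine ⟨b, hf hb, c, lt_of_le_of_ne c.2 fun h0 => hb0 ?_, hc'⟩
  rw [hc', ← h0, zero_smul]

theorem mem_hull_range_iff {ι : Type*} [Fintype ι] {v : ι → W} {x : W} :
    x ∈ PointedCone.hull ℝ (Set.range v) ↔ ∃ c : ι → ℝ, (∀ i, 0 ≤ c i) ∧ ∑ i, c i • v i = x := by
  rw [Submodule.mem_span_range_iff_exists_fun]
  exact ⟨fun ⟨c, hc⟩ => ⟨fun i => c i, fun i => (c i).2, hc⟩,
    fun ⟨c, h0, hc⟩ => ⟨fun i => ⟨c i, h0 i⟩, hc⟩⟩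

theorem mem_hull_range_basis {ι : Type*} [Fintype ι] (b : Module.Basis ι ℝ W) {x : W} :
    x ∈ PointedCone.hull ℝ (Set.range b) ↔ ∀ i, 0 ≤ b.repr x i := by
  classical
  rw [mem_hull_range_iff]
  constructor
  · rintro ⟨c, h0, rfl⟩ i
    simpa [Finsupp.single_apply] using h0 i
  · exact fun h => ⟨fun i => b.repr x i, h, b.sum_repr x⟩

/-- The edges of a simplicial cone are faces. -/
theorem isFaceOf_hull_range_basis {ι : Type*} [Fintype ι] (b : Module.Basis ι ℝ W) (i : ι) :
    (PointedCone.hull ℝ {b i}).IsFaceOf (PointedCone.hull ℝ (Set.range b)) := by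
  classical
  refine ⟨Submodule.span_mono (by simp), fun {x y a} hx hy ha h => ?_⟩
  rw [mem_hull_range_basis] at hx hy
  obtain ⟨c, hc⟩ := Submodule.mem_span_singleton.1 h
  have hc' : (c : ℝ) • b i = a • x + y := hc
  have h0 : ∀ j, j ≠ i → b.repr x j = 0 := by
    intro j hj
    have h1 := congrArg (fun z => b.repr z j) hc'
    simp only [map_add, map_smul, Module.Basis.repr_self, Finsupp.smul_single, Finsupp.add_apply,
      Finsupp.smul_apply, smul_eq_mul, Finsupp.single_eq_of_ne hj] at h1
    have h2 := hx j
    have h3 := hy j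
    nlinarith [mul_nonneg ha.le h2]
  have hxi : x = b.repr x i • b i := by
    conv_lhs => rw [← b.sum_repr x]
    exact Finset.sum_eq_single i (fun j _ hj => by rw [h0 j hj, zero_smul]) (by simp)
  rw [hxi]
  exact PointedCone.smul_mem _ (hx i) (PointedCone.subset_hull rfl)

theorem hull_range_smul {ι : Type*} {v u : ι → W} {c : ι → ℝ} (hc : ∀ i, 0 < c i)
    (h : ∀ i, v i = c i • u i) :
    PointedCone.hull ℝ (Set.range v) = PointedCone.hull ℝ (Set.range u) := by
  refine le_antisymm (Submodule.span_le.2 ?_) (Submodule.span_le.2 ?_)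
  · rintro _ ⟨i, rfl⟩
    rw [h i]
    exact PointedCone.smul_mem _ (hc i).le (PointedCone.subset_hull ⟨i, rfl⟩)
  · rintro _ ⟨i, rfl⟩
    have : u i = (c i)⁻¹ • v i := by rw [h i, inv_smul_smul₀ (hc i).ne']
    rw [this]
    exact PointedCone.smul_mem _ (inv_nonneg.2 (hc i).le) (PointedCone.subset_hull ⟨i, rfl⟩)

end Cones

/-! ### Tiles and their triangulations -/

variable {n : ℕ}

local notation "SLZ" n => Matrix.SpecialLinearGroup (Fin n) ℤ

theorem sym_ne_zero {x : Fin n → ℤ} (hx : x ≠ 0) : sym x ≠ 0 := fun h => by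
  have := (ryshkov_sumSq n).one_le x hx
  rw [h, map_zero] at this
  linarith

theorem rankOne_ne_zero {u : Fin n → ℚ} (hu : u ≠ 0) : rankOne u ≠ 0 := fun h => hu <| by
  funext i
  have h1 : (rankOne u).1 i i = 0 := by rw [h]; rfl
  rw [rankOne_eq_symR, symR_apply] at h1
  simpa using h1

/-- The form with the coefficients of the matrix `Q`. -/
def formOf (Q : Matrix (Fin n) (Fin n) ℝ) : Form n where
  toFun A := ∑ i, ∑ j, A.1 i j * Q i j
  map_add' A B := by
    simp only [← Finset.sum_add_distrib]
    refine Finset.sum_congr rfl fun i _ => Finset.sum_congr rfl fun j _ => ?_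
    change (A.1 i j + B.1 i j) * _ = _
    ring
  map_smul' c A := by
    simp only [smul_eq_mul, RingHom.id_apply, Finset.mul_sum]
    refine Finset.sum_congr rfl fun i _ => Finset.sum_congr rfl fun j _ => ?_
    change (c * A.1 i j) * _ = _
    ring

theorem formOf_symR (Q : Matrix (Fin n) (Fin n) ℝ) (y : Fin n → ℝ) :
    formOf Q (symR y) = y ⬝ᵥ Q.mulVec y := by
  change ∑ i, ∑ j, (symR y).1 i j * Q i j = ∑ i, y i * ∑ j, Q i j * y j
  refine Finset.sum_congr rfl fun i _ => ?_
  rw [Finset.mul_sum]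
  refine Finset.sum_congr rfl fun j _ => ?_
  rw [symR_apply]; ring

theorem quadVal_eq (Q : Matrix (Fin n) (Fin n) ℝ) (x : Fin n → ℤ) :
    quadVal Q x = formOf Q (sym x) := by
  rw [sym_eq, formOf_symR]; rfl

/-- A perfect quadratic form, scaled to have minimum one, is a perfect form in the Ryshkov
polyhedron with the same tile. -/
theorem exists_perfect_of_isTile (hn : 0 < n) {T : PointedCone ℝ (SymMat n)} (h : IsTile T) :
    ∃ φ : Form n, Perfect φ ∧ T = tile φ := by
  obtain ⟨Q, ⟨hQ, hspan⟩, rfl⟩ := h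
  obtain ⟨x, hx0, hx⟩ : (minVectors Q).Nonempty := by
    by_contra hne
    rw [Set.not_nonempty_iff_eq_empty] at hne
    rw [minRankOnes, hne, Set.image_empty, Submodule.span_empty] at hspan
    have : sym (Pi.single (⟨0, hn⟩ : Fin n) 1) ∈ (⊥ : Submodule ℝ (SymMat n)) := by
      rw [hspan]; trivial
    exact sym_ne_zero (by simp) ((Submodule.mem_bot ℝ).1 this)
  have hpos : ∀ y : Fin n → ℝ, y ≠ 0 → 0 < formOf Q (symR y) := fun y hy => by
    rw [formOf_symR]
    exact hQ.dotProduct_mulVec_pos hy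
  have hm : 0 < quadVal Q x := by
    rw [quadVal_eq, sym_eq]
    exact hpos _ fun h => hx0 (funext fun i => by simpa using congrFun h i)
  set φ : Form n := (quadVal Q x)⁻¹ • formOf Q with hφ
  have hφx : ∀ z, φ (sym z) = (quadVal Q x)⁻¹ * quadVal Q z := fun z => by
    rw [quadVal_eq Q z]; rfl
  have hone : ∀ z, 1 ≤ φ (sym z) ↔ quadVal Q x ≤ quadVal Q z := fun z => by
    rw [hφx, le_inv_mul_iff₀ hm, mul_one]
  have hmin : minSet φ = minVectors Q := by
    ext z
    have h1 : z ∈ minSet φ ↔ quadVal Q z = quadVal Q x := by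
      rw [minSet, Set.mem_ofPred_eq, hφx, inv_mul_eq_one₀ hm.ne', eq_comm]
    constructor
    · intro hz
      exact ⟨ne_zero_of_mem_minSet hz, fun y hy => (h1.1 hz).trans_le (hx y hy)⟩
    · intro hz
      exact h1.2 (le_antisymm (hz.2 x hx0) (hx z hz.1))
  refine ⟨φ, ⟨⟨fun y => ?_, fun z hz => (hone z).2 (hx z hz)⟩, ?_⟩, ?_⟩
  · rw [hφ, LinearMap.smul_apply, smul_eq_mul]
    refine mul_nonneg (inv_nonneg.2 hm.le) ?_
    by_cases hy : y = 0
    · simp [hy, symR_zero]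
    · exact (hpos y hy).le
  · rw [hmin]; exact hspan
  · rw [tile, hmin]; rfl

/-- Perfect forms in the Ryshkov polyhedron are positive definite, so that they define tiles. -/
theorem Perfect.isTile (hn : 0 < n) {φ : Form n} (h : Perfect φ) : IsTile (tile φ) := by
  set Q : Matrix (Fin n) (Fin n) ℝ := Matrix.of fun i j => bil φ (Pi.single i 1) (Pi.single j 1)
    with hQ
  have hφQ : φ = formOf Q := LinearMap.ext fun A => apply_eq_sum_bil φ A
  obtain ⟨c, hc, hcφ⟩ := exists_forall_le n (tr φ)
  obtain ⟨x, hx⟩ : (minSet φ).Nonempty := by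
    by_contra hne
    have hspan := h.span
    rw [Set.not_nonempty_iff_eq_empty] at hne
    rw [hne, Set.image_empty, Submodule.span_empty] at hspan
    have : sym (Pi.single (⟨0, hn⟩ : Fin n) 1) ∈ (⊥ : Submodule ℝ (SymMat n)) := by
      rw [hspan]; trivial
    exact sym_ne_zero (by simp) ((Submodule.mem_bot ℝ).1 this)
  have hmin : minVectors Q = minSet φ := by
    ext z
    simp only [minVectors, quadVal_eq, ← hφQ, minSet, Set.mem_ofPred_eq]
    constructor
    · intro hz
      exact le_antisymm ((hz.2 x (ne_zero_of_mem_minSet hx)).trans (le_of_eq hx))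
        (h.one_le z hz.1)
    · intro hz
      exact ⟨ne_zero_of_mem_minSet hz, fun y hy => hz.trans_le (h.one_le y hy)⟩
  refine ⟨Q, ⟨Matrix.PosDef.of_dotProduct_mulVec_pos ?_ fun y hy => ?_, ?_⟩, ?_⟩
  · ext i j
    simp [hQ, bil_comm φ (Pi.single i 1)]
  · have h1 := hcφ φ h.toRyshkov le_rfl y
    rw [star_trivial, ← formOf_symR, ← hφQ]
    refine lt_of_lt_of_le (mul_pos hc ?_) h1
    obtain ⟨i, hi⟩ := Function.ne_iff.1 hy
    exact Finset.sum_pos' (fun i _ => sq_nonneg _) ⟨i, Finset.mem_univ _, sq_pos_of_ne_zero hi⟩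
  · rw [minRankOnes, hmin]; exact h.span
  · rw [minRankOnes, hmin]; rfl

/-- Two proportional matrices of rank one come from proportional vectors. -/
theorem exists_units_smul {v u : Fin n → ℚ} (hv : v ≠ 0) {c : ℝ}
    (h : rankOne v = c • rankOne u) : ∃ a : ℚˣ, v = (a : ℚ) • u := by
  have h1 : ∀ i j, (v i : ℝ) * v j = c * (u i * u j) := fun i j => by
    have := congrArg (fun A : SymMat n => A.1 i j) h
    exact this
  obtain ⟨i, hi⟩ := Function.ne_iff.1 hv
  have hi : v i ≠ 0 := hi
  have hi' : (v i : ℝ) ≠ 0 := by exact_mod_cast hi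
  have hu : u i ≠ 0 := by
    intro h0
    have := h1 i i
    simp [h0, hi] at this
  have hu' : (u i : ℝ) ≠ 0 := by exact_mod_cast hu
  refine ⟨Units.mk0 (v i / u i) (div_ne_zero hi hu), funext fun j => ?_⟩
  rw [Units.val_mk0, Pi.smul_apply, smul_eq_mul, div_mul_eq_mul_div, eq_div_iff hu]
  have h2 := h1 i i
  have h3 := h1 i j
  have : (v j : ℝ) * u i = v i * u j := by
    apply mul_left_cancel₀ hi'
    linear_combination (u i : ℝ) * h3 - (u j : ℝ) * h2
  exact_mod_cast this

/-- The vertices of a tile are minimal vectors. -/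
theorem exists_minSet_of_isVertexOf {φ : Form n} {v : NZVec n} (h : IsVertexOf v (tile φ)) :
    ∃ x ∈ minSet φ, ∃ c : ℝ, 0 < c ∧ rankOne v.1 = c • sym x := by
  obtain ⟨_, ⟨x, hx, rfl⟩, c, hc, hcx⟩ := exists_smul_of_isFaceOf (rankOne_ne_zero v.2) h
  exact ⟨x, hx, c⁻¹, inv_pos.2 hc, by rw [hcx, inv_smul_smul₀ hc.ne']⟩

theorem exists_of_mem_simplicialCones {φ : Form n} {s : PointedCone ℝ (SymMat n)}
    (h : s ∈ simplicialCones (tile φ)) : ∃ U : Fin (coneDim n) → Fin n → ℤ,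
      (∀ i, U i ∈ minSet φ) ∧ s = PointedCone.hull ℝ (Set.range fun i => sym (U i)) := by
  obtain ⟨v, -, hv, rfl⟩ := h
  choose U hU c hc hcU using fun i => exists_minSet_of_isVertexOf (hv i)
  exact ⟨U, hU, hull_range_smul hc hcU⟩

theorem finite_simplicialCones {φ : Form n} (h : Ryshkov φ) :
    (simplicialCones (tile φ)).Finite := by
  refine ((Set.Finite.pi' (ι := Fin (coneDim n)) (t := fun _ => minSet φ)
    fun _ => h.finite_minSet).image
      fun U => PointedCone.hull ℝ (Set.range fun i => sym (U i))).subset fun s hs => ?_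
  obtain ⟨U, hU, rfl⟩ := exists_of_mem_simplicialCones hs
  exact ⟨U, hU, rfl⟩

/-- The primitive description of an oriented list of vertices of a simplicial cone: the vertices
may be taken to be minimal vectors of the form of the tile. -/
theorem exists_minimal_vertices {o : Orientation ℝ (SymMat n) (Fin (coneDim n))} {φ : Form n}
    {s : PointedCone ℝ (SymMat n)} (hs : s ∈ simplicialCones (tile φ))
    {v : Fin (coneDim n) → NZVec n} (hv : IsOrientedVertexList o s v) :
    ∃ U : Fin (coneDim n) → Fin n → ℤ, (∀ i, U i ∈ minSet φ) ∧
      s = PointedCone.hull ℝ (Set.range fun i => sym (U i)) ∧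
      (∃ b : Module.Basis (Fin (coneDim n)) ℝ (SymMat n), (∀ i, b i = sym (U i)) ∧
        b.orientation = o) ∧
      ∀ i, ∃ a : ℚˣ, (v i).1 = (a : ℚ) • fun k => (U i k : ℚ) := by
  obtain ⟨U₀, hU₀, hs₀⟩ := exists_of_mem_simplicialCones hs
  obtain ⟨hsv, b, hb, rfl⟩ := hv
  have h1 : ∀ i, ∃ x ∈ minSet φ, ∃ c : ℝ, 0 < c ∧ rankOne (v i).1 = c • sym x := by
    intro i
    have h2 := isFaceOf_hull_range_basis b i
    have h3 : PointedCone.hull ℝ (Set.range b) =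
        PointedCone.hull ℝ (Set.range fun i => sym (U₀ i)) := by
      rw [← hs₀, hsv, coneOf]
      congr 2
      exact funext hb
    rw [h3] at h2
    obtain ⟨_, ⟨j, rfl⟩, c, hc, hcx⟩ := exists_smul_of_isFaceOf (b.ne_zero i) h2
    exact ⟨U₀ j, hU₀ j, c⁻¹, inv_pos.2 hc, by
      rw [show sym (U₀ j) = c • b i from hcx, inv_smul_smul₀ hc.ne', hb]⟩
  choose U hU c hc hcU using h1
  refine ⟨U, hU, hsv.trans (hull_range_smul hc hcU),
    ⟨b.isUnitSMul (w := fun i => (c i)⁻¹) fun i => (inv_pos.2 (hc i)).ne'.isUnit, fun i => ?_, ?_⟩,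
    fun i => exists_units_smul (v i).2 (hcU i)⟩
  · rw [Module.Basis.isUnitSMul_apply, hb, hcU, inv_smul_smul₀ (hc i).ne']
  · rw [eq_comm, Module.Basis.orientation_eq_iff_det_pos]
    have : ⇑(b.isUnitSMul (w := fun i => (c i)⁻¹) fun i => (inv_pos.2 (hc i)).ne'.isUnit) =
        fun i => (c i)⁻¹ • b i := funext fun i => Module.Basis.isUnitSMul_apply _ i
    rw [this]
    have h4 := b.det.toMultilinearMap.map_smul_univ (fun i => (c i)⁻¹) b
    have h5 : b.det (fun i => (c i)⁻¹ • b i) = (∏ i, (c i)⁻¹) • b.det b := h4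
    rw [h5, b.det_self, smul_eq_mul, mul_one]
    exact Finset.prod_pos fun i _ => inv_pos.2 (hc i)

theorem symAct_map_mul (T : PointedCone ℝ (SymMat n)) (g h : SLZ n) :
    (T.map (symAct h)).map (symAct g) = T.map (symAct (g * h)) := by
  rw [symAct_mul, PointedCone.map_map]

theorem symAct_map_one (T : PointedCone ℝ (SymMat n)) : T.map (symAct (1 : SLZ n)) = T := by
  rw [symAct_one, PointedCone.map_id]

/-- Every tile is a translate `g T` of one of finitely many tiles `T`, and for a given `T` its orbit
under `G` depends only on the coset `G g`. -/
theorem finite_representatives (hn : 0 < n) {G : Subgroup (SLZ n)} (hfin : G.FiniteIndex)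
    {R : Set (PointedCone ℝ (SymMat n))} (hR : IsTileRepresentatives G R) : R.Finite := by
  obtain ⟨P, hP, hrep⟩ := exists_finite_perfect hn
  have h1 : ∀ T : PointedCone ℝ (SymMat n), ∃ φ : Form n, ∃ g : SLZ n, T ∈ R →
      φ ∈ P ∧ T = (tile φ).map (symAct g) := by
    intro T
    by_cases hT : T ∈ R
    · obtain ⟨φ, hφ, hTφ⟩ := exists_perfect_of_isTile hn (hR.1 T hT)
      obtain ⟨g, hg⟩ := hrep φ hφ
      exact ⟨_, g, fun _ => ⟨hg, by rw [tile_comp, hTφ]⟩⟩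
    · exact ⟨0, 1, fun h => absurd h hT⟩
  choose φ g h1 using h1
  have : Finite ((SLZ n) ⧸ G) := Subgroup.finite_quotient_of_finiteIndex
  refine Set.Finite.of_injOn (f := fun T => (φ T, QuotientGroup.mk (s := G) (g T)⁻¹))
    (t := P ×ˢ Set.univ)
    (fun T hT => ⟨(h1 T hT).1, trivial⟩) ?_ (hP.prod Set.finite_univ)
  intro T hT T' hT' heq
  have e1 : φ T = φ T' := congrArg Prod.fst heq
  have e2 : QuotientGroup.mk (s := G) (g T)⁻¹ = QuotientGroup.mk (s := G) (g T')⁻¹ :=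
    congrArg Prod.snd heq
  have e3 : g T * (g T')⁻¹ ∈ G := by
    have := QuotientGroup.eq.1 e2
    simpa using this
  have e4 : T'.map (symAct (g T * (g T')⁻¹)) = T := by
    have e5 := congrArg (PointedCone.map (symAct (g T * (g T')⁻¹))) (h1 T' hT').2
    rwa [symAct_map_mul, inv_mul_cancel_right, ← e1, ← (h1 T hT).2] at e5
  obtain ⟨T'', -, huniq⟩ := hR.2 T' (hR.1 T' hT')
  rw [huniq T ⟨hT, _, e3, e4⟩, huniq T' ⟨hT', 1, G.one_mem, symAct_map_one T'⟩]

end Voronoi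
end

noncomputable section
/-! ### Dissections of the cone of positive definite matrices -/

namespace Voronoi

variable {n : ℕ}

local notation "SLZ" n => Matrix.SpecialLinearGroup (Fin n) ℤ

/-- If a point of the tile of `ψ` is a positive combination of minimal vectors of `φ`, then these
are minimal vectors of `ψ`. -/
theorem mem_minSet_of_sum_eq {φ ψ : Form n} (hφ : Ryshkov φ) (hψ : Ryshkov ψ) {α β : Type*}
    [Fintype α] [Fintype β] {x : α → Fin n → ℤ} (hx : ∀ a, x a ∈ minSet φ) {t : α → ℝ}
    (ht : ∀ a, 0 ≤ t a) {z : β → Fin n → ℤ} (hz : ∀ a, z a ∈ minSet ψ) {r : β → ℝ}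
    (hr : ∀ a, 0 ≤ r a) (h : ∑ a, t a • sym (x a) = ∑ a, r a • sym (z a)) {a : α}
    (ha : 0 < t a) : x a ∈ minSet ψ := by
  have h1 : ∑ a, t a = ∑ a, r a * φ (sym (z a)) := by
    have := congrArg φ h
    simp only [map_sum, map_smul, smul_eq_mul] at this
    rw [← this]
    exact Finset.sum_congr rfl fun a _ => by rw [show φ (sym (x a)) = 1 from hx a, mul_one]
  have h2 : ∑ a, t a * ψ (sym (x a)) = ∑ a, r a := by
    have := congrArg ψ h
    simp only [map_sum, map_smul, smul_eq_mul] at this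
    rw [this]
    exact Finset.sum_congr rfl fun a _ => by rw [show ψ (sym (z a)) = 1 from hz a, mul_one]
  have h3 : ∑ a, r a ≤ ∑ a, r a * φ (sym (z a)) := Finset.sum_le_sum fun a _ =>
    le_mul_of_one_le_right (hr a) (hφ.one_le _ (ne_zero_of_mem_minSet (hz a)))
  have h4 : ∑ a, t a * (ψ (sym (x a)) - 1) ≤ 0 := by
    simp only [mul_sub, mul_one, Finset.sum_sub_distrib]
    linarith
  have h5 : ∀ a ∈ Finset.univ, 0 ≤ t a * (ψ (sym (x a)) - 1) := fun a _ =>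
    mul_nonneg (ht a) (sub_nonneg.2 (hψ.one_le _ (ne_zero_of_mem_minSet (hx a))))
  have h6 := (Finset.sum_eq_zero_iff_of_nonneg h5).1 (le_antisymm h4 (Finset.sum_nonneg h5)) a
    (Finset.mem_univ a)
  rcases mul_eq_zero.1 h6 with h7 | h7
  · exact absurd h7 ha.ne'
  · exact sub_eq_zero.1 h7

/-- A tile determines its perfect form. -/
theorem Perfect.eq_of_tile_eq {φ ψ : Form n} (hφ : Perfect φ) (hψ : Perfect ψ)
    (h : tile φ = tile ψ) : φ = ψ := by
  refine hφ.eq fun x hx => ?_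
  have h1 : sym x ∈ tile ψ := h ▸ sym_mem_tile hx
  have : Fintype (minSet ψ) := hψ.toRyshkov.finite_minSet.fintype
  have h2 : sym '' minSet ψ = Set.range fun z : minSet ψ => sym z.1 := by
    ext A
    simp
  rw [tile, h2, mem_hull_range_iff] at h1
  obtain ⟨c, hc, hcx⟩ := h1
  refine mem_minSet_of_sum_eq (α := Unit) hφ.toRyshkov hψ.toRyshkov (x := fun _ => x)
    (fun _ => hx) (t := fun _ => 1) (fun _ => zero_le_one) (fun z : minSet ψ => z.2) hc ?_
    (a := ()) one_pos
  rw [hcx]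
  simp

theorem ext_of_smul_eq {g h : SLZ n} {F : Set (Fin n → ℤ)}
    (hspan : Submodule.span ℝ (toR '' F) = ⊤) (hg : ∀ x ∈ F, g • x = h • x) : g = h := by
  obtain ⟨M, hM, hMF⟩ := exists_det_ne_zero hspan
  have h1 : g.1 * M = h.1 * M := by
    ext i j
    exact congrFun (hg _ (hMF j)) i
  apply Subtype.ext
  have h2 := congrArg (· * M.adjugate) h1
  simp only [Matrix.mul_assoc, Matrix.mul_adjugate, Matrix.mul_smul, Matrix.mul_one] at h2
  exact smul_right_injective _ hM h2

/-- An element of a torsion-free group which preserves a finite spanning set is trivial. -/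
theorem eq_one_of_mapsTo {g : SLZ n} (htf : IsOfFinOrder g → g = 1) {F : Set (Fin n → ℤ)}
    (hF : F.Finite) (hspan : Submodule.span ℝ (toR '' F) = ⊤) (hg : ∀ x ∈ F, g • x ∈ F) :
    g = 1 := by
  refine htf ?_
  by_contra hord
  rw [← injective_pow_iff_not_isOfFinOrder] at hord
  have hpow : ∀ (m : ℕ), ∀ x ∈ F, g ^ m • x ∈ F := by
    intro m
    induction m with
    | zero => intro x hx; simpa using hx
    | succ m ih => intro x hx; rw [pow_succ', mul_smul]; exact hg _ (ih x hx)
  have : Finite F := hF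
  refine not_injective_infinite_finite (fun m : ℕ => fun x : F => (⟨_, hpow m x.1 x.2⟩ : F))
    fun m m' h => hord ?_
  refine ext_of_smul_eq hspan fun x hx => ?_
  exact congrArg Subtype.val (congrFun h ⟨x, hx⟩)

/-- A dissection of the cone of positive definite matrices: finitely many simplicial cones with
bases `b i`, made of minimal vectors of perfect forms, the translates of which by a group `G`
cover all tiles and have disjoint interiors. -/
structure Dissection (n k : ℕ) (G : Subgroup (SLZ n)) (ι : Type) where
  /-- the form of the tile of a cone -/
  φ : ι → Form n
  /-- the vertices of a cone -/
  U : ι → Fin (k + 1) → Fin n → ℤ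
  /-- the basis given by the vertices of a cone -/
  b : ι → Module.Basis (Fin (k + 1)) ℝ (SymMat n)
  ryshkov : ∀ i, Ryshkov (φ i)
  b_apply : ∀ i j, b i j = sym (U i j)
  mem : ∀ i j, U i j ∈ minSet (φ i)
  orient : ∀ i j, 0 < (b i).det (b j)
  cover : ∀ ψ : Form n, Perfect ψ → ∃ g ∈ G, ∀ y ∈ tile ψ, ∃ i, ∀ j,
    0 ≤ (b i).repr (symAct g⁻¹ y) j
  disjoint : ∀ i i', ∀ g ∈ G, ∀ y, (∀ j, 0 < (b i).repr y j) →
    (∀ j, 0 < (b i').repr (symAct g⁻¹ y) j) → i = i' ∧ g = 1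

theorem le_of_isFaceOf {W ι : Type*} [AddCommGroup W] [Module ℝ W] [Fintype ι] [DecidableEq ι]
    (b : Module.Basis ι ℝ W) {F : PointedCone ℝ W}
    (hF : F.IsFaceOf (PointedCone.hull ℝ (Set.range b))) {y : W} (hy : ∀ i, 0 < b.repr y i)
    (hyF : y ∈ F) : PointedCone.hull ℝ (Set.range b) ≤ F := by
  refine Submodule.span_le.2 ?_
  rintro _ ⟨i, rfl⟩
  refine hF.mem_of_smul_add_mem (x := b i) (a := b.repr y i)
    (y := ∑ x ∈ Finset.univ.erase i, b.repr y x • b x) (PointedCone.subset_hull ⟨i, rfl⟩)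
    (sum_mem fun x _ => PointedCone.smul_mem _ (hy x).le (PointedCone.subset_hull ⟨x, rfl⟩))
    (hy i) ?_
  rwa [Finset.add_sum_erase _ (fun x => b.repr y x • b x) (Finset.mem_univ i), b.sum_repr]

/-- Triangulations of representatives of the tiles give a dissection. -/
theorem exists_dissection (hn : 0 < n) {k : ℕ} (hk : coneDim n = k + 1)
    {o : Orientation ℝ (SymMat n) (Fin (coneDim n))} {G : Subgroup (SLZ n)}
    (htf : ∀ g ∈ G, IsOfFinOrder g → g = 1)
    {R : Set (PointedCone ℝ (SymMat n))} (hR : IsTileRepresentatives G R)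
    {τ : PointedCone ℝ (SymMat n) → Set (PointedCone ℝ (SymMat n))}
    (hτ : ∀ T ∈ R, IsTriangulation T (τ T))
    {S : Set (PointedCone ℝ (SymMat n))} (hS : S = ⋃ T ∈ R, τ T)
    {w : PointedCone ℝ (SymMat n) → Fin (coneDim n) → NZVec n}
    (hw : ∀ s ∈ S, IsOrientedVertexList o s (w s)) :
    ∃ D : Dissection n k G S, ∀ (s : S) (i : Fin (coneDim n)),
      ∃ a : ℚˣ, (w s.1 i).1 = (a : ℚ) • fun l => (D.U s (Fin.cast hk i) l : ℚ) := by
  have h1 : ∀ s : S, ∃ T ∈ R, s.1 ∈ τ T := fun s => by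
    simpa using hS.subset s.2
  choose T hTR hsT using h1
  choose φ hφ hTφ using fun s => exists_perfect_of_isTile hn (hR.1 _ (hTR s))
  have h2 : ∀ s : S, s.1 ∈ simplicialCones (tile (φ s)) := fun s => by
    rw [← hTφ]; exact (hτ _ (hTR s)).subset (hsT s)
  choose U hU hsU hb hw' using fun s : S => exists_minimal_vertices (h2 s) (hw s.1 s.2)
  choose b hbU hbo using hb
  have hhull : ∀ s : S, s.1 = PointedCone.hull ℝ (Set.range (b s)) := fun s => by
    rw [hsU s]
    congr 2
    exact (funext (hbU s)).symm
  have hmem : ∀ (s : S) (y : SymMat n), y ∈ s.1 ↔ ∀ j, 0 ≤ (b s).repr y j := fun s y => by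
    conv_lhs => rw [hhull s]
    exact mem_hull_range_basis (b s)
  have hTuniq : ∀ s s' : S, ∀ g ∈ G, (T s).map (symAct g) = T s' → T s = T s' := by
    intro s s' g hg h
    obtain ⟨T', -, hu⟩ := hR.2 (T s) (hR.1 _ (hTR s))
    rw [hu (T s) ⟨hTR s, 1, G.one_mem, symAct_map_one _⟩, hu (T s') ⟨hTR s', g, hg, h⟩]
  have hdisj : ∀ i i' : S, ∀ g ∈ G, ∀ y, (∀ j, 0 < (b i).repr y j) →
      (∀ j, 0 < (b i').repr (symAct g⁻¹ y) j) → i = i' ∧ g = 1 := by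
    intro i i' g hg y hy hy'
    have hy2 : ∑ j, (b i).repr y j • sym (U i j) =
        ∑ j, (b i').repr (symAct g⁻¹ y) j • sym (g • U i' j) := by
      have e1 : ∑ j, (b i).repr y j • sym (U i j) = y := by
        conv_rhs => rw [← (b i).sum_repr y]
        exact Finset.sum_congr rfl fun j _ => by rw [hbU]
      have e2 : ∑ j, (b i').repr (symAct g⁻¹ y) j • sym (g • U i' j) = y := by
        conv_rhs => rw [← symAct_symAct_inv g y, ← (b i').sum_repr (symAct g⁻¹ y)]
        rw [map_sum]
        exact Finset.sum_congr rfl fun j _ => by rw [map_smul, hbU, symAct_sym]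
      rw [e1, e2]
    -- The vertices of the one cone are minimal vectors of the form of the other one, because the
    -- cones have an interior point in common. So the forms agree, and `g` permutes their minimal
    -- vectors.
    have hform : φ i = φ i' ∘ₗ symAct g⁻¹ := by
      refine (b i).ext fun j => ?_
      have h3 := mem_minSet_of_sum_eq (hφ i).toRyshkov ((hφ i').toRyshkov.comp g⁻¹) (hU i)
        (fun j => (hy j).le) (z := fun j => g • U i' j)
        (fun j => mem_minSet_comp.2 (by simpa using hU i' j)) (fun j => (hy' j).le) hy2 (hy j)
      rw [hbU, show φ i (sym (U i j)) = 1 from hU i j]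
      exact h3.symm
    have htile : (T i').map (symAct g) = T i := by
      have h3 : φ i ∘ₗ symAct g = φ i' := by
        rw [hform, comp_comp, inv_mul_cancel, symAct_one, LinearMap.comp_id]
      rw [hTφ i', hTφ i, ← tile_comp (φ i) g, h3]
    have hTT := hTuniq i' i g hg htile
    have hφφ : φ i' = φ i := (hφ i').eq_of_tile_eq (hφ i) (by rw [← hTφ, ← hTφ, hTT])
    have hg1 : g = 1 := by
      have h4 : g⁻¹ = 1 := by
        refine eq_one_of_mapsTo (htf _ (G.inv_mem hg)) (hφ i).toRyshkov.finite_minSet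
          (hφ i).span_minSet fun x hx => ?_
        rw [hform, mem_minSet_comp, hφφ] at hx
        exact hx
      simpa using h4
    refine ⟨?_, hg1⟩
    rw [hg1, inv_one, symAct_one, LinearMap.id_apply] at hy'
    -- Two cones of one triangulation with a common interior point coincide, because the
    -- intersection is a face that meets the interior.
    by_contra hne
    have hne' : i.1 ≠ i'.1 := fun h => hne (Subtype.ext h)
    obtain ⟨f1, f2⟩ := (hτ _ (hTR i)).inter i.1 (hsT i) i'.1 (hTT ▸ hsT i') hne'
    have hyi : y ∈ i.1 ⊓ i'.1 :=
      ⟨(hmem i y).2 fun j => (hy j).le, (hmem i' y).2 fun j => (hy' j).le⟩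
    have l1 : i.1 ≤ i.1 ⊓ i'.1 := by
      have := le_of_isFaceOf (b i) (F := i.1 ⊓ i'.1) (by rw [← hhull]; exact f1) hy hyi
      rwa [← hhull] at this
    have l2 : i'.1 ≤ i.1 ⊓ i'.1 := by
      have := le_of_isFaceOf (b i') (F := i.1 ⊓ i'.1) (by rw [← hhull]; exact f2) hy' hyi
      rwa [← hhull] at this
    exact hne' (le_antisymm (l1.trans inf_le_right) (l2.trans inf_le_left))
  have hcov : ∀ ψ : Form n, Perfect ψ → ∃ g ∈ G, ∀ y ∈ tile ψ, ∃ i : S, ∀ j,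
      0 ≤ (b i).repr (symAct g⁻¹ y) j := by
    intro ψ hψ
    obtain ⟨T', ⟨hT', γ, hγ, hγT⟩, -⟩ := hR.2 (tile ψ) (hψ.isTile hn)
    refine ⟨γ⁻¹, G.inv_mem hγ, fun y hy => ?_⟩
    have h3 : symAct γ y ∈ (T' : Set (SymMat n)) := by
      rw [← hγT]
      exact ⟨y, hy, rfl⟩
    rw [← (hτ T' hT').cover] at h3
    simp only [Set.mem_iUnion] at h3
    obtain ⟨s, hs, hys⟩ := h3
    have hsS : s ∈ S := by
      rw [hS]
      exact Set.mem_biUnion hT' hs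
    refine ⟨⟨s, hsS⟩, (hmem ⟨s, hsS⟩ _).1 ?_⟩
    rw [inv_inv]
    exact hys
  let e := finCongr hk
  refine ⟨{
    φ := φ
    U := fun s j => U s (e.symm j)
    b := fun s => (b s).reindex e
    ryshkov := fun s => (hφ s).toRyshkov
    b_apply := fun s j => by simp [hbU]
    mem := fun s j => hU s _
    orient := fun s s' => ?_
    cover := fun ψ hψ => ?_
    disjoint := fun s s' g hg y hy hy' => ?_ }, fun s i => hw' s i⟩
  · have h3 := ((b s).orientation_eq_iff_det_pos (b s')).1 (by rw [hbo, hbo])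
    have h4 : ⇑((b s').reindex e) ∘ e = b s' := by
      funext j
      simp
    rw [Module.Basis.det_reindex, h4]
    exact h3
  · obtain ⟨g, hg, h3⟩ := hcov ψ hψ
    refine ⟨g, hg, fun y hy => ?_⟩
    obtain ⟨i, hi⟩ := h3 y hy
    exact ⟨i, fun j => by simpa using hi (e.symm j)⟩
  · exact hdisj s s' g hg y (fun j => by simpa using hy (e j)) fun j => by simpa using hy' (e j)

end Voronoi
end

noncomputable section
/-! ### Crossing a wall of a simplicial cone -/

namespace Voronoi

section Jump

variable {W : Type*} [AddCommGroup W] [Module ℝ W] {k : ℕ}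

theorem det_cons_succAbove (b e : Module.Basis (Fin (k + 1)) ℝ W) (N : W) (j : Fin (k + 1)) :
    b.det (Fin.cons N fun a => e (j.succAbove a)) = (-1) ^ (j : ℕ) * e.coord j N * b.det e := by
  set l : W →ₗ[ℝ] ℝ := b.det.toMultilinearMap.toLinearMap (Fin.cons 0 fun a => e (j.succAbove a)) 0
    with hl
  have hlN : ∀ M, l M = b.det (Fin.cons M fun a => e (j.succAbove a)) := fun M => by
    rw [hl, MultilinearMap.toLinearMap_apply, Fin.update_cons_zero]
    rfl
  have h : l = ((-1) ^ (j : ℕ) * b.det e) • e.coord j := by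
    refine e.ext fun i => ?_
    rw [hlN, LinearMap.smul_apply, smul_eq_mul]
    by_cases hij : i = j
    · subst hij
      have h1 : (Fin.cons (e i) fun a => e (i.succAbove a)) =
          e ∘ (i.cycleRange⁻¹ : Equiv.Perm _) := by
        funext a
        refine Fin.cases ?_ (fun a => ?_) a
        · simp [Equiv.Perm.inv_def]
        · simp [Equiv.Perm.inv_def]
      rw [h1, AlternatingMap.map_perm, Equiv.Perm.sign_inv, Fin.sign_cycleRange]
      simp [Units.smul_def]
    · obtain ⟨a, rfl⟩ := Fin.exists_succAbove_eq hij
      rw [b.det.map_eq_zero_of_eq _ (i := 0) (j := a.succ) (by simp) (Fin.succ_ne_zero a).symm]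
      simp
  rw [← hlN, h, LinearMap.smul_apply, smul_eq_mul]
  ring

open scoped Classical in
/-- The indicator of the condition that `p + ε M` is interior to the simplicial cone with basis
`e`, for small positive `ε`. -/
def inward (e : Module.Basis (Fin (k + 1)) ℝ W) (p M : W) : ℝ :=
  if ∀ j, 0 < e.coord j p ∨ (e.coord j p = 0 ∧ 0 < e.coord j M) then 1 else 0

theorem coord_of_mem_open_wall (e : Module.Basis (Fin (k + 1)) ℝ W) {ν : W →ₗ[ℝ] ℝ} {N p y : W}
    (hν : ν N = 1) (hp : ν p = 0) {c : ℝ} (hy : y = c • N + p) {j : Fin (k + 1)}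
    (hj : ∀ a, ν (e (j.succAbove a)) = 0)
    (h : ∃ (a : ℝ) (t : Fin k → ℝ), (∀ i, 0 < t i) ∧ y = a • N + ∑ i, t i • e (j.succAbove i)) :
    e.coord j p = 0 ∧ ∀ a, 0 < e.coord (j.succAbove a) p := by
  obtain ⟨a, t, ht, hyt⟩ := h
  have hca : c = a := by
    have := congrArg ν (hy.symm.trans hyt)
    simpa [hν, hp, hj] using this
  have hpt : p = ∑ i, t i • e (j.succAbove i) := by
    have := hy.symm.trans hyt
    rw [hca] at this
    exact add_left_cancel this
  rw [hpt]
  refine ⟨by simp, fun a => ?_⟩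
  simpa [Finsupp.single_apply, Fin.succAbove_right_injective.eq_iff] using ht a

open scoped Classical in
/-- The jump of the indicator function of a simplicial cone across the hyperplane `ν = 0`, at a
point `p` which avoids all faces of codimension two and all walls transversal to the hyperplane,
as a sum over the walls. -/
theorem sum_signedCone_eq_inward_sub (b e : Module.Basis (Fin (k + 1)) ℝ W) (hbe : 0 < b.det e)
    {ν : W →ₗ[ℝ] ℝ} {N p y : W} (hν : ν N = 1) (hp : ν p = 0) {c : ℝ} (hy : y = c • N + p)
    (hgen : ∀ j, e.coord j p = 0 → ∀ z, ν z = 0 → e.coord j z = 0) {C : Fin (k + 1) → Prop}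
    (hC1 : ∀ j, C j → ∀ a, ν (e (j.succAbove a)) = 0)
    (hC2 : ∀ j, e.coord j p = 0 → (∀ a, 0 < e.coord (j.succAbove a) p) → C j) :
    ∑ j : Fin (k + 1), (if C j then (-1 : ℝ) ^ (j : ℕ) *
      (if ∃ (a : ℝ) (t : Fin k → ℝ), (∀ i, 0 < t i) ∧ y = a • N + ∑ i, t i • e (j.succAbove i)
        then ((SignType.sign (b.det (Fin.cons N fun a => e (j.succAbove a))) : SignType) : ℝ)
        else 0) else 0) = inward e p N - inward e p (-N) := by
  have hterm : ∀ j : Fin (k + 1), (if C j then (-1 : ℝ) ^ (j : ℕ) *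
      (if ∃ (a : ℝ) (t : Fin k → ℝ), (∀ i, 0 < t i) ∧ y = a • N + ∑ i, t i • e (j.succAbove i)
        then ((SignType.sign (b.det (Fin.cons N fun a => e (j.succAbove a))) : SignType) : ℝ)
        else 0) else 0) =
      if e.coord j p = 0 ∧ ∀ a, 0 < e.coord (j.succAbove a) p
        then ((SignType.sign (e.coord j N) : SignType) : ℝ) else 0 := by
    intro j
    by_cases hA : e.coord j p = 0 ∧ ∀ a, 0 < e.coord (j.succAbove a) p
    · have hyp : y = c • N + ∑ i, e.coord (j.succAbove i) p • e (j.succAbove i) := by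
        rw [hy]
        congr 1
        conv_lhs => rw [← e.sum_repr p, Fin.sum_univ_succAbove _ j]
        have : e.repr p j = 0 := hA.1
        rw [this, zero_smul, zero_add]
        rfl
      rw [if_pos hA, if_pos (hC2 j hA.1 hA.2), if_pos ⟨c, _, hA.2, hyp⟩, det_cons_succAbove,
        sign_mul, sign_mul, sign_pos hbe, mul_one, sign_pow, Left.sign_neg, sign_one]
      push_cast
      rw [← mul_assoc, ← mul_pow]
      norm_num
    · rw [if_neg hA]
      split_ifs with h1 h2
      · exact absurd (coord_of_mem_open_wall e hν hp hy (hC1 j h1) h2) hA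
      · simp
      · rfl
  rw [Finset.sum_congr rfl fun j _ => hterm j]
  have htwo : ∀ i j, i ≠ j → e.coord i p = 0 → e.coord j p ≠ 0 := by
    intro i j hij hi hj
    have hz : ν (ν (e i) • e j - ν (e j) • e i) = 0 := by
      simp only [map_sub, map_smul, smul_eq_mul]; ring
    have h1 := hgen j hj _ hz
    have h2 : ν (e i) = 0 := by
      simpa [Finsupp.single_apply, hij] using h1
    have h3 := hgen i hi _ h2
    simp at h3
  by_cases hex : ∃ j, e.coord j p = 0 ∧ ∀ a, 0 < e.coord (j.succAbove a) p
  · obtain ⟨j, hj0, hj⟩ := hex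
    have hj' : ∀ i, i ≠ j → 0 < e.coord i p := by
      intro i hi
      obtain ⟨a, rfl⟩ := Fin.exists_succAbove_eq hi
      exact hj a
    rw [Finset.sum_eq_single j (fun i _ hi => if_neg fun h => (hj' i hi).ne' h.1) (by simp),
      if_pos ⟨hj0, hj⟩]
    have hNe : e.coord j N ≠ 0 := by
      intro h0
      have h1 := hgen j hj0 (e j - ν (e j) • N) (by simp [hν])
      rw [map_sub, map_smul, h0, smul_zero, sub_zero] at h1
      simp at h1
    have hin : ∀ M, inward e p M = if 0 < e.coord j M then 1 else 0 := by
      intro M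
      refine if_congr ⟨fun h => ?_, fun h i => ?_⟩ rfl rfl
      · rcases h j with h1 | h1
        · exact absurd hj0 h1.ne'
        · exact h1.2
      · by_cases hi : i = j
        · subst hi; exact Or.inr ⟨hj0, h⟩
        · exact Or.inl (hj' i hi)
    rw [hin, hin, map_neg]
    rcases hNe.lt_or_gt with h | h
    · rw [sign_neg h, if_neg h.not_gt, if_pos (by linarith)]
      simp
    · rw [sign_pos h, if_pos h, if_neg (by linarith)]
      simp
  · rw [Finset.sum_eq_zero fun j _ => if_neg fun h => hex ⟨j, h⟩]
    have hin : ∀ M, inward e p M = if ∀ j, 0 < e.coord j p then 1 else 0 := by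
      intro M
      refine if_congr ⟨fun h j => ?_, fun h j => Or.inl (h j)⟩ rfl rfl
      rcases h j with h1 | h1
      · exact h1
      · refine absurd ⟨j, h1.1, fun a => ?_⟩ hex
        rcases h (j.succAbove a) with h2 | h2
        · exact h2
        · exact absurd h2.1 (htwo j _ (Fin.succAbove_ne j a).symm h1.1)
    rw [hin, hin, sub_self]

open Filter Topology in
theorem inward_eq_one_iff (e : Module.Basis (Fin (k + 1)) ℝ W) (p M : W) :
    inward e p M = 1 ↔ ∀ j, 0 < e.coord j p ∨ (e.coord j p = 0 ∧ 0 < e.coord j M) := by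
  unfold inward
  split_ifs with h
  · simpa using h
  · simpa using h

open Filter Topology in
theorem eventually_pos_of_inward {e : Module.Basis (Fin (k + 1)) ℝ W} {p M : W}
    (h : inward e p M = 1) : ∀ᶠ ε : ℝ in 𝓝[>] 0, ∀ j, 0 < e.coord j (p + ε • M) := by
  rw [inward_eq_one_iff] at h
  rw [eventually_all]
  intro j
  have hlin : ∀ ε : ℝ, e.coord j (p + ε • M) = e.coord j p + ε * e.coord j M := fun ε => by
    rw [map_add, map_smul, smul_eq_mul]
  simp only [hlin]
  rcases h j with h1 | ⟨h1, h2⟩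
  · refine nhdsWithin_le_nhds ?_
    have : Tendsto (fun ε : ℝ => e.coord j p + ε * e.coord j M) (𝓝 0) (𝓝 (e.coord j p)) := by
      have : Continuous fun ε : ℝ => e.coord j p + ε * e.coord j M := by fun_prop
      simpa using this.tendsto 0
    exact this.eventually (lt_mem_nhds h1)
  · filter_upwards [self_mem_nhdsWithin] with ε hε
    rw [h1, zero_add]
    exact mul_pos hε h2

end Jump

end Voronoi
end

noncomputable section
/-! ### The local count -/

namespace Voronoi

variable {n k : ℕ} {ι : Type}

local notation "SLZ" n => Matrix.SpecialLinearGroup (Fin n) ℤ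

/-- `A ↦ g A ᵗg` as a linear automorphism. -/
def symEquiv (g : SLZ n) : SymMat n ≃ₗ[ℝ] SymMat n :=
  LinearEquiv.ofLinearMap (symAct g) (symAct g⁻¹)
    (LinearMap.ext fun A => symAct_symAct_inv g A) (LinearMap.ext fun A => symAct_inv_symAct g A)

theorem span_toR_of_sym {A : Set (Fin n → ℤ)} {x : Fin n → ℤ}
    (h : sym x ∈ Submodule.span ℝ (sym '' A)) : toR x ∈ Submodule.span ℝ (toR '' A) := by
  by_contra hne
  obtain ⟨f, hfx, hf⟩ := Submodule.exists_le_ker_of_notMem hne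
  have hsum : ∀ x : Fin n → ℝ, f x = ∑ i, f (Pi.single i 1) * x i := by
    intro x
    conv_lhs => rw [pi_eq_sum_univ' x]
    simp [map_sum, mul_comm]
  have h1 : Submodule.span ℝ (sym '' A) ≤ (sqForm fun i => f (Pi.single i 1)).ker := by
    rw [Submodule.span_le]
    rintro _ ⟨z, hz, rfl⟩
    have h2 : f (toR z) = 0 := hf (Submodule.subset_span ⟨z, hz, rfl⟩)
    change sqForm _ (sym z) = 0
    rw [sym_eq, sqForm_symR, ← hsum, h2]
    simp
  have h3 : sqForm (fun i => f (Pi.single i 1)) (sym x) = 0 := h1 h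
  rw [sym_eq, sqForm_symR, ← hsum] at h3
  exact hfx (by simpa using h3)

namespace Dissection

variable {G : Subgroup (SLZ n)} (D : Dissection n k G ι)

/-- The basis given by the vertices of a translate of a cone of a dissection. -/
def cell (q : (SLZ n) × ι) : Module.Basis (Fin (k + 1)) ℝ (SymMat n) :=
  (D.b q.2).map (symEquiv q.1)

theorem cell_apply (q : (SLZ n) × ι) (j : Fin (k + 1)) :
    D.cell q j = sym (q.1 • D.U q.2 j) := by
  rw [cell, Module.Basis.map_apply, D.b_apply]
  exact symAct_sym _ _

theorem mem_minSet_cell (q : (SLZ n) × ι) (j : Fin (k + 1)) :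
    q.1 • D.U q.2 j ∈ minSet (D.φ q.2 ∘ₗ symAct q.1⁻¹) :=
  mem_minSet_comp.2 (by simpa using D.mem q.2 j)

theorem sum_cell (q : (SLZ n) × ι) (y : SymMat n) :
    ∑ j, (D.cell q).coord j y • sym (q.1 • D.U q.2 j) = y := by
  conv_rhs => rw [← (D.cell q).sum_repr y]
  exact Finset.sum_congr rfl fun j _ => by rw [cell_apply]; rfl

theorem cell_eq_of_pos {q q' : (SLZ n) × ι} (hq : q.1 ∈ G) (hq' : q'.1 ∈ G) {y : SymMat n}
    (h : ∀ j, 0 < (D.cell q).coord j y) (h' : ∀ j, 0 < (D.cell q').coord j y) : q = q' := by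
  obtain ⟨h1, h2⟩ := D.disjoint q.2 q'.2 (q.1⁻¹ * q'.1) (G.mul_mem (G.inv_mem hq) hq')
    (symAct q.1⁻¹ y) h (by
      intro j
      rw [← LinearMap.comp_apply, ← symAct_mul, mul_inv_rev, inv_inv, mul_assoc, mul_inv_cancel,
        mul_one]
      exact h' j)
  exact Prod.ext (by rw [← mul_one q.1, ← h2, mul_inv_cancel_left]) h1

/-- Near a positive definite matrix, finitely many translates of the cones of a dissection cover. -/
theorem exists_finite_cover [Finite ι] (hn : 0 < n) {p M : SymMat n} {c : ℝ} (hc : 0 < c)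
    (hp : ∀ φ : Form n, PSD φ → c * tr φ ≤ φ p) :
    ∃ Q : Set ((SLZ n) × ι), Q.Finite ∧ (∀ q ∈ Q, q.1 ∈ G) ∧ ∃ ε₀ > 0, ∀ ε : ℝ, 0 ≤ ε → ε ≤ ε₀ →
      ∃ q ∈ Q, ∀ j, 0 ≤ (D.cell q).coord j (p + ε • M) := by
  set K : ℝ := 2 * ∑ i, ∑ j, |M.1 i j| with hK
  have hK0 : 0 ≤ K := by positivity
  set C : ℝ := (c / 2)⁻¹ * (|sumSq n p| + |sumSq n M|) with hC
  choose! g hgG hg using D.cover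
  refine ⟨(g '' {ψ | Perfect ψ ∧ tr ψ ≤ C}) ×ˢ Set.univ,
    ((finite_perfect n C).image g).prod Set.finite_univ, ?_,
    min 1 (c / (2 * (K + 1))), lt_min one_pos (by positivity), fun ε hε0 hε => ?_⟩
  · rintro ⟨_, i⟩ ⟨⟨ψ, hψ, rfl⟩, -⟩
    exact hgG ψ hψ.1
  · have h1 : ε ≤ 1 := hε.trans (min_le_left _ _)
    have h2 : ε * (2 * (K + 1)) ≤ c :=
      (le_div_iff₀ (by positivity)).1 (hε.trans (min_le_right _ _))
    obtain ⟨ψ, hψ, hmem, htr⟩ := exists_perfect_mem_tile hn (q := p + ε • M) (half_pos hc) (by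
      intro φ hφ
      have e1 := hp φ hφ
      have e2 := hφ.abs_apply_le M
      have e3 := neg_abs_le (φ M)
      have e4 := hφ.tr_nonneg
      rw [← hK] at e2
      rw [map_add, map_smul, smul_eq_mul]
      have e5 : ε * (-(K * tr φ)) ≤ ε * φ M := by
        gcongr
        linarith
      have e6 : (ε * (2 * (K + 1))) * tr φ ≤ c * tr φ := by gcongr
      have e7 : 0 ≤ ε * tr φ := by positivity
      nlinarith)
    have hψC : tr ψ ≤ C := by
      rw [hC, le_inv_mul_iff₀ (half_pos hc)]
      refine htr.trans ?_
      rw [map_add, map_smul, smul_eq_mul]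
      have e1 := le_abs_self (sumSq n p)
      have e2 := le_abs_self (sumSq n M)
      have e3 : ε * sumSq n M ≤ 1 * |sumSq n M| :=
        (mul_le_mul_of_nonneg_left e2 hε0).trans
          (mul_le_mul_of_nonneg_right h1 (abs_nonneg _))
      linarith
    obtain ⟨i, hi⟩ := hg ψ hψ _ hmem
    exact ⟨(g ψ, i), ⟨⟨ψ, ⟨hψ, hψC⟩, rfl⟩, trivial⟩, hi⟩

open Filter Topology in
open scoped Classical in
/-- At a generic point exactly one translate of a cone of a dissection contains the points in a
given direction. -/
theorem sum_inward_eq_one [Finite ι] (hn : 0 < n) {p M : SymMat n} {c : ℝ} (hc : 0 < c)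
    (hp : ∀ φ : Form n, PSD φ → c * tr φ ≤ φ p) {Q : Finset ((SLZ n) × ι)}
    (hQG : ∀ q ∈ Q, q.1 ∈ G)
    (hQ : ∀ q : (SLZ n) × ι, q.1 ∈ G → (∀ j, 0 ≤ (D.cell q).coord j p) → q ∈ Q)
    (hgen : ∀ q ∈ Q, ∀ j, (D.cell q).coord j p = 0 → (D.cell q).coord j M ≠ 0) :
    ∑ q ∈ Q, inward (D.cell q) p M = 1 := by
  obtain ⟨Q', hQ', hQ'G, ε₀, hε₀, hcov⟩ := D.exists_finite_cover hn (M := M) hc hp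
  have hlin : ∀ (q : (SLZ n) × ι) (j : Fin (k + 1)) (ε : ℝ), (D.cell q).coord j (p + ε • M) =
      (D.cell q).coord j p + ε * (D.cell q).coord j M := fun q j ε => by
    rw [map_add, map_smul, smul_eq_mul]
  -- one of the finitely many cells contains `p + ε M` for arbitrarily small `ε`
  obtain ⟨q, hqQ', hq⟩ : ∃ q ∈ Q', ∃ᶠ ε : ℝ in 𝓝[>] 0,
      ∀ j, 0 ≤ (D.cell q).coord j (p + ε • M) := by
    by_contra! hno
    have h1 : ∀ᶠ ε : ℝ in 𝓝[>] 0, ∀ q ∈ Q', ¬ ∀ j, 0 ≤ (D.cell q).coord j (p + ε • M) :=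
      (eventually_all_finite hQ').2 fun q hq => by
        filter_upwards [hno q hq] with ε ⟨j, hj⟩ h
        exact absurd (h j) (not_le.2 hj)
    have h2 : ∀ᶠ ε : ℝ in 𝓝[>] 0, ε ∈ Set.Ioo 0 ε₀ := Ioo_mem_nhdsGT hε₀
    obtain ⟨ε, hε1, hε2⟩ := (h1.and h2).exists
    obtain ⟨q, hq, hq2⟩ := hcov ε hε2.1.le hε2.2.le
    exact hε1 q hq hq2
  have hqp : ∀ j, 0 ≤ (D.cell q).coord j p := by
    intro j
    by_contra! hlt
    have hcont : Continuous fun ε : ℝ => (D.cell q).coord j p + ε * (D.cell q).coord j M := by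
      fun_prop
    have h1 : ∀ᶠ ε : ℝ in 𝓝[>] 0, (D.cell q).coord j (p + ε • M) < 0 := by
      refine nhdsWithin_le_nhds ?_
      simp only [hlin]
      have := hcont.tendsto 0
      simp only [zero_mul, add_zero] at this
      exact this.eventually (gt_mem_nhds hlt)
    obtain ⟨ε, hε1, hε2⟩ := (hq.and_eventually h1).exists
    exact absurd (hε1 j) (not_le.2 hε2)
  have hqG := hQ'G q hqQ'
  have hqQ := hQ q hqG hqp
  have hone : inward (D.cell q) p M = 1 := by
    rw [inward_eq_one_iff]
    intro j
    rcases (hqp j).lt_or_eq with h | h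
    · exact Or.inl h
    · refine Or.inr ⟨h.symm, lt_of_le_of_ne ?_ (hgen q hqQ j h.symm).symm⟩
      obtain ⟨ε, hε1, hε2⟩ := (hq.and_eventually self_mem_nhdsWithin).exists
      have h1 := hε1 j
      rw [hlin, ← h, zero_add] at h1
      exact nonneg_of_mul_nonneg_right h1 hε2
  -- another such cell would have interior points in common with it
  rw [Finset.sum_eq_single q, hone]
  · intro q' hq' hne
    by_contra h0
    have h1 : inward (D.cell q') p M = 1 := by
      unfold inward at h0 ⊢
      split_ifs at h0 ⊢ with h2
      · rfl
      · exact absurd rfl h0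
    obtain ⟨ε, hε1, hε2⟩ :=
      ((eventually_pos_of_inward hone).and (eventually_pos_of_inward h1)).exists
    exact hne (D.cell_eq_of_pos (hQG q' hq') hqG hε2 hε1)
  · exact fun h => absurd hqQ h

/-- Only finitely many translates of cones have a spanning set of minimal vectors in a given finite
set: a translate by `g` is determined by a nonsingular matrix `M` of such vectors, and by the matrix
`g⁻¹ M` of minimal vectors of one of the finitely many original forms. -/
theorem finite_setOf_span [Finite ι] {F : Set (Fin n → ℤ)} (hF : F.Finite) :
    {q : (SLZ n) × ι | Submodule.span ℝ
      (toR '' (F ∩ minSet (D.φ q.2 ∘ₗ symAct q.1⁻¹))) = ⊤}.Finite := by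
  set Q := {q : (SLZ n) × ι | Submodule.span ℝ
      (toR '' (F ∩ minSet (D.φ q.2 ∘ₗ symAct q.1⁻¹))) = ⊤} with hQ
  have h1 : ∀ q : (SLZ n) × ι, ∃ M : Matrix (Fin n) (Fin n) ℤ, q ∈ Q → M.det ≠ 0 ∧ ∀ j,
      M.col j ∈ F ∩ minSet (D.φ q.2 ∘ₗ symAct q.1⁻¹) := fun q => by
    by_cases hq : q ∈ Q
    · obtain ⟨M, hM⟩ := exists_det_ne_zero hq
      exact ⟨M, fun _ => hM⟩
    · exact ⟨0, fun h => absurd h hq⟩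
  choose M hM using h1
  have hfin : ∀ B : Set (Fin n → ℤ), B.Finite →
      {M : Matrix (Fin n) (Fin n) ℤ | ∀ j, M.col j ∈ B}.Finite := fun B hB => by
    refine Set.Finite.of_injOn (f := fun M : Matrix (Fin n) (Fin n) ℤ => M.col)
      (t := {f : Fin n → Fin n → ℤ | ∀ j, f j ∈ B}) (fun M hM => hM) (fun M _ M' _ h => ?_)
      (Set.Finite.pi' fun _ => hB)
    ext i j
    exact congrFun (congrFun h j) i
  refine Set.Finite.of_injOn (f := fun q => (q.2, M q, q.1⁻¹.1 * M q))
    (t := ⋃ i : ι, {i} ×ˢ ({M | ∀ j, M.col j ∈ F} ×ˢ {M | ∀ j, M.col j ∈ minSet (D.φ i)}))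
    (fun q hq => Set.mem_iUnion.2 ⟨q.2, rfl, fun j => ((hM q hq).2 j).1,
      fun j => mem_minSet_comp.1 ((hM q hq).2 j).2⟩) (fun q hq q' hq' h => ?_)
    (Set.finite_iUnion fun i => (Set.finite_singleton i).prod
      ((hfin F hF).prod (hfin _ (D.ryshkov i).finite_minSet)))
  have e1 : q.2 = q'.2 := congrArg Prod.fst h
  have e2 : M q = M q' := congrArg (fun z => z.2.1) h
  have e3 : q.1⁻¹.1 * M q = q'.1⁻¹.1 * M q' := congrArg (fun z => z.2.2) h
  rw [← e2] at e3
  refine Prod.ext (inv_injective (Subtype.ext ?_)) e1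
  have h2 := congrArg (· * (M q).adjugate) e3
  simp only [Matrix.mul_assoc, Matrix.mul_adjugate, Matrix.mul_smul, Matrix.mul_one] at h2
  exact smul_right_injective _ (hM q hq).1 h2

end Dissection

end Voronoi
end

noncomputable section
/-! ### The relation between the walls of a dissection in a hyperplane -/

namespace Voronoi

variable {n k : ℕ} {ι : Type}

local notation "SLZ" n => Matrix.SpecialLinearGroup (Fin n) ℤ

namespace Dissection

variable {G : Subgroup (SLZ n)} (D : Dissection n k G ι)

/-- The wall of a translate of a cone opposite to a vertex. -/
def wall (q : (SLZ n) × ι) (j : Fin (k + 1)) : Fin k → Fin n → ℤ :=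
  fun a => q.1 • D.U q.2 (j.succAbove a)

theorem det_cell_pos (hdet : ∀ g : SLZ n, 0 < LinearMap.det (symAct g)) (i : ι)
    (q : (SLZ n) × ι) : 0 < (D.b i).det (D.cell q) := by
  have h : ⇑(D.cell q) = symAct q.1 ∘ D.b q.2 := by
    funext j
    rw [cell, Module.Basis.map_apply]
    rfl
  rw [h, Module.Basis.det_comp]
  exact mul_pos (hdet _) (D.orient i q.2)

/-- A wall contained in a spanning subset of a hyperplane is spanning. -/
theorem span_wall {q : (SLZ n) × ι} {j : Fin (k + 1)} {ν : Form n} (hν : ν ≠ 0)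
    {F : Set (Fin n → ℤ)} (hF : Submodule.span ℝ (toR '' F) = ⊤) (hFν : ∀ x ∈ F, ν (sym x) = 0)
    (hw : ∀ a, D.wall q j a ∈ F) :
    Submodule.span ℝ (Set.range fun a => toR (D.wall q j a)) = ⊤ := by
  have h1 : ν (D.cell q j) • (D.cell q).coord j = ν := by
    refine (D.cell q).ext fun i => ?_
    by_cases hij : i = j
    · subst hij; simp
    · obtain ⟨a, rfl⟩ := Fin.exists_succAbove_eq hij
      rw [D.cell_apply q (j.succAbove a)]
      have h2 : ν (sym (q.1 • D.U q.2 (j.succAbove a))) = 0 := hFν _ (hw a)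
      rw [h2, ← D.cell_apply]
      simp
  have h2 : ν (D.cell q j) ≠ 0 := fun h0 => hν (by rw [← h1, h0, zero_smul])
  rw [eq_top_iff, ← hF, Submodule.span_le]
  rintro _ ⟨x, hx, rfl⟩
  have h3 : (D.cell q).coord j (sym x) = 0 := by
    have h4 := LinearMap.congr_fun h1 (sym x)
    rw [hFν x hx, LinearMap.smul_apply, smul_eq_mul] at h4
    exact (mul_eq_zero.1 h4).resolve_left h2
  have h4 : sym x ∈ Submodule.span ℝ (sym '' Set.range (D.wall q j)) := by
    rw [← D.sum_cell q (sym x), Fin.sum_univ_succAbove _ j, h3, zero_smul, zero_add]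
    exact sum_mem fun a _ => Submodule.smul_mem _ _
      (Submodule.subset_span ⟨_, ⟨a, rfl⟩, rfl⟩)
  have h5 := span_toR_of_sym h4
  rwa [← Set.range_comp] at h5

theorem exists_pos_le {α : Type*} [Fintype α] {t : α → ℝ} (ht : ∀ a, 0 < t a) :
    ∃ m > 0, ∀ a, m ≤ t a := by
  rcases isEmpty_or_nonempty α with h | h
  · exact ⟨1, one_pos, fun a => isEmptyElim a⟩
  · obtain ⟨a, ha⟩ := Finite.exists_min t
    exact ⟨t a, ht a, ha⟩

open VolumeForm

open scoped Classical in
/-- The signed number of the walls, in the flat `F` of a hyperplane, which contain a generic point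
of the hyperplane is zero: it is the jump across the hyperplane of the number of translates of the
cones that contain a point, and this number is one. -/
theorem exists_sum_signedCone_eq_zero [Fintype ι] (hn : 0 < n)
    (hdet : ∀ g : SLZ n, 0 < LinearMap.det (symAct g)) (i₀ : ι) {φ₀ ν : Form n}
    (hφ₀ : Ryshkov φ₀) {N : SymMat n} (hν : ν N = 1) {F : Set (Fin n → ℤ)}
    (hF : F = {x | x ∈ minSet φ₀ ∧ ν (sym x) = 0})
    (hFspan : Submodule.span ℝ (toR '' F) = ⊤) :
    ∃ Q : Finset ((SLZ n) × ι), (∀ q ∈ Q, q.1 ∈ G) ∧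
      (∀ q : (SLZ n) × ι, q.1 ∈ G → ∀ j, (∀ a, D.wall q j a ∈ F) → q ∈ Q) ∧
      ∃ H : Finset (Form n), (∀ ψ ∈ H, ψ ≠ 0) ∧ ∀ y, (∀ ψ ∈ H, ψ y ≠ 0) →
        ∑ q ∈ Q, ∑ j : Fin (k + 1), (if ∀ a, D.wall q j a ∈ F then (-1 : ℝ) ^ (j : ℕ) *
          signedCone (D.b i₀) sym N y (List.ofFn (D.wall q j)) else 0) = 0 := by
  have hν0 : ν ≠ 0 := by
    rintro rfl
    simp at hν
  have hFν : ∀ x ∈ F, ν (sym x) = 0 := fun x hx => by rw [hF] at hx; exact hx.2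
  have hFφ : ∀ x ∈ F, x ∈ minSet φ₀ := fun x hx => by rw [hF] at hx; exact hx.1
  have hFfin : F.Finite := hφ₀.finite_minSet.subset hFφ
  have hQfin : {q : (SLZ n) × ι | q.1 ∈ G ∧ Submodule.span ℝ
      (toR '' (F ∩ minSet (D.φ q.2 ∘ₗ symAct q.1⁻¹))) = ⊤}.Finite :=
    (D.finite_setOf_span hFfin).subset fun q hq => hq.2
  set Q := hQfin.toFinset with hQ
  have hmemQ : ∀ q : (SLZ n) × ι, q ∈ Q ↔ q.1 ∈ G ∧ Submodule.span ℝ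
      (toR '' (F ∩ minSet (D.φ q.2 ∘ₗ symAct q.1⁻¹))) = ⊤ := fun q => hQfin.mem_toFinset
  -- walls in the flat, and all cells which have enough of their minimal vectors in common with
  -- such a wall
  have hmem : ∀ (q q' : (SLZ n) × ι) (j : Fin (k + 1)), q'.1 ∈ G → (∀ a, D.wall q j a ∈ F) →
      (∀ a, D.wall q j a ∈ minSet (D.φ q'.2 ∘ₗ symAct q'.1⁻¹)) → q' ∈ Q := by
    intro q q' j hq' hw hw'
    refine (hmemQ q').2 ⟨hq', ?_⟩
    rw [eq_top_iff, ← D.span_wall hν0 hFspan hFν hw]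
    refine Submodule.span_mono ?_
    rintro _ ⟨a, rfl⟩
    exact ⟨_, ⟨hw a, hw' a⟩, rfl⟩
  refine ⟨Q, fun q hq => ((hmemQ q).1 hq).1,
    fun q hq j hw => hmem q q j hq hw fun a => D.mem_minSet_cell q _, ?_⟩
  -- the generic points are those whose projection `π y` to the hyperplane, along `N`, is on no wall
  -- of a cell in `Q`, unless the wall is in the hyperplane
  set π : SymMat n →ₗ[ℝ] SymMat n := LinearMap.id - ν.smulRight N with hπ
  have hπy : ∀ y, π y = y - ν y • N := fun y => rfl
  have hπν : ∀ z, ν z = 0 → π z = z := fun z hz => by rw [hπy, hz, zero_smul, sub_zero]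
  refine ⟨((Q ×ˢ (Finset.univ : Finset (Fin (k + 1)))).image
    fun z => (D.cell z.1).coord z.2 ∘ₗ π).filter fun ψ => ψ ≠ 0,
    fun ψ hψ => (Finset.mem_filter.1 hψ).2, fun y hy => ?_⟩
  set p := π y with hp
  have hνp : ν p = 0 := by rw [hp, hπy, map_sub, map_smul, hν]; simp
  have hyp : y = ν y • N + p := by rw [hp, hπy]; abel
  have hgen : ∀ q ∈ Q, ∀ j, (D.cell q).coord j p = 0 → ∀ z, ν z = 0 →
      (D.cell q).coord j z = 0 := by
    intro q hq j h0 z hz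
    by_contra hne
    refine hy ((D.cell q).coord j ∘ₗ π) (Finset.mem_filter.2 ⟨Finset.mem_image.2
      ⟨(q, j), Finset.mem_product.2 ⟨hq, Finset.mem_univ _⟩, rfl⟩, fun h1 => hne ?_⟩) h0
    have := LinearMap.congr_fun h1 z
    rwa [LinearMap.comp_apply, hπν z hz] at this
  have hgen' : ∀ q ∈ Q, ∀ j, (D.cell q).coord j p = 0 → ∀ z,
      (D.cell q).coord j z = ν z * (D.cell q).coord j N := by
    intro q hq j h0 z
    have := hgen q hq j h0 (z - ν z • N) (by simp [hν])
    rw [map_sub, map_smul, smul_eq_mul] at this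
    linarith
  have hgenN : ∀ q ∈ Q, ∀ j, (D.cell q).coord j p = 0 → (D.cell q).coord j N ≠ 0 := by
    intro q hq j h0 h1
    have := hgen' q hq j h0 (D.cell q j)
    rw [h1, mul_zero] at this
    simp at this
  have hC1 : ∀ q j, (∀ a, D.wall q j a ∈ F) → ∀ a, ν (D.cell q (j.succAbove a)) = 0 := by
    intro q j hw a
    rw [D.cell_apply]
    exact hFν _ (hw a)
  have hsc : ∀ q j, signedCone (D.b i₀) sym N y (List.ofFn (D.wall q j)) =
      (if ∃ (a : ℝ) (t : Fin k → ℝ), (∀ i, 0 < t i) ∧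
          y = a • N + ∑ i, t i • D.cell q (j.succAbove i)
        then ((SignType.sign ((D.b i₀).det (Fin.cons N fun a => D.cell q (j.succAbove a))) :
          SignType) : ℝ) else 0) := by
    intro q j
    have e1 : sym ∘ D.wall q j = fun a => D.cell q (j.succAbove a) :=
      funext fun a => (D.cell_apply q _).symm
    rw [signedCone_ofFn, relDet_ofFn, e1]
    refine if_congr (exists_congr fun a => exists_congr fun t => and_congr_right fun _ => ?_)
      rfl rfl
    have e2 : ∑ i, t i • sym (D.wall q j i) = ∑ i, t i • D.cell q (j.succAbove i) :=
      Finset.sum_congr rfl fun i _ => congrArg (t i • ·) (congrFun e1 i)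
    rw [e2]
  -- Unless the projection `p` is in some wall, all terms are zero. If it is, then all cells
  -- that contain `p` are in `Q`, and `p` is positive definite.
  by_cases hex : ∃ (q₀ : (SLZ n) × ι) (j₀ : Fin (k + 1)), (∀ a, D.wall q₀ j₀ a ∈ F) ∧
      (D.cell q₀).coord j₀ p = 0 ∧ ∀ a, 0 < (D.cell q₀).coord (j₀.succAbove a) p
  · obtain ⟨q₀, j₀, hw₀, hj₀, hpos₀⟩ := hex
    set t : Fin k → ℝ := fun a => (D.cell q₀).coord (j₀.succAbove a) p with ht
    have hpt : ∑ a, t a • sym (D.wall q₀ j₀ a) = p := by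
      conv_rhs => rw [← D.sum_cell q₀ p, Fin.sum_univ_succAbove _ j₀, hj₀, zero_smul, zero_add]
      rfl
    obtain ⟨m, hm, hmt⟩ := exists_pos_le hpos₀
    obtain ⟨c, hc, hctr⟩ := exists_tr_le _ (D.span_wall hν0 hFspan hFν hw₀)
    have hptr : ∀ φ : Form n, PSD φ → (m * c) * tr φ ≤ φ p := by
      intro φ hφ
      rw [← hpt, map_sum, mul_assoc]
      refine (mul_le_mul_of_nonneg_left (hctr φ hφ) hm.le).trans ?_
      rw [Finset.mul_sum]
      refine Finset.sum_le_sum fun a _ => ?_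
      rw [map_smul, smul_eq_mul, sym_eq]
      exact mul_le_mul_of_nonneg_right (hmt a) (hφ _)
    have hQcell : ∀ q : (SLZ n) × ι, q.1 ∈ G → (∀ j, 0 ≤ (D.cell q).coord j p) → q ∈ Q := by
      intro q hq hqp
      refine hmem q₀ q j₀ hq hw₀ fun a => ?_
      exact mem_minSet_of_sum_eq hφ₀ ((D.ryshkov q.2).comp q.1⁻¹) (fun a => hFφ _ (hw₀ a))
        (fun a => (hpos₀ a).le) (D.mem_minSet_cell q) hqp (hpt.trans (D.sum_cell q p).symm)
        (hpos₀ a)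
    have hC2 : ∀ q ∈ Q, ∀ j, (D.cell q).coord j p = 0 →
        (∀ a, 0 < (D.cell q).coord (j.succAbove a) p) → ∀ a, D.wall q j a ∈ F := by
      intro q hq j h0 h1 a
      have h2 : ∀ i, 0 ≤ (D.cell q).coord i p := by
        intro i
        by_cases hij : i = j
        · rw [hij, h0]
        · obtain ⟨a, rfl⟩ := Fin.exists_succAbove_eq hij
          exact (h1 a).le
      rw [hF]
      refine ⟨?_, ?_⟩
      · exact mem_minSet_of_sum_eq ((D.ryshkov q.2).comp q.1⁻¹) hφ₀ (D.mem_minSet_cell q) h2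
          (fun a => hFφ _ (hw₀ a)) (fun a => (hpos₀ a).le) ((D.sum_cell q p).trans hpt.symm)
          (h1 a)
      · have h3 := hgen' q hq j h0 (D.cell q (j.succAbove a))
        have h4 : (D.cell q).coord j (D.cell q (j.succAbove a)) = 0 := by simp
        rw [h4, eq_comm, D.cell_apply] at h3
        exact (mul_eq_zero.1 h3).resolve_right (hgenN q hq j h0)
    have hsum : ∀ q ∈ Q, ∑ j : Fin (k + 1), (if ∀ a, D.wall q j a ∈ F then (-1 : ℝ) ^ (j : ℕ) *
        signedCone (D.b i₀) sym N y (List.ofFn (D.wall q j)) else 0) =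
        inward (D.cell q) p N - inward (D.cell q) p (-N) := by
      intro q hq
      rw [← sum_signedCone_eq_inward_sub (D.b i₀) (D.cell q) (D.det_cell_pos hdet i₀ q) hν hνp hyp
        (hgen q hq) (C := fun j => ∀ a, D.wall q j a ∈ F) (hC1 q) (hC2 q hq)]
      refine Finset.sum_congr rfl fun j _ => ?_
      rw [hsc]
      by_cases hw : ∀ a, D.wall q j a ∈ F
      · rw [if_pos hw, if_pos hw]
      · rw [if_neg hw, if_neg hw]
    have hG : ∀ q ∈ Q, q.1 ∈ G := fun q hq => ((hmemQ q).1 hq).1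
    rw [Finset.sum_congr rfl hsum, Finset.sum_sub_distrib,
      D.sum_inward_eq_one hn (mul_pos hm hc) hptr hG hQcell hgenN,
      D.sum_inward_eq_one hn (mul_pos hm hc) hptr hG hQcell
        (fun q hq j h0 => by rw [map_neg]; exact neg_ne_zero.2 (hgenN q hq j h0)), sub_self]
  · refine Finset.sum_eq_zero fun q _ => Finset.sum_eq_zero fun j _ => ?_
    split_ifs with hw
    · rw [hsc, if_neg, mul_zero]
      exact fun h => hex ⟨q, j, hw, coord_of_mem_open_wall _ hν hνp hyp (hC1 q j hw) h⟩
    · rfl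

end Dissection

end Voronoi
end

noncomputable section
/-! ### The action of `SL_n` preserves the orientation -/

namespace Voronoi

variable {n : ℕ}

/-- The linear map `A ↦ M A ᵗM` of `Y`, for a real matrix `M`. -/
def realAct (M : Matrix (Fin n) (Fin n) ℝ) : SymMat n →ₗ[ℝ] SymMat n where
  toFun A := ⟨M * A.1 * M.transpose, by
    change Matrix.transpose _ = _
    have hA : A.1.transpose = A.1 := A.2
    simp [Matrix.transpose_mul, hA, Matrix.mul_assoc]⟩
  map_add' A B := Subtype.ext (by simp [Matrix.mul_add, Matrix.add_mul])
  map_smul' c A := Subtype.ext (by simp)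

theorem det_realAct_mul (M M' : Matrix (Fin n) (Fin n) ℝ) :
    LinearMap.det (realAct (M * M')) = LinearMap.det (realAct M) * LinearMap.det (realAct M') := by
  rw [← LinearMap.det_comp]
  congr 1
  refine LinearMap.ext fun A => Subtype.ext ?_
  change M * M' * A.1 * (M * M').transpose = M * (M' * A.1 * M'.transpose) * M.transpose
  rw [Matrix.transpose_mul]
  simp only [Matrix.mul_assoc]

theorem det_realAct_one : LinearMap.det (realAct (1 : Matrix (Fin n) (Fin n) ℝ)) = 1 := by
  have : realAct (1 : Matrix (Fin n) (Fin n) ℝ) = LinearMap.id :=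
    LinearMap.ext fun A => Subtype.ext (by change 1 * A.1 * Matrix.transpose 1 = A.1; simp)
  rw [this, LinearMap.det_id]

/-- A transvection is a square. -/
theorem det_realAct_transvection_pos {i j : Fin n} (hij : i ≠ j) (a : ℝ) :
    0 < LinearMap.det (realAct (Matrix.transvection i j a)) := by
  have h1 : ∀ a : ℝ, LinearMap.det (realAct (Matrix.transvection i j a)) ≠ 0 := fun a h0 => by
    have h2 := det_realAct_mul (Matrix.transvection i j a) (Matrix.transvection i j (-a))
    rw [Matrix.transvection_mul_transvection_same _ _ hij, add_neg_cancel, Matrix.transvection_zero,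
      det_realAct_one, h0, zero_mul] at h2
    exact one_ne_zero h2
  have h2 := det_realAct_mul (Matrix.transvection i j (a / 2)) (Matrix.transvection i j (a / 2))
  rw [Matrix.transvection_mul_transvection_same _ _ hij, add_halves] at h2
  rw [h2]
  exact mul_self_pos.2 (h1 _)

/-- A diagonal matrix with entries `c` and `c⁻¹` is a product of transvections. -/
theorem diagonal_eq_transvections {A : Type*} [Ring A] [Algebra ℝ A] {x y : A} (hx : x * x = 0)
    (hy : y * y = 0) (hxy : x * y * x = x) (hyx : y * x * y = y) {c : ℝ} (hc : c ≠ 0) :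
    (1 + c • x) * (1 + (-c⁻¹) • y) * (1 + (c - 1) • x) * (1 + (1 : ℝ) • y) * (1 + (-1 : ℝ) • x) =
      1 + (c - 1) • (x * y) + (c⁻¹ - 1) • (y * x) := by
  have e1 : (1 + c • x) * (1 + (-c⁻¹) • y) = 1 + c • x - c⁻¹ • y - x * y := by
    simp only [add_mul, mul_add, one_mul, mul_one, smul_mul_assoc, mul_smul_comm]
    match_scalars <;> field_simp
  have e2 : (1 + c • x - c⁻¹ • y - x * y) * (1 + (c - 1) • x) =
      1 + c • x - c⁻¹ • y - x * y - (1 - c⁻¹) • (y * x) := by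
    simp only [add_mul, sub_mul, mul_add, one_mul, mul_one, smul_mul_assoc, mul_smul_comm,
      hx, hxy, smul_zero]
    match_scalars <;> field_simp
    ring
  have e3 : (1 + c • x - c⁻¹ • y - x * y - (1 - c⁻¹) • (y * x)) * (1 + (1 : ℝ) • y) =
      1 + c • x + (c - 1) • (x * y) + (c⁻¹ - 1) • (y * x) := by
    have h0 : x * y * y = 0 := by rw [mul_assoc, hy, mul_zero]
    simp only [add_mul, sub_mul, mul_add, one_mul, mul_one, smul_mul_assoc, one_smul,
      hy, hyx, h0, smul_zero]
    module
  have e4 : (1 + c • x + (c - 1) • (x * y) + (c⁻¹ - 1) • (y * x)) * (1 + (-1 : ℝ) • x) =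
      1 + (c - 1) • (x * y) + (c⁻¹ - 1) • (y * x) := by
    have h0 : y * x * x = 0 := by rw [mul_assoc, hx, mul_zero]
    simp only [add_mul, mul_add, one_mul, mul_one, smul_mul_assoc, mul_smul_comm,
      hx, hxy, h0, smul_zero]
    module
  rw [e1, e2, e3, e4]

/-- `SL_n(ℝ)` is generated by transvections, which are squares of transvections. -/
theorem det_realAct_pos (hn : 2 ≤ n) (M : Matrix.SpecialLinearGroup (Fin n) ℝ) :
    0 < LinearMap.det (realAct M.1) := by
  have : Nontrivial (Fin n) := Fin.nontrivial_iff_two_le.2 hn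
  refine Matrix.SpecialLinearGroup.diagonal_transvection_induction'
    (fun M => 0 < LinearMap.det (realAct M.1)) M (fun i j hij c hc => ?_)
    (fun i j hij a => det_realAct_transvection_pos hij a) fun A B hA hB => ?_
  · have h1 := diagonal_eq_transvections (x := Matrix.single i j (1 : ℝ))
      (y := Matrix.single j i 1) (by simp [hij.symm]) (by simp [hij]) (by simp) (by simp) hc
    have h2 : (Matrix.SpecialLinearGroup.diag2n hij c hc).1 = Matrix.transvection i j c *
        Matrix.transvection j i (-c⁻¹) * Matrix.transvection i j (c - 1) *
        Matrix.transvection j i 1 * Matrix.transvection i j (-1) := by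
      have h3 : ∀ (i j : Fin n) (a : ℝ), Matrix.transvection i j a =
          1 + a • Matrix.single i j (1 : ℝ) := fun i j a => by
        rw [Matrix.transvection, Matrix.smul_single, smul_eq_mul, mul_one]
      rw [h3, h3, h3, h3, h3, h1, Matrix.SpecialLinearGroup.diag2n_coe]
      ext a b
      by_cases hab : a = b
      · subst hab
        by_cases hai : a = i
        · subst hai; simp [hij.symm]
        · by_cases haj : a = j
          · subst haj; simp [hai, Ne.symm hai]
          · simp [hai, haj, Ne.symm hai, Ne.symm haj]
      · have e1 : ¬ (i = a ∧ i = b) := fun h => hab (h.1.symm.trans h.2)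
        have e2 : ¬ (j = a ∧ j = b) := fun h => hab (h.1.symm.trans h.2)
        simp [hab, e1, e2]
    change 0 < LinearMap.det (realAct (Matrix.SpecialLinearGroup.diag2n hij c hc).1)
    rw [h2]
    simp only [det_realAct_mul]
    have p1 := fun a => det_realAct_transvection_pos hij a
    have p2 := fun a => det_realAct_transvection_pos hij.symm a
    exact mul_pos (mul_pos (mul_pos (mul_pos (p1 _) (p2 _)) (p1 _)) (p2 _)) (p1 _)
  · change 0 < LinearMap.det (realAct (A.1 * B.1))
    rw [det_realAct_mul]
    exact mul_pos hA hB

theorem det_symAct_pos (hn : 2 ≤ n) (g : Matrix.SpecialLinearGroup (Fin n) ℤ) :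
    0 < LinearMap.det (symAct g) :=
  det_realAct_pos hn (Matrix.SpecialLinearGroup.map (Int.castRingHom ℝ) g)

end Voronoi
end

noncomputable section
/-! ### The flats spanned by vectors -/

namespace FlatSystem

open Ch

variable {X W : Type*} [AddCommGroup W] [Module ℝ W]

/-- The subspace spanned by the vectors that label a tuple. -/
def lspan (u : X → W) (l : List X) : Submodule ℝ W := Submodule.span ℝ (u '' {x | x ∈ l})

theorem mem_lspan (u : X → W) {l : List X} {x : X} (h : x ∈ l) : u x ∈ lspan u l :=
  Submodule.subset_span ⟨x, h, rfl⟩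

theorem lspan_le {u : X → W} {l : List X} {E : Submodule ℝ W} (h : ∀ x ∈ l, u x ∈ E) :
    lspan u l ≤ E := by
  refine Submodule.span_le.2 ?_
  rintro _ ⟨x, hx, rfl⟩
  exact h x hx

theorem lspan_mono (u : X → W) {l l' : List X} (h : ∀ x ∈ l', x ∈ l) :
    lspan u l' ≤ lspan u l :=
  lspan_le fun x hx => mem_lspan u (h x hx)

theorem lspan_ofFn (u : X → W) {m : ℕ} (z : Fin m → X) :
    lspan u (List.ofFn z) = Submodule.span ℝ (Set.range fun i => u (z i)) := by
  rw [lspan]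
  congr 1
  ext A
  simp [List.mem_ofFn]

variable [FiniteDimensional ℝ W]

/-- The flats in a set `V` of labels of vectors: the intersections of `V` with linear subspaces.
No tuple is neglected. -/
def linear (u : X → W) (V : Set X) : FlatSystem X where
  N _ := False
  κ l := {x | x ∈ V ∧ u x ∈ lspan u l}
  r l := Module.finrank ℝ (lspan u l)
  A l := ∀ x ∈ l, x ∈ V
  N_sub _ _ h _ := h
  subset l hl x hx := ⟨hl x hx, mem_lspan u hx⟩
  closed l l' _ hl' := by
    have h1 : lspan u l' ≤ lspan u l := lspan_le fun x hx => (hl' x hx).2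
    refine ⟨fun x hx => (hl' x hx).1, fun x hx => ⟨hx.1, h1 hx.2⟩,
      Submodule.finrank_mono h1, fun h => ?_⟩
    rw [Submodule.eq_of_le_of_finrank_eq h1 h]
  congr l l' hl hl' h := by
    have key : ∀ {l l' : List X}, (∀ x ∈ l, x ∈ V) →
        {x | x ∈ V ∧ u x ∈ lspan u l} = {x | x ∈ V ∧ u x ∈ lspan u l'} →
        lspan u l ≤ lspan u l' := fun hl h =>
      lspan_le fun x hx => ((Set.ext_iff.1 h x).1 ⟨hl x hx, mem_lspan u hx⟩).2
    rw [le_antisymm (key hl h) (key hl' h.symm)]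
    exact ⟨rfl, Iff.rfl⟩
  acyclic l _ _ K hK c hc hbd := by
    have hbd0 : bd c = 0 := by
      ext l
      by_contra h
      exact mem_on.1 hbd l h
    -- a cycle bounds the cone over it from any label of the flat
    by_cases hne : ∃ x, x ∈ V ∧ u x ∈ lspan u l
    · obtain ⟨x, hx⟩ := hne
      refine ⟨cone x c, cone_mem_on (fun l' hl' => ⟨by simp [hl'.1], fun y hy => ?_⟩) hc, ?_⟩
      · rw [bd_cone, hbd0, map_zero, sub_zero, sub_self]
        exact zero_mem _
      · exact (List.mem_cons.1 hy).elim (fun h => h ▸ hx) (hl'.2 y)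
    · have : c = 0 := by
        ext l'
        by_contra h
        obtain ⟨h1, h2⟩ := mem_on.1 hc l' h
        obtain ⟨x, hx⟩ := List.exists_mem_of_length_pos (l := l') (by omega)
        exact hne ⟨x, h2 x hx⟩
      exact ⟨0, zero_mem _, by simp [this]⟩

/-- Chains of spanning tuples of vectors from a set `V`, modulo nonspanning ones, have no homology
in lengths above the dimension. -/
theorem exists_sub_bd_mem_on_finrank_lt (u : X → W) (V : Set X) {K : ℕ}
    (hK : Module.finrank ℝ W < K) {c : Ch X}
    (hc : c ∈ on (fun l => l.length = K ∧ ∀ x ∈ l, x ∈ V))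
    (hbd : bd c ∈ on (fun l => lspan u l ≠ ⊤)) :
    ∃ a ∈ on (fun l => l.length = K + 1 ∧ ∀ x ∈ l, x ∈ V),
      c - bd a ∈ on (fun l => lspan u l ≠ ⊤) := by
  have hlt : ∀ l, lspan u l ≠ ⊤ → Module.finrank ℝ (lspan u l) < Module.finrank ℝ W :=
    fun l hl => Submodule.finrank_lt hl
  have h1 : bd c ∈ on (fun l => l.length = K - 1 ∧ ∀ x ∈ l, x ∈ V) :=
    bd_mem_on (fun l l' hl hs hlen => ⟨by omega, fun x hx => hl.2 x (hs.subset hx)⟩) hc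
  obtain ⟨a', ha', he⟩ := exists_normal_eq_normal_bd (Module.finrank ℝ W) (linear u V) id
    (isNormalForm_id _) (K - 1) (by omega) (bd c)
    (mem_on.2 fun l hl => ⟨(mem_on.1 h1 l hl).2, (mem_on.1 h1 l hl).1, hlt l (mem_on.1 hbd l hl)⟩)
    (by rw [bd_bd, map_zero])
  have h2 : bd c = bd a' := by
    have := (linear u V).normal_id_eq_zero (c := bd c - bd a') (by rw [map_sub, he, sub_self])
    ext l
    by_contra h
    exact mem_on.1 this l (by simpa [sub_eq_zero] using h)
  -- `c - a'` is a cycle, hence the boundary of a cone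
  by_cases hV : ∃ x, x ∈ V
  · obtain ⟨x, hx⟩ := hV
    have h3 : c - a' ∈ on (fun l => l.length = K ∧ ∀ x ∈ l, x ∈ V) :=
      sub_mem hc (on_mono (fun l hl => ⟨by have := hl.2.1; omega, hl.1⟩) ha')
    refine ⟨cone x (c - a'), cone_mem_on (fun l hl => ⟨by simp [hl.1], fun y hy => ?_⟩) h3, ?_⟩
    · rw [bd_cone, map_sub bd, h2, sub_self, map_zero, sub_zero, sub_sub_cancel]
      exact on_mono (fun l hl h => by
        have h3 : Module.finrank ℝ (lspan u l) < Module.finrank ℝ W := hl.2.2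
        rw [h, finrank_top] at h3
        exact lt_irrefl _ h3) ha'
    · exact (List.mem_cons.1 hy).elim (fun h => h ▸ hx) (hl.2 y)
  · have : c = 0 := by
      ext l'
      by_contra h
      obtain ⟨h1, h2⟩ := mem_on.1 hc l' h
      obtain ⟨x, hx⟩ := List.exists_mem_of_length_pos (l := l') (by omega)
      exact hV ⟨x, h2 x hx⟩
    exact ⟨0, zero_mem _, by simp [this]⟩

end FlatSystem

/-! ### Normal forms for a free group action on flats -/

namespace Ch

variable {X : Type*}

/-- The map of chains induced by a map of labels. -/
def mapCh (f : X → X) : Ch X →ₗ[ℤ] Ch X := Finsupp.lmapDomain ℤ ℤ (List.map f)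

theorem mapCh_single (f : X → X) (l : List X) (a : ℤ) :
    mapCh f (Finsupp.single l a) = Finsupp.single (l.map f) a := by
  simp [mapCh]

theorem bd_mapCh (f : X → X) (c : Ch X) : bd (mapCh f c) = mapCh f (bd c) := by
  have hcone : ∀ (x : X) (c : Ch X), mapCh f (cone x c) = cone (f x) (mapCh f c) := by
    intro x c
    induction c using Finsupp.induction_linear with
    | zero => simp
    | add a b ha hb => simp only [map_add, ha, hb]
    | single l a => simp only [mapCh_single, cone_single, List.map_cons]
  have hl : ∀ l : List X, bdList (l.map f) = mapCh f (bdList l) := by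
    intro l
    induction l with
    | nil => simp [bdList]
    | cons x l ih => rw [List.map_cons, bdList, bdList, map_sub, mapCh_single, hcone, ih]
  induction c using Finsupp.induction_linear with
  | zero => simp
  | add a b ha hb => simp only [map_add, ha, hb]
  | single l a => rw [mapCh_single, bd_single, bd_single, map_smul, hl]

end Ch

namespace FlatSystem

open Ch
open scoped Pointwise

variable {X Γ : Type*} [Group Γ] [MulAction Γ X]

/-- The system of flats is invariant under a group of permutations of the labels, and a group
element which maps a flat that is not neglected to itself fixes all its elements. -/
structure IsFree (F : FlatSystem X) (Γ : Type*) [Group Γ] [MulAction Γ X] : Prop where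
  A_map : ∀ (g : Γ) l, F.A l → F.A (l.map (g • ·))
  N_map : ∀ (g : Γ) l, F.A l → (F.N (l.map (g • ·)) ↔ F.N l)
  r_map : ∀ (g : Γ) l, F.A l → F.r (l.map (g • ·)) = F.r l
  κ_map : ∀ (g : Γ) l, F.A l → F.κ (l.map (g • ·)) = g • F.κ l
  free : ∀ (g : Γ) l, F.A l → ¬ F.N l → g • F.κ l = F.κ l → ∀ x ∈ F.κ l, g • x = x

variable (Γ) in
/-- The selected representative of the orbit of a set of labels. -/
def orbitRep (E : Set X) : Set X := (Quotient.mk (MulAction.orbitRel Γ (Set X)) E).out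

theorem exists_smul_eq_orbitRep (E : Set X) : ∃ g : Γ, g • E = orbitRep Γ E := by
  have h : (MulAction.orbitRel Γ (Set X)) (orbitRep Γ E) E := Quotient.mk_out E
  exact MulAction.orbitRel_apply.1 h

theorem orbitRep_smul (g : Γ) (E : Set X) : orbitRep Γ (g • E) = orbitRep Γ E := by
  unfold orbitRep
  congr 1
  exact Quotient.sound (s := MulAction.orbitRel Γ (Set X))
    (MulAction.orbitRel_apply.2 ⟨g, rfl⟩)

theorem orbitRep_orbitRep (E : Set X) : orbitRep Γ (orbitRep Γ E) = orbitRep Γ E := by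
  obtain ⟨g, hg⟩ := exists_smul_eq_orbitRep (Γ := Γ) E
  rw [← hg, orbitRep_smul, hg]

variable (Γ) in
/-- A group element that moves a set of labels to the selected representative of its orbit. -/
def toRep (E : Set X) : Γ := (exists_smul_eq_orbitRep (Γ := Γ) E).choose

theorem toRep_smul (E : Set X) : toRep Γ E • E = orbitRep Γ E :=
  (exists_smul_eq_orbitRep (Γ := Γ) E).choose_spec

open scoped Classical in
/-- The normal form of a tuple: its flat is moved to the selected representative of the orbit. -/
def orbitForm (F : FlatSystem X) (Γ : Type*) [Group Γ] [MulAction Γ X] (l : List X) : List X :=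
  if F.A l ∧ ¬ F.N l then l.map (toRep Γ (F.κ l) • ·) else l

variable {F : FlatSystem X}

theorem orbitForm_eq {l : List X} (h : F.A l) (hN : ¬ F.N l) :
    F.orbitForm Γ l = l.map (toRep Γ (F.κ l) • ·) := if_pos ⟨h, hN⟩

theorem IsFree.κ_orbitForm (hF : F.IsFree Γ) {l : List X} (h : F.A l) (hN : ¬ F.N l) :
    F.κ (F.orbitForm Γ l) = orbitRep Γ (F.κ l) := by
  rw [orbitForm_eq h hN, hF.κ_map _ _ h, toRep_smul]

/-- The normal form is invariant: the group element that moves a flat to the representative of its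
orbit is unique, up to elements which fix the flat pointwise. -/
theorem IsFree.orbitForm_smul (hF : F.IsFree Γ) (g : Γ) {l : List X} (h : F.A l)
    (hN : ¬ F.N l) : F.orbitForm Γ (l.map (g • ·)) = F.orbitForm Γ l := by
  have hN' : ¬ F.N (l.map (g • ·)) := fun h' => hN ((hF.N_map g l h).1 h')
  have hA := hF.A_map g l h
  rw [orbitForm_eq hA hN', orbitForm_eq h hN, hF.κ_map g l h, List.map_map]
  refine List.map_congr_left fun x hx => ?_
  set t := toRep Γ (g • F.κ l)
  set s := toRep Γ (F.κ l)
  have hs : s • F.κ l = orbitRep Γ (F.κ l) := toRep_smul _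
  have ht : t • g • F.κ l = orbitRep Γ (F.κ l) := by
    rw [toRep_smul, orbitRep_smul]
  have h1 := hF.free (s⁻¹ * t * g) l h hN (by
    rw [mul_smul, mul_smul, ht, ← hs, inv_smul_smul]) x (F.subset l h x hx)
  rw [mul_smul, mul_smul, inv_smul_eq_iff] at h1
  exact h1

theorem IsFree.normal_single_smul (hF : F.IsFree Γ) (g : Γ) {l : List X} (h : F.A l) :
    F.normal (F.orbitForm Γ) (Finsupp.single (l.map (g • ·)) 1) =
      F.normal (F.orbitForm Γ) (Finsupp.single l 1) := by
  by_cases hN : F.N l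
  · rw [normal_single_of_N F _ hN, normal_single_of_N F _ ((hF.N_map g l h).2 hN)]
  · rw [normal_single F _ hN, normal_single F _ fun h' => hN ((hF.N_map g l h).1 h'),
      hF.orbitForm_smul g h hN]

theorem IsFree.isNormalForm (hF : F.IsFree Γ) : F.IsNormalForm (F.orbitForm Γ) where
  mem l h hN := by
    rw [orbitForm_eq h hN]
    exact ⟨hF.A_map _ _ h, List.length_map _, hF.r_map _ _ h,
      fun h' => hN ((hF.N_map _ l h).1 h')⟩
  comm l h := by
    by_cases hN : F.N l
    · rw [normal_single_of_N F _ hN, map_zero, map_zero,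
        normal_of_N F _ (F.bd_N (single_mem_on hN 1))]
    · rw [normal_single F _ hN, orbitForm_eq h hN, ← mapCh_single, bd_mapCh]
      refine map_eq_of_on (F.normal (F.orbitForm Γ) ∘ₗ mapCh _) (F.normal (F.orbitForm Γ))
        (p := F.A) (fun l' hl' => ?_) (bd_mem_on (p := fun l' => l' = l)
          (fun l₁ l₂ h₁ hs _ => ?_) (single_mem_on (p := fun l' => l' = l) rfl 1))
      · rw [LinearMap.comp_apply, mapCh_single, hF.normal_single_smul _ hl']
      · subst h₁
        exact (F.closed l₁ l₂ h fun x hx => F.subset l₁ h x (hs.subset hx)).1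
  fix l l' h hN hl' hκ := by
    have hA := hF.A_map (toRep Γ (F.κ l)) l h
    have hN' : ¬ F.N (l.map (toRep Γ (F.κ l) • ·)) := fun h' => hN ((hF.N_map _ l h).1 h')
    rw [← orbitForm_eq h hN] at hA hN'
    have hA' : F.A l' := (F.closed _ l' hA hl').1
    have hNl' : ¬ F.N l' := fun h' => hN' ((F.congr _ _ hA' hA hκ).2.1 h')
    rw [orbitForm_eq hA' hNl']
    conv_rhs => rw [← List.map_id l']
    refine List.map_congr_left fun x hx => ?_
    refine hF.free _ l' hA' hNl' ?_ x (F.subset l' hA' x hx)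
    rw [toRep_smul, hκ, hF.κ_orbitForm h hN, orbitRep_orbitRep]

end FlatSystem

end

noncomputable section
/-! ### The flats of the perfect cone decomposition -/

namespace Voronoi

open FlatSystem Ch

variable {n : ℕ}

local notation "SLZ" n => Matrix.SpecialLinearGroup (Fin n) ℤ

/-- A tuple of integral vectors is admissible if its entries are common minimal vectors of a form
in the Ryshkov polyhedron. -/
def Admissible (l : List (Fin n → ℤ)) : Prop := ∃ φ : Form n, Ryshkov φ ∧ ∀ x ∈ l, x ∈ minSet φ

/-- The minimal vectors `x` such that `x'` is in the span of the matrices of a tuple. For an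
admissible tuple, the form in the definition does not matter. -/
def flat (l : List (Fin n → ℤ)) : Set (Fin n → ℤ) :=
  {x | sym x ∈ lspan sym l ∧ ∃ φ : Form n, Ryshkov φ ∧ (∀ y ∈ l, y ∈ minSet φ) ∧ x ∈ minSet φ}

theorem flat_eq {φ : Form n} (h : Ryshkov φ) {l : List (Fin n → ℤ)} (hl : ∀ x ∈ l, x ∈ minSet φ) :
    flat l = {x | x ∈ minSet φ ∧ sym x ∈ lspan sym l} := by
  ext x
  constructor
  · rintro ⟨hx, ψ, -, hψl, hψx⟩
    refine ⟨?_, hx⟩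
    have h1 : lspan sym l ≤ (φ - ψ).ker := lspan_le fun y hy => by
      rw [LinearMap.mem_ker, LinearMap.sub_apply, show φ (sym y) = 1 from hl y hy,
        show ψ (sym y) = 1 from hψl y hy, sub_self]
    have h2 := h1 hx
    rw [LinearMap.mem_ker, LinearMap.sub_apply, show ψ (sym x) = 1 from hψx] at h2
    exact sub_eq_zero.1 h2
  · rintro ⟨h1, h2⟩
    exact ⟨h2, φ, h, hl, h1⟩

theorem finite_flat {l : List (Fin n → ℤ)} (h : Admissible l) : (flat l).Finite := by
  obtain ⟨φ, hφ, hl⟩ := h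
  rw [flat_eq hφ hl]
  exact hφ.finite_minSet.subset fun x hx => hx.1

theorem lspan_toR_le {l l' : List (Fin n → ℤ)} (h : lspan sym l ≤ lspan sym l') :
    lspan toR l ≤ lspan toR l' :=
  lspan_le fun _ hx => span_toR_of_sym (h (mem_lspan _ hx))

/-- The matrices `x ᵗx` of linearly independent vectors `x` are linearly independent. -/
theorem le_finrank_lspan {l : List (Fin n → ℤ)} (h : lspan toR l = ⊤) :
    n ≤ Module.finrank ℝ (lspan sym l) := by
  obtain ⟨M, hM, hMl⟩ := exists_det_ne_zero (A := {x | x ∈ l}) h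
  have hM' : (M.det : ℝ) ≠ 0 := by exact_mod_cast hM
  have hli : LinearIndependent ℝ fun j => sym (M.col j) := by
    rw [Fintype.linearIndependent_iff]
    intro c hc i
    -- the squares of the linear forms given by the rows of the adjugate matrix separate them
    have h1 := congrArg (sqForm fun a => (M.adjugate i a : ℝ)) hc
    have h2 : ∀ j, ∑ a, (M.adjugate i a : ℝ) * toR (M.col j) a =
        if i = j then (M.det : ℝ) else 0 := by
      intro j
      have h3 := congrFun (congrFun (Matrix.adjugate_mul M) i) j
      rw [Matrix.mul_apply, Matrix.smul_apply, Matrix.one_apply] at h3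
      have h4 := congrArg (Int.cast : ℤ → ℝ) h3
      push_cast at h4
      simpa [toR, Matrix.col] using h4
    simp only [map_sum, map_smul, map_zero, sym_eq, sqForm_symR, h2, smul_eq_mul, ite_pow,
      ne_eq, OfNat.ofNat_ne_zero, not_false_eq_true, zero_pow, mul_ite, mul_zero] at h1
    rw [Finset.sum_ite_eq Finset.univ i, if_pos (Finset.mem_univ i)] at h1
    exact (mul_eq_zero.1 h1).resolve_right (pow_ne_zero 2 hM')
  have h5 := finrank_span_eq_card hli
  rw [Fintype.card_fin] at h5
  refine h5.symm.le.trans (Submodule.finrank_mono (Submodule.span_mono ?_))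
  rintro _ ⟨j, rfl⟩
  exact ⟨_, hMl j, rfl⟩

/-- The flats of the perfect cone decomposition. The tuples to be neglected are those which do not
span `ℝⁿ`. -/
def flats (n : ℕ) : FlatSystem (Fin n → ℤ) where
  N l := lspan toR l ≠ ⊤
  κ := flat
  r l := Module.finrank ℝ (lspan sym l)
  A := Admissible
  N_sub l l' h hs h' := h (top_unique (h' ▸ lspan_mono toR fun _ hx => hs.subset hx))
  subset l hl x hx := by
    obtain ⟨φ, hφ, hlφ⟩ := hl
    exact ⟨mem_lspan _ hx, φ, hφ, hlφ, hlφ x hx⟩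
  closed l l' hl hl' := by
    obtain ⟨φ, hφ, hlφ⟩ := hl
    rw [flat_eq hφ hlφ] at hl' ⊢
    have h1 : lspan sym l' ≤ lspan sym l := lspan_le fun x hx => (hl' x hx).2
    have h2 : ∀ x ∈ l', x ∈ minSet φ := fun x hx => (hl' x hx).1
    rw [flat_eq hφ h2]
    exact ⟨⟨φ, hφ, h2⟩, fun x hx => ⟨hx.1, h1 hx.2⟩, Submodule.finrank_mono h1, fun h => by
      rw [Submodule.eq_of_le_of_finrank_eq h1 h]⟩
  congr l l' hl hl' h := by
    have key : ∀ {l l' : List (Fin n → ℤ)}, Admissible l → flat l = flat l' →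
        lspan sym l ≤ lspan sym l' := by
      rintro l l' ⟨φ, hφ, hlφ⟩ h
      exact lspan_le fun x hx =>
        ((Set.ext_iff.1 h x).1 ⟨mem_lspan _ hx, φ, hφ, hlφ, hlφ x hx⟩).1
    have h1 := key hl h
    have h2 := key hl' h.symm
    rw [le_antisymm h1 h2, le_antisymm (lspan_toR_le h1) (lspan_toR_le h2)]
    exact ⟨rfl, Iff.rfl⟩
  acyclic l hl hN K hK c hc hbd := by
    have h1 := le_finrank_lspan (not_not.1 hN)
    exact exists_sub_bd_mem_on_finrank_lt toR (flat l)
      (by rw [Module.finrank_fin_fun]; omega) hc hbd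

theorem lspan_sym_map (g : SLZ n) (l : List (Fin n → ℤ)) :
    lspan sym (l.map (g • ·)) = (lspan sym l).map (symEquiv g).toLinearMap := by
  rw [lspan, lspan, Submodule.map_span, Set.image_image]
  congr 1
  ext A
  simp only [Set.mem_image, Set.mem_ofPred_eq, List.mem_map]
  constructor
  · rintro ⟨_, ⟨x, hx, rfl⟩, rfl⟩
    exact ⟨x, hx, symAct_sym g x⟩
  · rintro ⟨x, hx, rfl⟩
    exact ⟨_, ⟨x, hx, rfl⟩, (symAct_sym g x).symm⟩

theorem map_smul_map_inv_smul (g : SLZ n) (l : List (Fin n → ℤ)) :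
    (l.map (g • ·)).map (g⁻¹ • ·) = l := by
  simp [List.map_map, Function.comp_def]

theorem Admissible.map {l : List (Fin n → ℤ)} (h : Admissible l) (g : SLZ n) :
    Admissible (l.map (g • ·)) := by
  obtain ⟨φ, hφ, hl⟩ := h
  refine ⟨φ ∘ₗ symAct g⁻¹, hφ.comp _, fun x hx => ?_⟩
  obtain ⟨y, hy, rfl⟩ := List.mem_map.1 hx
  exact mem_minSet_comp.2 (by simpa using hl y hy)

theorem lspan_toR_map (g : SLZ n) {l : List (Fin n → ℤ)} (h : lspan toR l = ⊤) :
    lspan toR (l.map (g • ·)) = ⊤ := by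
  obtain ⟨M, hM, hMl⟩ := exists_det_ne_zero (A := {x | x ∈ l}) h
  set M' := (g.1 * M).map (Int.cast : ℤ → ℝ)
  have hM' : IsUnit M' := by
    rw [Matrix.isUnit_iff_isUnit_det, det_map_cast, Matrix.det_mul, g.2, one_mul,
      isUnit_iff_ne_zero]
    exact_mod_cast hM
  have h1 : Submodule.span ℝ (Set.range M'.col) = ⊤ :=
    (Matrix.linearIndependent_cols_iff_isUnit.2 hM').span_eq_top_of_card_eq_finrank'
      (by simp)
  refine top_unique (h1 ▸ Submodule.span_mono ?_)
  rintro _ ⟨j, rfl⟩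
  exact ⟨g • M.col j, List.mem_map.2 ⟨_, hMl j, rfl⟩, rfl⟩

open scoped Pointwise in
theorem flat_map (g : SLZ n) {l : List (Fin n → ℤ)} (h : Admissible l) :
    flat (l.map (g • ·)) = g • flat l := by
  have key : ∀ (g : SLZ n) {l : List (Fin n → ℤ)}, Admissible l →
      g • flat l ⊆ flat (l.map (g • ·)) := by
    rintro g l ⟨φ, hφ, hl⟩ _ ⟨x, hx, rfl⟩
    rw [flat_eq hφ hl] at hx
    refine ⟨?_, φ ∘ₗ symAct g⁻¹, hφ.comp _, fun y hy => ?_, ?_⟩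
    · rw [lspan_sym_map]
      exact ⟨_, hx.2, symAct_sym g x⟩
    · obtain ⟨z, hz, rfl⟩ := List.mem_map.1 hy
      exact mem_minSet_comp.2 (by simpa using hl z hz)
    · exact mem_minSet_comp.2 (by simpa using hx.1)
  refine subset_antisymm ?_ (key g h)
  have h1 := key g⁻¹ (h.map g)
  rwa [map_smul_map_inv_smul, Set.smul_set_subset_iff_subset_inv_smul_set, inv_inv] at h1

open scoped Pointwise in
/-- A torsion-free group permutes the spanning flats freely. -/
theorem isFree_flats {G : Subgroup (SLZ n)} (htf : ∀ g ∈ G, IsOfFinOrder g → g = 1) :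
    (flats n).IsFree G where
  A_map g l h := h.map g.1
  N_map g l _ := not_congr ⟨fun h => by
    have h1 := lspan_toR_map g.1⁻¹ h
    rwa [show l.map (g • ·) = l.map (g.1 • ·) from rfl, map_smul_map_inv_smul] at h1,
    lspan_toR_map g.1⟩
  r_map g l _ := by
    change Module.finrank ℝ (lspan sym (l.map (g.1 • ·))) = _
    rw [lspan_sym_map]
    exact LinearEquiv.finrank_map_eq _ _
  κ_map g l h := flat_map g.1 h
  free g l h hN hg := by
    have h1 : g.1 = 1 := by
      refine eq_one_of_mapsTo (htf g.1 g.2) (finite_flat h) ?_ fun x hx => ?_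
      · refine top_unique ((not_not.1 hN : lspan toR l = ⊤) ▸ Submodule.span_mono
          (Set.image_mono fun x hx => (flats n).subset l h x hx))
      · have h2 : g.1 • x ∈ g • flat l := ⟨x, hx, rfl⟩
        rwa [show g • flat l = flat l from hg] at h2
    intro x _
    change g.1 • x = x
    rw [h1, one_smul]

end Voronoi

end

noncomputable section
/-! ### The facets of a dissection in a given hyperplane -/

namespace Voronoi

open FlatSystem Ch VolumeForm

variable {n k : ℕ} {ι : Type}

local notation "SLZ" n => Matrix.SpecialLinearGroup (Fin n) ℤ

namespace Dissection

variable {G : Subgroup (SLZ n)} (D : Dissection n k G ι)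

/-- A facet of a cone of a dissection, as a tuple. -/
def facet (i : ι) (j : Fin (k + 1)) : List (Fin n → ℤ) := List.ofFn (D.U i ∘ j.succAbove)

theorem ofFn_wall (q : (SLZ n) × ι) (j : Fin (k + 1)) :
    List.ofFn (D.wall q j) = (D.facet q.2 j).map (q.1 • ·) := by
  rw [facet, List.map_ofFn]
  rfl

theorem mem_facet {i : ι} {j : Fin (k + 1)} {x : Fin n → ℤ} :
    x ∈ D.facet i j ↔ ∃ a, D.U i (j.succAbove a) = x := by
  simp [facet, List.mem_ofFn]

theorem admissible_facet (i : ι) (j : Fin (k + 1)) : Admissible (D.facet i j) := by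
  refine ⟨D.φ i, D.ryshkov i, fun x hx => ?_⟩
  obtain ⟨a, rfl⟩ := D.mem_facet.1 hx
  exact D.mem i _

theorem finrank_lspan_facet (i : ι) (j : Fin (k + 1)) :
    Module.finrank ℝ (lspan sym (D.facet i j)) = k := by
  have h1 : LinearIndependent ℝ fun a => sym (D.U i (j.succAbove a)) := by
    have h2 := (D.b i).linearIndependent.comp _ (Fin.succAbove_right_injective (p := j))
    convert h2 using 1
    funext a
    exact (D.b_apply i _).symm
  rw [facet, lspan_ofFn]
  exact (finrank_span_eq_card h1).trans (Fintype.card_fin k)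

/-- If a translate of a facet lies in a selected flat of the same rank, it is the normal form of the
facet. -/
theorem orbitForm_facet (htf : ∀ g ∈ G, IsOfFinOrder g → g = 1) {l : List (Fin n → ℤ)}
    (hl : Admissible l) (hN : ¬ (flats n).N l) (hr : Module.finrank ℝ (lspan sym l) = k)
    {g : SLZ n} (hg : g ∈ G) {i : ι} {j : Fin (k + 1)}
    (h : ∀ a, D.wall (g, i) j a ∈ flat ((flats n).orbitForm G l)) :
    ¬ (flats n).N (D.facet i j) ∧
      (flats n).orbitForm G (D.facet i j) = List.ofFn (D.wall (g, i) j) ∧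
      flat (List.ofFn (D.wall (g, i) j)) = flat ((flats n).orbitForm G l) := by
  have hF := isFree_flats htf
  obtain ⟨h1, -, h2, h3⟩ := hF.isNormalForm.mem l hl hN
  have hA := D.admissible_facet i j
  have hw : ∀ x ∈ List.ofFn (D.wall (g, i) j), x ∈ (flats n).κ ((flats n).orbitForm G l) := by
    intro x hx
    obtain ⟨a, rfl⟩ := (List.mem_ofFn' _ _).1 hx
    exact h a
  obtain ⟨h4, -, -, h5⟩ := (flats n).closed _ _ h1 hw
  have h6 := h5 (by
    rw [h2, ofFn_wall]
    exact ((hF.r_map ⟨g, hg⟩ _ hA).trans (D.finrank_lspan_facet i j)).trans hr.symm)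
  have h7 : ¬ (flats n).N (List.ofFn (D.wall (g, i) j)) := fun h' =>
    h3 (((flats n).congr _ _ h4 h1 h6).2.1 h')
  have h8 : ¬ (flats n).N (D.facet i j) := fun h' => h7 (by
    rw [ofFn_wall]
    exact (hF.N_map ⟨g, hg⟩ _ hA).2 h')
  refine ⟨h8, ?_, h6⟩
  rw [← hF.isNormalForm.fix l _ hl hN hw h6, ofFn_wall]
  exact (hF.orbitForm_smul ⟨g, hg⟩ hA h8).symm

open scoped Classical in
/-- The contribution of a facet to a selected flat is the unique translate of the facet to this
flat, if there is one. -/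
theorem eval_part_normal_facet (htf : ∀ g ∈ G, IsOfFinOrder g → g = 1) {l : List (Fin n → ℤ)}
    (hl : Admissible l) (hN : ¬ (flats n).N l) (hr : Module.finrank ℝ (lspan sym l) = k)
    {Q : Finset ((SLZ n) × ι)} (hQG : ∀ q ∈ Q, q.1 ∈ G)
    (hQ : ∀ q : (SLZ n) × ι, q.1 ∈ G → ∀ j,
      (∀ a, D.wall q j a ∈ flat ((flats n).orbitForm G l)) → q ∈ Q)
    (w : List (Fin n → ℤ) → ℝ) (i : ι) (j : Fin (k + 1)) :
    eval w (part (fun l' => flat l' = flat ((flats n).orbitForm G l))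
        ((flats n).normal ((flats n).orbitForm G) (Finsupp.single (D.facet i j) 1))) =
      ∑ q ∈ Q with q.2 = i, if ∀ a, D.wall q j a ∈ flat ((flats n).orbitForm G l)
        then w (List.ofFn (D.wall q j)) else 0 := by
  have hF := isFree_flats htf
  have hA := D.admissible_facet i j
  by_cases hex : ∃ g ∈ G, ∀ a, D.wall (g, i) j a ∈ flat ((flats n).orbitForm G l)
  · obtain ⟨g, hg, hgw⟩ := hex
    obtain ⟨h1, h2, h3⟩ := D.orbitForm_facet htf hl hN hr hg hgw
    rw [normal_single _ _ h1, h2, part_single_pos h3, eval_single, Int.cast_one, one_mul,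
      Finset.sum_eq_single (g, i), if_pos hgw]
    · rintro ⟨g', i'⟩ hq hne
      obtain ⟨hq1, rfl⟩ := Finset.mem_filter.1 hq
      refine if_neg fun hw => hne ?_
      obtain ⟨-, h4, -⟩ := D.orbitForm_facet htf hl hN hr (hQG _ hq1) hw
      rw [h2, List.ofFn_inj] at h4
      refine Prod.ext (ext_of_smul_eq (F := {x | x ∈ D.facet i' j}) (not_not.1 h1) ?_) rfl
      intro x hx
      obtain ⟨a, rfl⟩ := D.mem_facet.1 hx
      exact (congrFun h4 a).symm
    · exact fun h => (h (Finset.mem_filter.2 ⟨hQ (g, i) hg j hgw, rfl⟩)).elim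
  · rw [Finset.sum_eq_zero]
    · by_cases hNf : (flats n).N (D.facet i j)
      · rw [normal_single_of_N _ _ hNf, map_zero, map_zero]
      · rw [normal_single _ _ hNf, part_single_neg, map_zero]
        intro h
        refine hex ⟨(toRep G (flat (D.facet i j))).1, SetLike.coe_mem _, fun a => ?_⟩
        rw [← h]
        refine (flats n).subset _ (hF.isNormalForm.mem _ hA hNf).1 _ ?_
        rw [orbitForm_eq hA hNf]
        exact List.mem_map.2 ⟨_, D.mem_facet.2 ⟨a, rfl⟩, rfl⟩
    · rintro ⟨g', i'⟩ hq
      obtain ⟨hq1, rfl⟩ := Finset.mem_filter.1 hq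
      exact if_neg fun hw => hex ⟨g', hQG _ hq1, hw⟩

/-- The sum of the cones of a dissection, as a chain. -/
def chain [Fintype ι] : Ch (Fin n → ℤ) := ∑ i, Finsupp.single (List.ofFn (D.U i)) 1

theorem bd_chain [Fintype ι] :
    bd D.chain = ∑ i, ∑ j : Fin (k + 1), (-1 : ℤ) ^ (j : ℕ) • Finsupp.single (D.facet i j) 1 := by
  rw [chain, map_sum]
  refine Finset.sum_congr rfl fun i _ => ?_
  rw [bd_single, one_smul, bdList_ofFn]
  rfl

/-- The facets of a dissection in a selected flat of a hyperplane form a boundary, up to tuples of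
smaller rank. -/
theorem exists_part_sub_bd_mem [Fintype ι] (hn : 0 < n)
    (hdet : ∀ g : SLZ n, 0 < LinearMap.det (symAct g)) (htf : ∀ g ∈ G, IsOfFinOrder g → g = 1)
    {l : List (Fin n → ℤ)} (hl : Admissible l) (hN : ¬ (flats n).N l) (i₀ : ι)
    (hr : Module.finrank ℝ (lspan sym l) = k) {E : Set (Fin n → ℤ)}
    (hE : E = flat ((flats n).orbitForm G l)) {x : Ch (Fin n → ℤ)}
    (hx : x = part (fun l' => flat l' = E)
      ((flats n).normal ((flats n).orbitForm G) (bd D.chain)))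
    (hxE : x ∈ on (fun l' => l'.length = k ∧ ∀ y ∈ l', y ∈ E)) :
    ∃ a ∈ on (fun l' => l'.length = k + 1 ∧ ∀ y ∈ l', y ∈ E),
      x - bd a ∈ on (fun l' => l'.length = k ∧ (∀ y ∈ l', y ∈ E) ∧
        Module.finrank ℝ (lspan sym l') < k) := by
  classical
  have hF := isFree_flats htf
  obtain ⟨hA, -, hr', hN'⟩ := hF.isNormalForm.mem l hl hN
  replace hr' : Module.finrank ℝ (lspan sym ((flats n).orbitForm G l)) = k := hr'.trans hr
  obtain ⟨φ₀, hφ₀, hlφ₀⟩ := id hA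
  have hEspan : Submodule.span ℝ (toR '' E) = ⊤ := by
    refine top_unique ((not_not.1 hN' : lspan toR _ = ⊤) ▸ Submodule.span_mono
      (Set.image_mono fun x hx => ?_))
    rw [hE]
    exact (flats n).subset _ hA x hx
  -- the hyperplane of the flat
  have hdim : Module.finrank ℝ (SymMat n) = k + 1 := by
    rw [Module.finrank_eq_card_basis (D.b i₀), Fintype.card_fin]
  have hlt : lspan sym ((flats n).orbitForm G l) < ⊤ := by
    refine lt_top_iff_ne_top.2 fun h => ?_
    rw [h, finrank_top] at hr'
    omega
  obtain ⟨ν, hν0, hνl⟩ := Submodule.exists_le_ker_of_lt_top _ hlt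
  have hker : lspan sym ((flats n).orbitForm G l) = ν.ker := by
    refine Submodule.eq_of_le_of_finrank_eq hνl ?_
    have h1 := Module.Dual.finrank_ker_add_one_of_ne_zero (f := ν) hν0
    omega
  obtain ⟨N, hνN⟩ : ∃ N, ν N = 1 := by
    obtain ⟨y, hy⟩ : ∃ y, ν y ≠ 0 := by
      by_contra! h
      exact hν0 (LinearMap.ext h)
    exact ⟨(ν y)⁻¹ • y, by rw [map_smul, smul_eq_mul, inv_mul_cancel₀ hy]⟩
  have hEν : E = {x | x ∈ minSet φ₀ ∧ ν (sym x) = 0} := by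
    rw [hE, flat_eq hφ₀ hlφ₀, hker]
    rfl
  have hEfin : E.Finite := by
    rw [hEν]
    exact hφ₀.finite_minSet.subset fun x hx => hx.1
  obtain ⟨Q, hQG, hQ, H, hH, hsum⟩ := D.exists_sum_signedCone_eq_zero hn hdet i₀ hφ₀ hνN hEν hEspan
  obtain ⟨a, ha, hxa⟩ := exists_bd_of_signedCone (D.b i₀) sym N ν φ₀ hνN (D := hEfin.toFinset)
    (fun y hy => by
      rw [Set.Finite.mem_toFinset, hEν] at hy
      exact ⟨hy.2, by rw [show φ₀ (sym y) = 1 from hy.1]; exact one_pos⟩)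
    (c := x) (by simpa using hxE) H hH (fun y hy => by
      rw [← hsum y hy, ← Finset.sum_fiberwise Q (fun q => q.2), hx, bd_chain]
      simp only [map_sum, map_zsmul]
      refine Finset.sum_congr rfl fun i _ => ?_
      rw [Finset.sum_comm]
      refine Finset.sum_congr rfl fun j _ => ?_
      rw [hE, D.eval_part_normal_facet htf hl hN hr hQG (by rw [← hE]; exact hQ) _ i j,
        zsmul_eq_mul, Finset.mul_sum]
      refine Finset.sum_congr rfl fun q _ => ?_
      push_cast
      rw [mul_ite, mul_zero])
  simp only [Set.Finite.mem_toFinset] at ha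
  refine ⟨a, ha, mem_on.2 fun l' hl' => ?_⟩
  have h1 : x - bd a ∈ on (fun l' => l'.length = k ∧ ∀ y ∈ l', y ∈ E) :=
    sub_mem hxE (bd_mem_on (fun l₁ l₂ h₁ hs hlen => ⟨by omega, fun y hy => h₁.2 y (hs.subset hy)⟩)
      ha)
  obtain ⟨h2, h3⟩ := mem_on.1 h1 l' hl'
  refine ⟨h2, h3, ?_⟩
  have h4 := mem_on.1 hxa l' hl'
  obtain ⟨v, rfl⟩ := exists_ofFn_eq h2
  have hvE : ∀ a, v a ∈ E := fun a => h3 _ ((List.mem_ofFn' _ _).2 ⟨a, rfl⟩)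
  have hle : lspan sym (List.ofFn v) ≤ ν.ker := lspan_le fun y hy => by
    have := h3 y hy
    rw [hEν] at this
    exact this.2
  have hkerk : Module.finrank ℝ ν.ker = k := by rw [← hker, hr']
  -- a tuple that spans the hyperplane is a basis together with `N`
  refine lt_of_le_of_ne ((Submodule.finrank_mono hle).trans hkerk.le) fun h => ?_
  rw [relDet_ofFn] at h4
  have hspan :
      Submodule.span ℝ (Set.range (Fin.cons N (sym ∘ v) : Fin (k + 1) → SymMat n)) = ⊤ := by
    refine eq_top_iff.2 fun y _ => ?_
    have h5 : y - ν y • N ∈ lspan sym (List.ofFn v) := by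
      rw [Submodule.eq_of_le_of_finrank_eq hle (h.trans hkerk.symm), LinearMap.mem_ker, map_sub,
        map_smul, hνN, smul_eq_mul, mul_one, sub_self]
    rw [lspan_ofFn] at h5
    rw [← sub_add_cancel y (ν y • N), Fin.range_cons]
    exact add_mem (Submodule.span_mono (Set.subset_insert _ _) h5)
      (Submodule.smul_mem _ _ (Submodule.subset_span (Set.mem_insert _ _)))
  refine (((D.b i₀).is_basis_iff_det).1 ⟨linearIndependent_of_top_le_span_of_card_eq_finrank
    hspan.ge ?_, hspan⟩).ne_zero h4
  rw [hdim, Fintype.card_fin]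

end Dissection

end Voronoi

end

noncomputable section
/-! ### The boundary of a dissection -/

namespace Voronoi

open FlatSystem Ch

variable {n k : ℕ} {ι : Type}

local notation "SLZ" n => Matrix.SpecialLinearGroup (Fin n) ℤ

variable {G : Subgroup (SLZ n)} (D : Dissection n k G ι)

/-- Up to the action of the group, and up to nonspanning tuples, the boundary of the chain of a
dissection is the boundary of a chain of degenerate cones. -/
theorem Dissection.exists_normal_bd_chain_eq [Fintype ι] (hn : 0 < n)
    (hdet : ∀ g : SLZ n, 0 < LinearMap.det (symAct g)) (htf : ∀ g ∈ G, IsOfFinOrder g → g = 1)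
    (i₀ : ι) :
    ∃ a ∈ on (fun l => Admissible l ∧ l.length = k + 1 ∧
        Module.finrank ℝ (lspan sym l) < k + 1),
      (flats n).normal ((flats n).orbitForm G) (bd D.chain) =
        (flats n).normal ((flats n).orbitForm G) (bd a) := by
  classical
  set ν := (flats n).orbitForm G with hν
  have hF : (flats n).IsFree G := isFree_flats htf
  have hnf : (flats n).IsNormalForm ν := hF.isNormalForm
  set e := (flats n).normal ν (bd D.chain) with he
  have hmem₀ : bd D.chain ∈ on (fun l => Admissible l ∧ l.length = k ∧
      Module.finrank ℝ (lspan sym l) = k) := by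
    rw [D.bd_chain]
    refine Submodule.sum_mem _ fun i _ => Submodule.sum_mem _ fun j _ =>
      Submodule.smul_mem _ _
        (single_mem_on ⟨D.admissible_facet i j, ?_, D.finrank_lspan_facet i j⟩ 1)
    simp [Dissection.facet]
  have hmem : e ∈ on (fun l => l.length = k ∧ ∃ l₀, Admissible l₀ ∧ ¬ (flats n).N l₀ ∧
      Module.finrank ℝ (lspan sym l₀) = k ∧ l = ν l₀) := by
    refine map_mem_on _ (fun l hl => ?_) hmem₀
    by_cases hN : (flats n).N l
    · rw [normal_single_of_N _ _ hN]; exact zero_mem _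
    · rw [normal_single _ _ hN]
      exact single_mem_on ⟨(hnf.mem l hl.1 hN).2.1.trans hl.2.1, l, hl.1, hN, hl.2.2, rfl⟩ 1
  -- the pieces of the boundary in the various hyperplanes
  set I := e.support.image flat with hI
  set x : Set (Fin n → ℤ) → Ch (Fin n → ℤ) := fun E => part (fun l => flat l = E) e with hx
  have hsum : ∑ E ∈ I, x E = e := sum_part flat e
  have hrep : ∀ E ∈ I, ∃ l₀, Admissible l₀ ∧ ¬ (flats n).N l₀ ∧
      Module.finrank ℝ (lspan sym l₀) = k ∧ E = flat (ν l₀) := by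
    intro E hE
    obtain ⟨l, hl, rfl⟩ := Finset.mem_image.1 hE
    obtain ⟨-, l₀, h1, h2, h3, rfl⟩ := mem_on.1 hmem l (Finsupp.mem_support_iff.1 hl)
    exact ⟨l₀, h1, h2, h3, rfl⟩
  have hsub : ∀ E ∈ I, ∀ l, (∀ y ∈ l, y ∈ E) →
      Admissible l ∧ Module.finrank ℝ (lspan sym l) ≤ k := by
    intro E hE l hl
    obtain ⟨l₀, h1, h2, h3, rfl⟩ := hrep E hE
    obtain ⟨h4, -, h5, -⟩ := hnf.mem l₀ h1 h2
    have h6 := (flats n).closed _ l h4 hl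
    exact ⟨h6.1, h6.2.2.1.trans (h5.trans h3).le⟩
  have hfill : ∀ E ∈ I, ∃ a ∈ on (fun l => l.length = k + 1 ∧ ∀ y ∈ l, y ∈ E),
      x E - bd a ∈ on (fun l => l.length = k ∧ (∀ y ∈ l, y ∈ E) ∧
        Module.finrank ℝ (lspan sym l) < k) := by
    intro E hE
    obtain ⟨l₀, h1, h2, h3, h4⟩ := hrep E hE
    refine D.exists_part_sub_bd_mem hn hdet htf h1 h2 i₀ h3 h4 rfl
      (on_mono (fun l hl => ⟨hl.1.1, fun y hy => ?_⟩) (part_mem_of_mem (fun l => flat l = E) hmem))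
    obtain ⟨l₁, h5, h6, -, rfl⟩ := hl.1.2
    exact hl.2 ▸ (flats n).subset _ (hnf.mem l₁ h5 h6).1 y hy
  choose! a ha hxa using hfill
  -- what is left has smaller rank, and is a cycle
  set y := ∑ E ∈ I, (x E - bd (a E)) with hy
  have hey : e = y + bd (∑ E ∈ I, a E) := by
    rw [hy, Finset.sum_sub_distrib, hsum, map_sum, sub_add_cancel]
  have hymem : y ∈ on (fun l => Admissible l ∧ l.length = k ∧
      Module.finrank ℝ (lspan sym l) < k) := by
    refine Submodule.sum_mem _ fun E hE => on_mono (fun l hl => ?_) (hxa E hE)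
    exact ⟨(hsub E hE l hl.2.1).1, hl.1, hl.2.2⟩
  have hamem : ∑ E ∈ I, a E ∈ on (fun l => Admissible l ∧ l.length = k + 1 ∧
      Module.finrank ℝ (lspan sym l) < k + 1) := by
    refine Submodule.sum_mem _ fun E hE => on_mono (fun l hl => ?_) (ha E hE)
    exact ⟨(hsub E hE l hl.2).1, hl.1, Nat.lt_succ_of_le (hsub E hE l hl.2).2⟩
  have hfix : (flats n).normal ν e = e := by
    refine map_eq_of_on ((flats n).normal ν) LinearMap.id (fun l hl => ?_) hmem
    obtain ⟨-, l₀, h1, h2, h3, rfl⟩ := hl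
    obtain ⟨h4, -, -, h5⟩ := hnf.mem l₀ h1 h2
    rw [normal_single _ _ h5, hnf.fix l₀ (ν l₀) h1 h2 ((flats n).subset _ h4) rfl]
    rfl
  have hbde : (flats n).normal ν (bd e) = 0 := by
    have h := map_eq_of_on ((flats n).normal ν ∘ₗ bd ∘ₗ (flats n).normal ν)
      ((flats n).normal ν ∘ₗ bd) (fun l hl => hnf.comm l hl.1) hmem₀
    simp only [LinearMap.comp_apply, bd_bd, map_zero] at h
    exact h
  have hbdy : (flats n).normal ν (bd y) = 0 := by
    rw [hey, map_add, bd_bd, add_zero] at hbde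
    exact hbde
  obtain ⟨a', ha', hya'⟩ := exists_normal_eq_normal_bd k (flats n) ν hnf k le_rfl y hymem hbdy
  refine ⟨a' + ∑ E ∈ I, a E, add_mem (on_mono (fun l hl => ?_) ha') hamem, ?_⟩
  · exact ⟨hl.1, hl.2.1, hl.2.2.trans (Nat.lt_succ_self k)⟩
  · rw [map_add, map_add, ← hya', ← map_add, ← hey, hfix]

end Voronoi

end

noncomputable section
/-! ### From chains to sharblies -/

namespace Voronoi

open FlatSystem Ch

variable {n : ℕ}

local notation "SLZ" n => Matrix.SpecialLinearGroup (Fin n) ℤ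

section Relations

variable {m : ℕ} (G : Subgroup (SLZ n))

theorem mk_eq_zero_of_mem_rel {x : (Fin (n + m) → NZVec n) →₀ ℚ} (h : x ∈ sharblyRel n (n + m)) :
    (sharblyRel n (n + m)).mkQ x = 0 := by
  rwa [← LinearMap.mem_ker, Submodule.ker_mkQ]

theorem basicSharblyCoinv_perm (v : Fin (n + m) → NZVec n) (σ : Equiv.Perm (Fin (n + m))) :
    basicSharblyCoinv G (v ∘ σ) = ((Equiv.Perm.sign σ : ℤ) : ℚ) • basicSharblyCoinv G v := by
  have h := mk_eq_zero_of_mem_rel (n := n) (m := m)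
    (Submodule.subset_span (Or.inl (Or.inl ⟨v, σ, rfl⟩)))
  rw [map_sub, map_smul, sub_eq_zero] at h
  rw [basicSharblyCoinv, basicSharblyCoinv, ← map_smul]
  exact congrArg _ h

theorem basicSharblyCoinv_of_not_spansTop {v : Fin (n + m) → NZVec n} (hv : ¬ SpansTop v) :
    basicSharblyCoinv G v = 0 := by
  have h := mk_eq_zero_of_mem_rel (n := n) (m := m)
    (Submodule.subset_span (Or.inl (Or.inr ⟨v, hv, rfl⟩)))
  exact (congrArg _ h).trans (map_zero _)

theorem basicSharblyCoinv_update (v : Fin (n + m) → NZVec n) (i : Fin (n + m)) (a : ℚˣ) :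
    basicSharblyCoinv G (Function.update v i ((v i).scale a)) = basicSharblyCoinv G v := by
  have h := mk_eq_zero_of_mem_rel (n := n) (m := m)
    (Submodule.subset_span (Or.inr ⟨v, i, a, rfl⟩))
  rw [map_sub, sub_eq_zero] at h
  exact (congrArg _ h).symm

theorem basicSharblyCoinv_eq_of_smul {v v' : Fin (n + m) → NZVec n}
    (h : ∀ i, ∃ a : ℚˣ, (v i).1 = (a : ℚ) • (v' i).1) :
    basicSharblyCoinv G v = basicSharblyCoinv G v' := by
  have key : ∀ s : Finset (Fin (n + m)),
      basicSharblyCoinv G (fun i => if i ∈ s then v i else v' i) = basicSharblyCoinv G v' := by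
    intro s
    induction s using Finset.induction_on with
    | empty => simp
    | insert j s hj ih =>
      obtain ⟨a, ha⟩ := h j
      rw [← ih, ← basicSharblyCoinv_update G (fun i => if i ∈ s then v i else v' i) j a]
      congr 1
      funext i
      by_cases hij : i = j
      · subst hij
        rw [Function.update_self, if_pos (Finset.mem_insert_self i s), if_neg hj]
        exact Subtype.ext ha
      · rw [Function.update_of_ne hij]
        simp [Finset.mem_insert, hij]
  simpa using key Finset.univ

theorem basicSharblyCoinv_smul {g : SLZ n} (hg : g ∈ G) (v : Fin (n + m) → NZVec n) :
    basicSharblyCoinv G (Matrix.SpecialLinearGroup.mapGL ℚ g • v) = basicSharblyCoinv G v := by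
  have h := Representation.Coinvariants.mk_self_apply (sharblyRepRes n m G) ⟨g, hg⟩
    (basicSharbly v)
  refine Eq.trans ?_ h
  exact congrArg _ (sharblyRep_basic _ _).symm

end Relations

/-- A nonzero integral vector, as a rational vector. -/
def ratVec (x : Fin n → ℤ) (hx : x ≠ 0) : NZVec n :=
  ⟨fun i => (x i : ℚ), fun h => hx (funext fun i => by
    have := congrFun h i
    rwa [Pi.zero_apply, Int.cast_eq_zero] at this)⟩

theorem rankOne_ratVec (x : Fin n → ℤ) (hx : x ≠ 0) : rankOne (ratVec x hx).1 = sym x := rfl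

open scoped Classical in
/-- The class of a tuple of nonzero integral vectors of the right length in the coinvariants of
the sharbly complex. Other tuples are mapped to zero. -/
def symbol (m : ℕ) (G : Subgroup (SLZ n)) (l : List (Fin n → ℤ)) : SharblyCoinv n m G :=
  if h : l.length = n + m ∧ ∀ x ∈ l, x ≠ 0 then
    basicSharblyCoinv G fun i => ratVec (l.get (i.cast h.1.symm)) (h.2 _ (List.get_mem _ _))
  else 0

theorem symbol_ofFn {m r : ℕ} (G : Subgroup (SLZ n)) (hr : n + m = r) (z : Fin r → Fin n → ℤ)
    (hz : ∀ i, z i ≠ 0) :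
    symbol m G (List.ofFn z) = basicSharblyCoinv G fun i => ratVec (z (i.cast hr)) (hz _) := by
  subst hr
  rw [symbol, dif_pos ⟨by simp, fun x hx => by
    obtain ⟨i, rfl⟩ := (List.mem_ofFn' _ _).1 hx
    exact hz i⟩]
  congr 1
  funext i
  simp

theorem exists_ofFn_eq_of_ne_zero {r : ℕ} {l : List (Fin n → ℤ)} (h : l.length = r)
    (h0 : ∀ x ∈ l, x ≠ 0) : ∃ z : Fin r → Fin n → ℤ, (∀ i, z i ≠ 0) ∧ l = List.ofFn z := by
  obtain ⟨z, rfl⟩ := VolumeForm.exists_ofFn_eq h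
  exact ⟨z, fun i => h0 _ ((List.mem_ofFn' _ _).2 ⟨i, rfl⟩), rfl⟩

/-- Nonspanning tuples, with respect to real coefficients, are zero in the sharbly complex. -/
theorem symbol_of_lspan_ne_top {m : ℕ} (G : Subgroup (SLZ n)) {l : List (Fin n → ℤ)}
    (h : lspan toR l ≠ ⊤) : symbol m G l = 0 := by
  rw [symbol]
  split_ifs with hl
  · refine basicSharblyCoinv_of_not_spansTop G fun hs => h ?_
    have key : ∀ x ∈ Submodule.span ℚ (Set.range fun i : Fin (n + m) =>
        (ratVec (l.get (i.cast hl.1.symm)) (hl.2 _ (List.get_mem _ _))).1),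
        (fun a => (x a : ℝ)) ∈ lspan toR l := by
      intro x hx
      induction hx using Submodule.span_induction with
      | mem x hx =>
        obtain ⟨i, rfl⟩ := hx
        have := mem_lspan toR (List.get_mem l (i.cast hl.1.symm))
        convert this using 1
        funext a
        simp [ratVec]
      | zero =>
        convert zero_mem (lspan toR l) using 1
        funext a
        simp
      | add x y _ _ hx hy =>
        convert add_mem hx hy using 1
        funext a
        simp
      | smul c x _ hx =>
        convert Submodule.smul_mem _ (c : ℝ) hx using 1
        funext a
        simp
    rw [eq_top_iff, ← (Pi.basisFun ℝ (Fin n)).span_eq]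
    refine Submodule.span_le.2 ?_
    rintro _ ⟨a, rfl⟩
    have h1 := key (Pi.single a 1) (by
      have : Submodule.span ℚ _ = ⊤ := hs
      rw [this]; trivial)
    rw [SetLike.mem_coe]
    convert h1 using 1
    funext b
    by_cases hab : b = a
    · subst hab; simp
    · simp [hab]
  · rfl

theorem symbol_map_smul {m : ℕ} {G : Subgroup (SLZ n)} {g : SLZ n} (hg : g ∈ G)
    (l : List (Fin n → ℤ)) : symbol m G (l.map (g • ·)) = symbol m G l := by
  by_cases h : l.length = n + m ∧ ∀ x ∈ l, x ≠ 0
  · obtain ⟨z, hz, rfl⟩ := exists_ofFn_eq_of_ne_zero h.1 h.2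
    have hz' : ∀ i, g • z i ≠ 0 := fun i h0 => hz i (by simpa using congrArg (g⁻¹ • ·) h0)
    rw [List.map_ofFn, symbol_ofFn G rfl z hz, symbol_ofFn G rfl ((g • ·) ∘ z) hz']
    refine Eq.trans ?_ (basicSharblyCoinv_smul G hg _)
    congr 1
    funext i
    apply Subtype.ext
    funext a
    simp [ratVec, NZVec.gl_smul_val, smul_def, Matrix.mulVec, dotProduct]
  · rw [symbol, symbol, dif_neg h, dif_neg]
    rintro ⟨h1, h2⟩
    refine h ⟨by simpa using h1, fun x hx h0 => h2 (g • x) (List.mem_map.2 ⟨x, hx, rfl⟩) ?_⟩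
    rw [h0, smul_zero]

/-- The map from chains of integral vectors to the coinvariants of the sharbly complex. -/
def toSharbly (m : ℕ) (G : Subgroup (SLZ n)) : Ch (Fin n → ℤ) →ₗ[ℤ] SharblyCoinv n m G :=
  Finsupp.linearCombination ℤ (symbol m G)

theorem toSharbly_single (m : ℕ) (G : Subgroup (SLZ n)) (l : List (Fin n → ℤ)) (a : ℤ) :
    toSharbly m G (Finsupp.single l a) = a • symbol m G l := by
  simp [toSharbly]

/-- Sharblies do not see the passage to normal forms. -/
theorem toSharbly_normal (m : ℕ) (G : Subgroup (SLZ n)) {c : Ch (Fin n → ℤ)}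
    (hc : c ∈ on Admissible) :
    toSharbly m G ((flats n).normal ((flats n).orbitForm G) c) = toSharbly m G c := by
  refine map_eq_of_on (toSharbly m G ∘ₗ (flats n).normal ((flats n).orbitForm G)) (toSharbly m G)
    (fun l hl => ?_) hc
  rw [LinearMap.comp_apply]
  by_cases hN : (flats n).N l
  · rw [normal_single_of_N _ _ hN, map_zero, toSharbly_single, symbol_of_lspan_ne_top G hN,
      smul_zero]
  · rw [normal_single _ _ hN, orbitForm_eq hl hN, toSharbly_single, toSharbly_single]
    congr 1
    exact symbol_map_smul (SetLike.coe_mem _) l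

theorem boundary_basicSharblyCoinv {m : ℕ} (G : Subgroup (SLZ n))
    (v : Fin (n + (m + 1)) → NZVec n) :
    sharblyCoinvBoundary n (m + 1) G (basicSharblyCoinv G v) =
      ∑ i : Fin (n + m + 1), (-1 : ℚ) ^ (i : ℕ) •
        (basicSharblyCoinv (k := m) G (fun j : Fin (n + m) => v (i.succAbove j))) := by
  have h : sharblyCoinvBoundary n (m + 1) G (basicSharblyCoinv G v) =
      Representation.Coinvariants.mk (sharblyRepRes n m G)
        (sharblyBoundary n (m + 1) (basicSharbly v)) := rfl
  rw [h, sharblyBoundary_basic, map_sum]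
  simp only [map_smul]
  rfl

/-- The map from chains to sharblies commutes with the boundary maps. -/
theorem boundary_toSharbly {m : ℕ} (hm : 0 < m) (G : Subgroup (SLZ n)) {c : Ch (Fin n → ℤ)}
    (hc : c ∈ on (fun l => l.length = n + m ∧ ∀ x ∈ l, x ≠ 0)) :
    sharblyCoinvBoundary n m G (toSharbly m G c) = toSharbly (m - 1) G (bd c) := by
  obtain ⟨m, rfl⟩ : ∃ m', m = m' + 1 := ⟨m - 1, by omega⟩
  refine map_eq_of_on ((sharblyCoinvBoundary n (m + 1) G).restrictScalars ℤ ∘ₗ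
    toSharbly (m + 1) G) (toSharbly m G ∘ₗ bd) (fun l hl => ?_) hc
  obtain ⟨z, hz, rfl⟩ := exists_ofFn_eq_of_ne_zero (r := n + m + 1) hl.1 hl.2
  rw [LinearMap.comp_apply, LinearMap.comp_apply, toSharbly_single, bd_single, one_smul, one_smul,
    Ch.bdList_ofFn]
  refine (congrArg _ (symbol_ofFn (m := m + 1) G rfl z hz)).trans
    ((boundary_basicSharblyCoinv G _).trans ?_)
  rw [map_sum]
  refine Finset.sum_congr rfl fun i _ => ?_
  rw [map_smul, toSharbly_single, one_smul, symbol_ofFn G rfl (z ∘ i.succAbove) fun j => hz _]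
  rw [← Int.cast_smul_eq_zsmul ℚ]
  push_cast
  rfl

/-! ### Flipons -/

theorem isFlipon_comp {v : Fin (coneDim n) → NZVec n} (h : IsFlipon v)
    (σ : Equiv.Perm (Fin (coneDim n))) : IsFlipon (v ∘ σ) := by
  obtain ⟨A, hA, hv⟩ := h
  exact ⟨A, hA, fun i => hv (σ i)⟩

theorem finrank_ker_inf_ker {W : Type*} [AddCommGroup W] [Module ℝ W] [FiniteDimensional ℝ W]
    {ν φ : W →ₗ[ℝ] ℝ} (hν : ν ≠ 0) {p : W} (hp : ν p = 0) (hφ : φ p ≠ 0) :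
    Module.finrank ℝ (ν.ker ⊓ φ.ker : Submodule ℝ W) + 2 = Module.finrank ℝ W := by
  have h1 := Module.Dual.finrank_ker_add_one_of_ne_zero (f := ν) hν
  have h2 := Module.Dual.finrank_ker_add_one_of_ne_zero (f := φ ∘ₗ ν.ker.subtype) fun h0 =>
    hφ (LinearMap.congr_fun h0 ⟨p, hp⟩)
  have h3 : (φ ∘ₗ ν.ker.subtype).ker.map ν.ker.subtype = ν.ker ⊓ φ.ker := by
    rw [LinearMap.ker_comp, Submodule.map_comap_subtype]
  rw [← h3, Submodule.finrank_map_subtype_eq]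
  omega

/-- Minimal vectors of a form lie in an affine hyperplane; if they are dependent, also in a linear
one. -/
theorem isFlipon_of_finrank_lt (hn : 0 < n) (hdim : Module.finrank ℝ (SymMat n) = coneDim n)
    {z : Fin (coneDim n) → Fin n → ℤ} (hz : ∀ i, z i ≠ 0) {φ : Form n}
    (hφ : ∀ i, z i ∈ minSet φ)
    (h : Module.finrank ℝ (Submodule.span ℝ (Set.range fun i => sym (z i))) < coneDim n) :
    IsFlipon fun i => ratVec (z i) (hz i) := by
  obtain ⟨ν, hν0, hν⟩ := Submodule.exists_le_ker_of_lt_top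
    (Submodule.span ℝ (Set.range fun i => sym (z i))) (lt_top_iff_ne_top.2 fun h' => by
      rw [h', finrank_top, hdim] at h
      exact lt_irrefl _ h)
  have hνz : ∀ i, ν (sym (z i)) = 0 := fun i => hν (Submodule.subset_span ⟨i, rfl⟩)
  let i₀ : Fin (coneDim n) := ⟨0, by unfold coneDim; omega⟩
  refine ⟨AffineSubspace.mk' (sym (z i₀)) (ν.ker ⊓ φ.ker), ?_,
    fun i => ?_⟩
  · rw [AffineSubspace.direction_mk', ← hdim]
    exact finrank_ker_inf_ker hν0 (hνz i₀)
      (by rw [show φ (sym (z i₀)) = 1 from hφ i₀]; exact one_ne_zero)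
  · rw [rankOne_ratVec, AffineSubspace.mem_mk']
    refine ⟨?_, ?_⟩
    · change ν (sym (z i) - sym (z i₀)) = 0
      rw [map_sub, hνz, hνz, sub_self]
    · change φ (sym (z i) - sym (z i₀)) = 0
      rw [map_sub, show φ (sym (z i)) = 1 from hφ i, show φ (sym (z i₀)) = 1 from hφ i₀, sub_self]

/-- A chain of degenerate cones gives a sum of flipons; as flipons are antisymmetric, no
coefficients are needed. -/
theorem toSharbly_mem_closure_flipon (hn : 2 ≤ n)
    (hdim : Module.finrank ℝ (SymMat n) = coneDim n) (G : Subgroup (SLZ n)) {c : Ch (Fin n → ℤ)}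
    (hc : c ∈ on (fun l => Admissible l ∧ l.length = coneDim n ∧
      Module.finrank ℝ (lspan sym l) < coneDim n)) :
    toSharbly (vcd n) G c ∈ AddSubmonoid.closure
      {x | ∃ v : Fin (coneDim n) → NZVec n, IsFlipon v ∧ basicSharblyCoinv G v = x} := by
  set P := {x : SharblyCoinv n (vcd n) G |
    ∃ v : Fin (coneDim n) → NZVec n, IsFlipon v ∧ basicSharblyCoinv G v = x} with hP
  have hneg : ∀ x ∈ P, -x ∈ P := by
    rintro _ ⟨v, hv, rfl⟩
    have h01 : (⟨0, by unfold coneDim; omega⟩ : Fin (coneDim n)) ≠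
        ⟨1, by unfold coneDim; omega⟩ := by simp
    refine ⟨_, isFlipon_comp hv (Equiv.swap ⟨0, by unfold coneDim; omega⟩
      ⟨1, by unfold coneDim; omega⟩), ?_⟩
    rw [basicSharblyCoinv_perm, Equiv.Perm.sign_swap h01]
    simp
  have hnat : ∀ x ∈ P, ∀ a : ℤ, a • x ∈ AddSubmonoid.closure P := by
    intro x hx a
    obtain ⟨m, rfl | rfl⟩ := a.eq_nat_or_neg
    · rw [natCast_zsmul]
      exact AddSubmonoid.nsmul_mem _ (AddSubmonoid.subset_closure hx) m
    · rw [neg_smul, ← smul_neg, natCast_zsmul]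
      exact AddSubmonoid.nsmul_mem _ (AddSubmonoid.subset_closure (hneg x hx)) m
  rw [toSharbly, Finsupp.linearCombination_apply]
  refine AddSubmonoid.sum_mem _ fun l hl => ?_
  refine hnat _ ?_ _
  obtain ⟨⟨φ, -, hφ⟩, h2, h3⟩ := mem_on.1 hc l (Finsupp.mem_support_iff.1 hl)
  obtain ⟨z, hz, rfl⟩ := exists_ofFn_eq_of_ne_zero h2 fun x hx => ne_zero_of_mem_minSet (hφ x hx)
  rw [lspan_ofFn] at h3
  rw [symbol_ofFn G rfl z hz]
  exact ⟨_, isFlipon_of_finrank_lt (by omega) hdim hz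
    (fun i => hφ _ ((List.mem_ofFn' _ _).2 ⟨i, rfl⟩)) h3, rfl⟩

end Voronoi

end

noncomputable section
/-! ### The fundamental cycle -/

namespace Voronoi

theorem exists_fin_sum_eq {α M : Type*} [AddCommMonoid M] {p : α → Prop} {f : α → M} {x : M}
    (h : x ∈ AddSubmonoid.closure {x | ∃ v, p v ∧ f v = x}) :
    ∃ (N : ℕ) (y : Fin N → α), (∀ i, p (y i)) ∧ ∑ i, f (y i) = x := by
  obtain ⟨l, hl, rfl⟩ := AddSubmonoid.exists_list_of_mem_closure h
  choose y hy using fun i : Fin l.length => hl _ (List.get_mem l i)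
  refine ⟨l.length, y, fun i => (hy i).1, ?_⟩
  rw [Finset.sum_congr rfl fun i _ => (hy i).2, ← List.sum_ofFn, List.ofFn_get]

theorem finite_iUnion_triangulation {n : ℕ} (hn : 0 < n)
    {G : Subgroup (Matrix.SpecialLinearGroup (Fin n) ℤ)} (hfin : G.FiniteIndex)
    {R : Set (PointedCone ℝ (SymMat n))} (hR : IsTileRepresentatives G R)
    {τ : PointedCone ℝ (SymMat n) → Set (PointedCone ℝ (SymMat n))}
    (hτ : ∀ T ∈ R, IsTriangulation T (τ T)) : (⋃ T ∈ R, τ T).Finite := by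
  refine (finite_representatives hn hfin hR).biUnion fun T hT => ?_
  obtain ⟨φ, hφ, rfl⟩ := exists_perfect_of_isTile hn (hR.1 T hT)
  exact (finite_simplicialCones hφ.toRyshkov).subset (hτ _ hT).subset

end Voronoi

end

open Voronoi Ch in
theorem mainTheorem2 (n : ℕ) (hn : 2 ≤ n)
    (o : Orientation ℝ (SymMat n) (Fin (coneDim n)))
    (G : Subgroup (Matrix.SpecialLinearGroup (Fin n) ℤ)) (hfin : G.FiniteIndex)
    (htf : ∀ g ∈ G, IsOfFinOrder g → g = 1)
    (R : Set (PointedCone ℝ (SymMat n))) (hR : IsTileRepresentatives G R)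
    (τ : PointedCone ℝ (SymMat n) → Set (PointedCone ℝ (SymMat n)))
    (hτ : ∀ T ∈ R, IsRegularTriangulation T (τ T))
    (S : Set (PointedCone ℝ (SymMat n))) (hS : S = ⋃ T ∈ R, τ T)
    (w : PointedCone ℝ (SymMat n) → Fin (coneDim n) → NZVec n)
    (hw : ∀ s ∈ S, IsOrientedVertexList o s (w s)) :
    ∃ hSfin : S.Finite, ∃ (N : ℕ) (y : Fin N → Fin (coneDim n) → NZVec n),
      (∀ α, IsFlipon (y α)) ∧
        sharblyCoinvBoundary n (vcd n) G
          (∑ s ∈ hSfin.toFinset, basicSharblyCoinv G (w s) +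
            ∑ α : Fin N, basicSharblyCoinv G (y α)) = 0 := by
  have hn0 : 0 < n := by omega
  have hSfin : S.Finite := hS ▸ finite_iUnion_triangulation hn0 hfin hR fun T hT => (hτ T hT).1
  refine ⟨hSfin, ?_⟩
  rcases S.eq_empty_or_nonempty with rfl | ⟨s₀, hs₀⟩
  · exact ⟨0, Fin.elim0, fun α => α.elim0, by simp⟩
  have : Fintype S := hSfin.fintype
  have ht : 0 < vcd n :=
    Nat.div_pos (Nat.le_trans hn (Nat.le_mul_of_pos_right n (by omega))) two_pos
  obtain ⟨k, hk⟩ : ∃ k, coneDim n = k + 1 := ⟨coneDim n - 1, by unfold coneDim; omega⟩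
  obtain ⟨D, hD⟩ := exists_dissection hn0 hk htf hR (fun T hT => (hτ T hT).1) hS hw
  obtain ⟨a, ha, hbd⟩ := D.exists_normal_bd_chain_eq hn0 (det_symAct_pos hn) htf ⟨s₀, hs₀⟩
  have hdim : Module.finrank ℝ (SymMat n) = coneDim n := by
    rw [Module.finrank_eq_card_basis (D.b ⟨s₀, hs₀⟩), Fintype.card_fin, hk]
  obtain ⟨N, y, hy, hsum⟩ := exists_fin_sum_eq
    (toSharbly_mem_closure_flipon hn hdim G (c := -a) (neg_mem (by rwa [hk])))
  -- The flipons are the classes of the tuples of `-a`, so that the sum is the class of the chain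
  -- `D.chain - a`, the boundary of which has normal form zero.
  refine ⟨N, y, hy, ?_⟩
  have hU0 : ∀ s j, D.U s j ≠ 0 := fun s j => ne_zero_of_mem_minSet (D.mem s j)
  have hz : ∑ s ∈ hSfin.toFinset, basicSharblyCoinv G (w s) = toSharbly (vcd n) G D.chain := by
    rw [Dissection.chain, map_sum, ← Finset.sum_coe_sort hSfin.toFinset]
    rw [← Equiv.sum_comp (Equiv.subtypeEquivRight fun s => hSfin.mem_toFinset.symm)]
    refine Finset.sum_congr rfl fun s _ => ?_
    rw [toSharbly_single, one_smul, symbol_ofFn G hk _ (hU0 s)]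
    exact basicSharblyCoinv_eq_of_smul G (hD s)
  have hchain : D.chain ∈ on (fun l => Admissible l ∧ l.length = n + vcd n) := by
    refine Submodule.sum_mem _ fun s _ => single_mem_on ⟨⟨D.φ s, D.ryshkov s, fun x hx => ?_⟩, ?_⟩ 1
    · obtain ⟨j, rfl⟩ := (List.mem_ofFn' _ _).1 hx
      exact D.mem s j
    · rw [List.length_ofFn]
      exact hk.symm
  have hmem : D.chain + -a ∈ on (fun l => Admissible l ∧ l.length = n + vcd n) :=
    add_mem hchain (neg_mem (on_mono (fun l hl => ⟨hl.1, hl.2.1.trans hk.symm⟩) ha))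
  have hmem' : bd (D.chain + -a) ∈ on Admissible :=
    bd_mem_on (fun l l' hl hs _ => by
      obtain ⟨⟨φ, hφ, h⟩, -⟩ := hl
      exact ⟨φ, hφ, fun x hx => h x (hs.subset hx)⟩) hmem
  rw [hz, hsum, ← map_add, boundary_toSharbly ht G (on_mono (fun l hl => ?_) hmem),
    ← toSharbly_normal _ G hmem', map_add, map_add, map_neg, map_neg, hbd, add_neg_cancel, map_zero]
  obtain ⟨⟨φ, hφ, h⟩, hlen⟩ := hl
  exact ⟨hlen, fun x hx => ne_zero_of_mem_minSet (h x hx)⟩
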